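/- **Theorem 1.** A *diamond* is the graph obtained from the complete graph on four vertices by deleting one edge; a graph is *diamond-free* if it has no induced subgraph isomorphic to the diamond. All graphs are finite, undirected and simple. The *diamond-free editing problem* takes as instance a graph $G$ and an integer $k\ge 0$; $(G,k)$ is a yes-instance if there are a set $E_+$ of non-edges of $G$ and a set $E_-$ of edges of $G$ with $|E_+\cup E_-|\le k$ such that $G+E_+-E_-$ is diamond-free. The diamond-free editing problem has a kernel of $O(k^8)$ vertices. That is, there are a function $g:\mathbb N\to\mathbb N$ with $g(k)=O(k^8)$ as $k\to\infty$ and a polynomial-time algorithm that, given any instance $(G,k)$, outputs an instance $(G',k')$ such that 1. $(G',k')$ is a yes-instance if and only if $(G,k)$ is a yes-instance, 2. $k'\le k$, and 3. $|V(G')|\le g(k)$. Here an algorithm is a program for a random access machine on natural numbers with unit-cost addition, truncated subtraction and indirect addressing. The graph, with vertices numbered $0,\dots,n-1$, is given by $n$ and its adjacency matrix (likewise for the output), and polynomial time means that the number of steps is bounded by a polynomial in $n=|V(G)|$ and the binary length of $k$. -/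

import Mathlib

open Asymptotics Filter
open scoped SimpleGraph

/-! ### Diamond-free editing -/

/-- The diamond: the complete graph on four vertices minus one edge. -/
def diamond : SimpleGraph (Fin 4) :=
  (⊤ : SimpleGraph (Fin 4)).deleteEdges {s(0, 3)}

/-- `G` has no induced subgraph isomorphic to the diamond. -/
def DiamondFree {V : Type*} (G : SimpleGraph V) : Prop :=
  ¬ diamond ⊴ G

/-- `G + E₊ - E₋`: add the edges in `Ep` and delete the edges in `Em`. -/
def editGraph {V : Type*} (G : SimpleGraph V) (Ep Em : Finset (Sym2 V)) : SimpleGraph V :=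
  (G ⊔ SimpleGraph.fromEdgeSet (Ep : Set (Sym2 V))).deleteEdges (Em : Set (Sym2 V))

/-- `(Ep, Em)` is a solution of `(G, k)`: `Ep` consists of non-edges of `G` (unordered pairs of
distinct nonadjacent vertices), `Em` of edges of `G`, together they have at most `k` elements, and
the edited graph is diamond-free. -/
structure IsSolution {V : Type*} [DecidableEq V] (G : SimpleGraph V) (k : ℕ)
    (Ep Em : Finset (Sym2 V)) : Prop where
  added : (Ep : Set (Sym2 V)) ⊆ Gᶜ.edgeSet
  deleted : (Em : Set (Sym2 V)) ⊆ G.edgeSet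
  card_le : (Ep ∪ Em).card ≤ k
  diamondFree : DiamondFree (editGraph G Ep Em)

/-- An instance of an edge modification problem: a finite simple graph, with vertices numbered
`0, …, n - 1`, and the parameter `k`. -/
structure GraphInstance where
  n : ℕ
  graph : SimpleGraph (Fin n)
  k : ℕ

/-- The diamond-free editing problem: `I` is a yes-instance. -/
def DiamondFreeEditing (I : GraphInstance) : Prop :=
  ∃ Ep Em : Finset (Sym2 (Fin I.n)), IsSolution I.graph I.k Ep Em

/-! ### Random access machines with a step count

A structured program for a random access machine.  The machine has registers and a random access
memory, all holding natural numbers; arithmetic is addition and truncated subtraction, and each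
elementary operation costs one time unit.  There is no multiplication or shift, so that in `t` time
units a number grows by at most `O(t)` bits: polynomial time on this machine is polynomial time
on a Turing machine. -/

namespace RAM

/-- A machine state: the contents of the registers and of the memory cells. -/
structure State where
  reg : ℕ → ℕ
  mem : ℕ → ℕ

/-- Expressions: constants, registers, memory cells (indirect addressing), `+` and `∸`. -/
inductive Expr where
  | const (c : ℕ)
  | reg (r : ℕ)
  | load (addr : Expr)
  | add (e₁ e₂ : Expr)
  | sub (e₁ e₂ : Expr)

/-- The value of an expression. -/
def Expr.eval (s : State) : Expr → ℕ
  | .const c => c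
  | .reg r => s.reg r
  | .load a => s.mem (a.eval s)
  | .add e₁ e₂ => e₁.eval s + e₂.eval s
  | .sub e₁ e₂ => e₁.eval s - e₂.eval s

/-- The time to evaluate an expression: one unit for each node of the expression. -/
def Expr.cost : Expr → ℕ
  | .const _ => 1
  | .reg _ => 1
  | .load a => a.cost + 1
  | .add e₁ e₂ => e₁.cost + e₂.cost + 1
  | .sub e₁ e₂ => e₁.cost + e₂.cost + 1

/-- Programs.  A condition `e` holds if the value of `e` is not zero. -/
inductive Program where
  | skip
  | assign (r : ℕ) (e : Expr)
  | store (addr e : Expr)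
  | seq (p q : Program)
  | ite (e : Expr) (p q : Program)
  | loop (e : Expr) (body : Program)

/-- `Runs p s s' t`: the program `p`, started in the state `s`, halts in the state `s'` after
exactly `t` time units.  (Programs are deterministic: `s'` and `t` are unique if they exist.) -/
inductive Runs : Program → State → State → ℕ → Prop where
  | skip (s : State) : Runs .skip s s 1
  | assign (s : State) (r : ℕ) (e : Expr) :
      Runs (.assign r e) s { s with reg := Function.update s.reg r (e.eval s) } (e.cost + 1)
  | store (s : State) (a e : Expr) :
      Runs (.store a e) s { s with mem := Function.update s.mem (a.eval s) (e.eval s) }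
        (a.cost + e.cost + 1)
  | seq {p q : Program} {s s' s'' : State} {t t' : ℕ} :
      Runs p s s' t → Runs q s' s'' t' → Runs (.seq p q) s s'' (t + t')
  | ite_true {e : Expr} {p q : Program} {s s' : State} {t : ℕ} :
      e.eval s ≠ 0 → Runs p s s' t → Runs (.ite e p q) s s' (e.cost + 1 + t)
  | ite_false {e : Expr} {p q : Program} {s s' : State} {t : ℕ} :
      e.eval s = 0 → Runs q s s' t → Runs (.ite e p q) s s' (e.cost + 1 + t)
  | loop_stop {e : Expr} {p : Program} {s : State} :
      e.eval s = 0 → Runs (.loop e p) s s (e.cost + 1)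
  | loop_step {e : Expr} {p : Program} {s s' s'' : State} {t t' : ℕ} :
      e.eval s ≠ 0 → Runs p s s' t → Runs (.loop e p) s' s'' t' →
        Runs (.loop e p) s s'' (e.cost + 1 + t + t')

/-- The state `s` holds the instance `I`: register `0` holds `n`, register `1` holds `k`, and the
first `n * n` memory cells hold the adjacency matrix, row by row. -/
def Holds (s : State) (I : GraphInstance) : Prop :=
  s.reg 0 = I.n ∧ s.reg 1 = I.k ∧
    ∀ i j : Fin I.n, (I.graph.Adj i j → s.mem (i * I.n + j) = 1) ∧
      (¬ I.graph.Adj i j → s.mem (i * I.n + j) = 0)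

/-- `s` is the initial state on input `I`: it holds `I`, and everything else is zero. -/
def IsInitial (s : State) (I : GraphInstance) : Prop :=
  Holds s I ∧ (∀ r, 2 ≤ r → s.reg r = 0) ∧ ∀ a, I.n * I.n ≤ a → s.mem a = 0

/-- `f` is computable in polynomial time: some program computes it within a number of time units
that is bounded by a polynomial in the number of vertices and the binary length of `k`. -/
def ComputableInPolyTime (f : GraphInstance → GraphInstance) : Prop :=
  ∃ (P : Program) (T : Polynomial ℕ), ∀ (I : GraphInstance) (s : State), IsInitial s I →
    ∃ (s' : State) (t : ℕ), Runs P s s' t ∧ Holds s' (f I) ∧ t ≤ T.eval (I.n + Nat.size I.k)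

end RAM

/-! ### Kernels -/

/-- The problem `Q` has a kernel of at most `g k` vertices: a polynomial-time algorithm maps each
instance `(G, k)` to an equivalent instance `(G', k')` with `k' ≤ k` and `|V(G')| ≤ g k`. -/
def HasVertexKernel (Q : GraphInstance → Prop) (g : ℕ → ℕ) : Prop :=
  ∃ f : GraphInstance → GraphInstance, RAM.ComputableInPolyTime f ∧
    ∀ I : GraphInstance, (Q (f I) ↔ Q I) ∧ (f I).k ≤ I.k ∧ (f I).n ≤ g I.k

/-! A solution amounts to a diamond-free graph `H` that differs from `G` in at most `2k` ordered
pairs. Take a maximal packing of diamonds, any two sharing at most two vertices. Every solution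
edits a pair inside each member. A pair contained in more than `2k` members must itself be edited:
otherwise two of these members would share another edited pair, hence three vertices. Such edits are
carried out while `k` is positive, each lowering `k` by one. When none is left, a yes-instance has
at most `4k²` members (`IsPacking.le_of_hasSolution`); a larger packing is answered by a single
diamond with parameter zero.

Let `Y` be the set of vertices of the packing. By maximality, a diamond of `G` has at most one
vertex outside `Y`. For a pair of vertices, keep `2k + 2` of the common neighbours outside `Y`, or
all if there are fewer. Doing this for the pairs inside members gives `B ⊇ Y` with `O(k³)` vertices.
Doing it for the pairs in `B`, and for the pairs `c`, `d` with `c ∈ B` and `d` kept for `c` and some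
vertex of `B`, gives the kernel `M` with `O(k⁸)` vertices. The gain: if a common neighbour was
discarded, a given solution leaves two of the kept ones untouched, and these can take its place in
arguments.

Induced subgraphs inherit solutions, so the content is the extension of a solution from `M` to `G`.
Choose one that is closest to `G[M]` and, among those, adds the fewest edges, and use `G` outside
`M`. Each edge of a diamond-free graph lies in a clique that absorbs every vertex with two
neighbours in it, a bag. By optimality (`IsOptimal.card_lt_two_mul`), in a bag with an added edge
every vertex is adjacent in `G` to more than half of the bag, so a diamond of `G` inside the bag
passes through it (`exists_isDiamond_of_degree`). It follows that added edges stay inside `B` and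
that a removed vertex has at most one neighbour in such a bag (`IsSolved.mem_of_added`,
`IsSolved.false_of_two_neighbors`). Moreover, an edge in a triangle with a removed vertex is never
deleted, since restoring the whole clique around it would be cheaper (`IsSolved.adj_of_removed`).
These facts exclude all diamonds of the patched graph (`IsSolved.noDiamond_patch`).

For the algorithm, the predicates above are written as terms with bounded sums. All loops run up to
`n` or `n⁴`, so the compiled program is polynomial in `n`. If `k ≥ n`, the input is already small
and is returned unchanged. -/

namespace RAM

/-! ### Terms with bounded sums and their compilation -/

def State.setReg (s : State) (r v : ℕ) : State := { s with reg := Function.update s.reg r v }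

def State.setMem (s : State) (a v : ℕ) : State := { s with mem := Function.update s.mem a v }

@[simp] theorem State.setReg_reg_self (s : State) (r v : ℕ) : (s.setReg r v).reg r = v := by
  simp [State.setReg]

theorem State.setReg_reg (s : State) (r v q : ℕ) :
    (s.setReg r v).reg q = if q = r then v else s.reg q := by
  simp [State.setReg, Function.update_apply]

@[simp] theorem State.setReg_reg_of_ne (s : State) {r q : ℕ} (v : ℕ) (h : q ≠ r) :
    (s.setReg r v).reg q = s.reg q := by
  simp [State.setReg, h]

@[simp] theorem State.setReg_mem (s : State) (r v : ℕ) : (s.setReg r v).mem = s.mem := rfl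

@[simp] theorem State.setMem_reg (s : State) (a v : ℕ) : (s.setMem a v).reg = s.reg := rfl

theorem State.setMem_mem (s : State) (a v b : ℕ) :
    (s.setMem a v).mem b = if b = a then v else s.mem b := by
  simp [State.setMem, Function.update_apply]

/-- Terms: expressions with bounded sums; `sum x b t` is the sum of `t` over the values of the
register `x` below the content of the register `b`. -/
inductive Tm where
  | const (c : ℕ)
  | reg (r : ℕ)
  | load (a : Tm)
  | add (a b : Tm)
  | sub (a b : Tm)
  | sum (x b : ℕ) (t : Tm)

namespace Tm

def eval : Tm → State → ℕ
  | const c, _ => c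
  | reg r, s => s.reg r
  | load a, s => s.mem (a.eval s)
  | add a b, s => a.eval s + b.eval s
  | sub a b, s => a.eval s - b.eval s
  | sum x b t, s => ∑ i ∈ Finset.range (s.reg b), t.eval (s.setReg x i)

/-- All registers are below `30`; sums run up to register `0` or `2`, and bind another one. -/
def ok : Tm → Bool
  | const _ => true
  | reg r => decide (r < 30)
  | load a => a.ok
  | add a b => a.ok && b.ok
  | sub a b => a.ok && b.ok
  | sum x b t => decide (x < 30) && (decide (b = 0) || decide (b = 2)) && !decide (x = 0) &&
      !decide (x = 2) && t.ok

/-- Code that evaluates a term into the register `d`, using the registers from `d` on. -/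
def comp : Tm → ℕ → Program
  | const c, d => .assign d (.const c)
  | reg r, d => .assign d (.reg r)
  | load a, d => .seq (a.comp d) (.assign d (.load (.reg d)))
  | add a b, d => .seq (a.comp d) (.seq (b.comp (d + 1)) (.assign d (.add (.reg d) (.reg (d + 1)))))
  | sub a b, d => .seq (a.comp d) (.seq (b.comp (d + 1)) (.assign d (.sub (.reg d) (.reg (d + 1)))))
  | sum x b t, d =>
      .seq (.assign d (.const 0)) (.seq (.assign (d + 1) (.reg x)) (.seq (.assign x (.const 0))
        (.seq (.loop (.sub (.reg b) (.reg x))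
          (.seq (t.comp (d + 2)) (.seq (.assign d (.add (.reg d) (.reg (d + 2))))
            (.assign x (.add (.reg x) (.const 1))))))
        (.assign x (.reg (d + 1))))))

/-- To be evaluated at a common upper bound of the registers `0` and `2`, which bound all sums. The
constants are generous rather than exact. -/
noncomputable def cost : Tm → Polynomial ℕ
  | const _ => 2
  | reg _ => 2
  | load a => a.cost + 3
  | add a b => a.cost + (b.cost + 4)
  | sub a b => a.cost + (b.cost + 4)
  | sum _ _ t => Polynomial.X * (t.cost + 12) + 20

/-- Scratch registers start at `30`, so what compiled code leaves there cannot influence a source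
term. -/
theorem eval_congr {t : Tm} (h : t.ok = true) {s σ : State} (hm : s.mem = σ.mem)
    (hr : ∀ r < 30, s.reg r = σ.reg r) : t.eval s = t.eval σ := by
  induction t generalizing s σ with
  | const c => rfl
  | reg r => exact hr r (by simpa [ok] using h)
  | load a ih => simp only [eval, hm, ih h hm hr]
  | add a b iha ihb =>
    simp only [ok, Bool.and_eq_true] at h
    simp only [eval, iha h.1 hm hr, ihb h.2 hm hr]
  | sub a b iha ihb =>
    simp only [ok, Bool.and_eq_true] at h
    simp only [eval, iha h.1 hm hr, ihb h.2 hm hr]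
  | sum x b t ih =>
    simp only [ok, Bool.and_eq_true, Bool.or_eq_true, decide_eq_true_eq] at h
    have hb : s.reg b = σ.reg b := hr b (by omega)
    simp only [eval, hb]
    refine Finset.sum_congr rfl fun i _ => ih h.2 hm fun r hr' => ?_
    rw [State.setReg_reg, State.setReg_reg, hr r hr']

/-- The code for a term works as on a stack: it writes only from `d` upwards, apart from the bound
variable of a sum, which is saved in `d + 1` and restored. Bound variables are below `30 ≤ d`, so
they never collide with partial results. -/
theorem comp_runs {t : Tm} (h : t.ok = true) {d : ℕ} (hd : 30 ≤ d) {s : State} {Z : ℕ}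
    (h0 : s.reg 0 ≤ Z) (h2 : s.reg 2 ≤ Z) :
    ∃ s' τ, Runs (t.comp d) s s' τ ∧ τ ≤ t.cost.eval Z ∧ s'.mem = s.mem ∧
      s'.reg d = t.eval s ∧ ∀ r < d, s'.reg r = s.reg r := by
  induction t generalizing s d with
  | const c =>
    exact ⟨_, _, .assign _ _ _, by simp [cost, Expr.cost], rfl, by simp [eval, Expr.eval],
      fun r hr => by simp [hr.ne]⟩
  | reg r =>
    exact ⟨_, _, .assign _ _ _, by simp [cost, Expr.cost], rfl, by simp [eval, Expr.eval],
      fun r hr => by simp [hr.ne]⟩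
  | load a ih =>
    obtain ⟨s', τ, hr, hτ, hm, he, hf⟩ := ih h hd h0 h2
    refine ⟨_, _, .seq hr (.assign _ _ _), ?_, hm, ?_, fun r hr => ?_⟩
    · simp [cost, Expr.cost]; omega
    · simp [eval, Expr.eval, he, hm]
    · simp [hr.ne, hf r hr]
  | add a b iha ihb =>
    simp only [ok, Bool.and_eq_true] at h
    obtain ⟨s₁, τ₁, hr₁, hτ₁, hm₁, he₁, hf₁⟩ := iha h.1 hd h0 h2
    obtain ⟨s₂, τ₂, hr₂, hτ₂, hm₂, he₂, hf₂⟩ := ihb h.2 (d := d + 1) (s := s₁) (by omega)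
      (by rw [hf₁ 0 (by omega)]; exact h0) (by rw [hf₁ 2 (by omega)]; exact h2)
    refine ⟨_, _, .seq hr₁ (.seq hr₂ (.assign _ _ _)), ?_, hm₂.trans hm₁, ?_, fun r hr => ?_⟩
    · simp [cost, Expr.cost]; omega
    · simp [eval, Expr.eval, he₂, hf₂ d (by omega), he₁,
        eval_congr h.2 hm₁ fun r hr => hf₁ r (by omega)]
    · simp [hr.ne, hf₂ r (by omega), hf₁ r hr]
  | sub a b iha ihb =>
    simp only [ok, Bool.and_eq_true] at h
    obtain ⟨s₁, τ₁, hr₁, hτ₁, hm₁, he₁, hf₁⟩ := iha h.1 hd h0 h2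
    obtain ⟨s₂, τ₂, hr₂, hτ₂, hm₂, he₂, hf₂⟩ := ihb h.2 (d := d + 1) (s := s₁) (by omega)
      (by rw [hf₁ 0 (by omega)]; exact h0) (by rw [hf₁ 2 (by omega)]; exact h2)
    refine ⟨_, _, .seq hr₁ (.seq hr₂ (.assign _ _ _)), ?_, hm₂.trans hm₁, ?_, fun r hr => ?_⟩
    · simp [cost, Expr.cost]; omega
    · simp [eval, Expr.eval, he₂, hf₂ d (by omega), he₁,
        eval_congr h.2 hm₁ fun r hr => hf₁ r (by omega)]
    · simp [hr.ne, hf₂ r (by omega), hf₁ r hr]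
  | sum x b t ih =>
    simp only [ok, Bool.and_eq_true, Bool.or_eq_true, decide_eq_true_eq, Bool.not_eq_true',
      decide_eq_false_iff_not] at h
    obtain ⟨⟨⟨⟨hx, hb⟩, hx0⟩, hx2⟩, ht⟩ := h
    have hb30 : b < 30 := by omega
    have hxb : b ≠ x := by omega
    -- Loop invariant with `i` rounds done and `m` to go: register `d` holds the partial sum, `d +
    -- 1` the saved bound variable.
    have key : ∀ m i σ, i + m = s.reg b → σ.mem = s.mem → σ.reg x = i →
        σ.reg d = ∑ j ∈ Finset.range i, t.eval (s.setReg x j) → σ.reg (d + 1) = s.reg x →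
        (∀ r < d, r ≠ x → σ.reg r = s.reg r) →
        ∃ σ' τ, Runs (.loop (.sub (.reg b) (.reg x))
            (.seq (t.comp (d + 2)) (.seq (.assign d (.add (.reg d) (.reg (d + 2))))
            (.assign x (.add (.reg x) (.const 1)))))) σ σ' τ ∧
          τ ≤ m * (t.cost.eval Z + 12) + 4 ∧ σ'.mem = s.mem ∧
          σ'.reg d = ∑ j ∈ Finset.range (s.reg b), t.eval (s.setReg x j) ∧
          σ'.reg (d + 1) = s.reg x ∧ ∀ r < d, r ≠ x → σ'.reg r = s.reg r := by
      intro m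
      induction m with
      | zero =>
        intro i σ hi hm hσx hσd hσd1 hσ
        refine ⟨_, _, Runs.loop_stop ?_, ?_, hm, ?_, hσd1, hσ⟩
        · simp [Expr.eval, hσ b (by omega) hxb, hσx]; omega
        · simp [Expr.cost]
        · rw [hσd, ← hi]; simp
      | succ m ihm =>
        intro i σ hi hm hσx hσd hσd1 hσ
        obtain ⟨s₁, τ₁, hr₁, hτ₁, hm₁, he₁, hf₁⟩ := ih ht (d := d + 2) (s := σ) (by omega)
          (by rw [hσ 0 (by omega) (by omega)]; exact h0)
          (by rw [hσ 2 (by omega) (by omega)]; exact h2)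
        set s₂ := s₁.setReg d (s₁.reg d + s₁.reg (d + 2)) with hs₂
        set s₃ := s₂.setReg x (s₂.reg x + 1) with hs₃
        obtain ⟨σ', τ, hr, hτ, hrest⟩ := ihm (i + 1) s₃ (by omega) (by simp [hs₃, hs₂, hm₁, hm])
          (by
            have : x ≠ d := by omega
            simp [hs₃, hs₂, this, hf₁ x (by omega), hσx])
          (by
            have : d ≠ x := by omega
            rw [Finset.sum_range_succ, ← hσd]
            simp only [hs₃, hs₂, State.setReg_reg_of_ne _ _ this, State.setReg_reg_self,
              hf₁ d (by omega), he₁]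
            congr 1
            refine eval_congr ht hm fun r hr => ?_
            rw [State.setReg_reg]
            split_ifs with hrx
            · rw [hrx, hσx]
            · exact hσ r (by omega) hrx)
          (by
            have h1 : d + 1 ≠ x := by omega
            simp [hs₃, hs₂, h1, hf₁ (d + 1) (by omega), hσd1])
          (by
            intro r hr hrx
            simp [hs₃, hs₂, hrx, hr.ne, hf₁ r (by omega), hσ r hr hrx])
        refine ⟨σ', _, .loop_step (s' := s₃) ?_ (.seq hr₁ (.seq (.assign _ _ _) (.assign _ _ _))) hr,
          ?_, hrest⟩
        · simp [Expr.eval, hσ b (by omega) hxb, hσx]; omega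
        · simp only [Expr.cost]
          have : (m + 1) * (t.cost.eval Z + 12) = m * (t.cost.eval Z + 12) + t.cost.eval Z + 12 := by
            ring
          omega
    have hxd : x ≠ d := by omega
    have hxd1 : x ≠ d + 1 := by omega
    obtain ⟨σ', τ, hr, hτ, hm, he, hx', hrest⟩ := key (s.reg b) 0
      (((s.setReg d 0).setReg (d + 1) (s.reg x)).setReg x 0) (by simp) rfl (by simp)
      (by simp [hxd.symm]) (by simp [hxd1.symm]) (by
        intro r hr hrx
        have : r ≠ d + 1 := by omega
        simp [hrx, hr.ne, this])
    have hs : (((s.setReg d 0).setReg (d + 1) (s.reg x)).setReg x 0) =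
        (((s.setReg d 0).setReg (d + 1) ((s.setReg d 0).reg x)).setReg x 0) := by
      rw [State.setReg_reg_of_ne _ _ hxd]
    rw [hs] at hr
    refine ⟨_, _, .seq (.assign _ _ _) (.seq (.assign _ _ _) (.seq (.assign _ _ _)
      (.seq hr (.assign _ _ _)))), ?_, ?_, ?_, ?_⟩
    · have hle : s.reg b * (t.cost.eval Z + 12) ≤ Z * (t.cost.eval Z + 12) :=
        Nat.mul_le_mul_right _ (by rcases hb with rfl | rfl <;> assumption)
      simp [cost, Expr.cost]; omega
    · exact hm
    · simp [hxd.symm, he, eval]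
    · intro r hr
      simp only [Function.update_apply]
      split_ifs with hrx
      · rw [hrx]; exact hx'
      · exact hrest r hr hrx

end Tm

/-! ### Commands with bounded loops and their compilation -/

/-- Structured commands with terms and bounded loops. -/
inductive Cmd where
  | skip
  | assign (r : ℕ) (t : Tm)
  | store (a t : Tm)
  | seq (c₁ c₂ : Cmd)
  | ite (t : Tm) (c₁ c₂ : Cmd)
  | iterate (x b : ℕ) (c : Cmd)

/-- `s` after `f` with the register `x` running through `0, …, n - 1`. -/
def iter (x : ℕ) (f : State → State) (s : State) : ℕ → State
  | 0 => s
  | n + 1 => f ((iter x f s n).setReg x n)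

namespace Cmd

def denote : Cmd → State → State
  | skip, s => s
  | assign r t, s => s.setReg r (t.eval s)
  | store a t, s => s.setMem (a.eval s) (t.eval s)
  | seq c₁ c₂, s => c₂.denote (c₁.denote s)
  | ite t c₁ c₂, s => if t.eval s ≠ 0 then c₁.denote s else c₂.denote s
  | .iterate x b c, s => (iter x c.denote s (s.reg b)).setReg x (s.reg b)

/-- The registers in `l` are not assigned. -/
def ok : Cmd → List ℕ → Bool
  | skip, _ => true
  | assign r t, l => decide (r < 30) && !decide (r ∈ l) && t.ok
  | store a t, _ => a.ok && t.ok
  | seq c₁ c₂, l => c₁.ok l && c₂.ok l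
  | ite t c₁ c₂, l => t.ok && c₁.ok l && c₂.ok l
  | .iterate x b c, l => decide (x < 30) && (decide (b = 0) || decide (b = 2)) && !decide (x ∈ l) &&
      c.ok (x :: l)

def comp : Cmd → Program
  | skip => .skip
  | assign r t => .seq (t.comp 30) (.assign r (.reg 30))
  | store a t => .seq (a.comp 30) (.seq (t.comp 31) (.store (.reg 30) (.reg 31)))
  | seq c₁ c₂ => .seq c₁.comp c₂.comp
  | ite t c₁ c₂ => .seq (t.comp 30) (.ite (.reg 30) c₁.comp c₂.comp)
  | .iterate x b c => .seq (.assign x (.const 0)) (.loop (.sub (.reg b) (.reg x))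
      (.seq c.comp (.assign x (.add (.reg x) (.const 1)))))

noncomputable def cost : Cmd → Polynomial ℕ
  | skip => 1
  | assign _ t => t.cost + 2
  | store a t => a.cost + (t.cost + 3)
  | seq c₁ c₂ => c₁.cost + c₂.cost
  | ite t c₁ c₂ => t.cost + (2 + (c₁.cost + c₂.cost))
  | .iterate _ _ c => Polynomial.X * (c.cost + 8) + 6

/-- Needed to know that a loop body changes neither its own counter nor the loop bounds in the
registers `0` and `2`. -/
theorem denote_reg_of_mem {c : Cmd} {l : List ℕ} (h : c.ok l = true) {r : ℕ} (hr : r ∈ l)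
    (s : State) : (c.denote s).reg r = s.reg r := by
  induction c generalizing l s with
  | skip => rfl
  | assign q t =>
    simp only [ok, Bool.and_eq_true, Bool.not_eq_true', decide_eq_false_iff_not] at h
    exact State.setReg_reg_of_ne _ _ fun e => h.1.2 (e ▸ hr)
  | store a t => rfl
  | seq c₁ c₂ ih₁ ih₂ =>
    simp only [ok, Bool.and_eq_true] at h
    exact (ih₂ h.2 hr _).trans (ih₁ h.1 hr _)
  | ite t c₁ c₂ ih₁ ih₂ =>
    simp only [ok, Bool.and_eq_true] at h
    simp only [denote]
    split_ifs
    exacts [ih₁ h.1.2 hr _, ih₂ h.2 hr _]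
  | iterate x b c ih =>
    simp only [ok, Bool.and_eq_true, Bool.not_eq_true', decide_eq_false_iff_not] at h
    have hne : r ≠ x := fun e => h.1.2 (e ▸ hr)
    have : ∀ n, (iter x c.denote s n).reg r = s.reg r := by
      intro n
      induction n with
      | zero => rfl
      | succ n ihn => rw [iter, ih h.2 (List.mem_cons_of_mem _ hr), State.setReg_reg_of_ne _ _ hne, ihn]
    simp only [denote]
    rw [State.setReg_reg_of_ne _ _ hne, this]

/-- The machine state `s` and the abstract state `σ` need agree only on memory and on the registers
below `30`. Since the registers `0` and `2` are protected, one bound `Z` on their initial contents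
controls every loop. -/
theorem comp_runs {c : Cmd} {l : List ℕ} (h : c.ok l = true) (hl0 : 0 ∈ l) (hl2 : 2 ∈ l)
    {s σ : State} {Z : ℕ} (hm : s.mem = σ.mem) (hr : ∀ r < 30, s.reg r = σ.reg r)
    (h0 : σ.reg 0 ≤ Z) (h2 : σ.reg 2 ≤ Z) :
    ∃ s' τ, Runs c.comp s s' τ ∧ τ ≤ c.cost.eval Z ∧ s'.mem = (c.denote σ).mem ∧
      ∀ r < 30, s'.reg r = (c.denote σ).reg r := by
  induction c generalizing l s σ with
  | skip => exact ⟨s, 1, .skip s, by simp [cost], hm, hr⟩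
  | assign q t =>
    simp only [ok, Bool.and_eq_true] at h
    obtain ⟨s₁, τ₁, hr₁, hτ₁, hm₁, he₁, hf₁⟩ := Tm.comp_runs h.2 le_rfl (s := s) (Z := Z)
      (by rw [hr 0 (by omega)]; exact h0) (by rw [hr 2 (by omega)]; exact h2)
    refine ⟨_, _, .seq hr₁ (.assign _ _ _), ?_, hm₁.trans hm, fun r hr' => ?_⟩
    · simp [cost, Expr.cost]; omega
    · simp only [denote, State.setReg_reg, Function.update_apply, Expr.eval, he₁,
        Tm.eval_congr h.2 hm hr]
      split_ifs
      · rfl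
      · rw [hf₁ r hr', hr r hr']
  | store a t =>
    simp only [ok, Bool.and_eq_true] at h
    obtain ⟨s₁, τ₁, hr₁, hτ₁, hm₁, he₁, hf₁⟩ := Tm.comp_runs h.1 le_rfl (s := s) (Z := Z)
      (by rw [hr 0 (by omega)]; exact h0) (by rw [hr 2 (by omega)]; exact h2)
    obtain ⟨s₂, τ₂, hr₂, hτ₂, hm₂, he₂, hf₂⟩ := Tm.comp_runs h.2 (d := 31) (by omega) (s := s₁)
      (Z := Z) (by rw [hf₁ 0 (by omega), hr 0 (by omega)]; exact h0)
      (by rw [hf₁ 2 (by omega), hr 2 (by omega)]; exact h2)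
    refine ⟨_, _, .seq hr₁ (.seq hr₂ (.store _ _ _)), ?_, ?_, fun r hr' => ?_⟩
    · simp [cost, Expr.cost]; omega
    · simp only [denote, State.setMem, Expr.eval, he₂, hf₂ 30 (by omega), he₁, hm₂, hm₁, hm,
        Tm.eval_congr h.1 hm hr,
        Tm.eval_congr h.2 (hm₁.trans hm) fun r hr' => (hf₁ r hr').trans (hr r hr')]
    · simp only [denote, State.setMem_reg]
      rw [hf₂ r (by omega), hf₁ r hr', hr r hr']
  | seq c₁ c₂ ih₁ ih₂ =>
    simp only [ok, Bool.and_eq_true] at h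
    obtain ⟨s₁, τ₁, hr₁, hτ₁, hm₁, hf₁⟩ := ih₁ h.1 hl0 hl2 hm hr h0 h2
    obtain ⟨s₂, τ₂, hr₂, hτ₂, hm₂, hf₂⟩ := ih₂ h.2 hl0 hl2 hm₁ hf₁
      (by rw [denote_reg_of_mem h.1 hl0]; exact h0) (by rw [denote_reg_of_mem h.1 hl2]; exact h2)
    exact ⟨s₂, _, .seq hr₁ hr₂, by simp [cost]; omega, hm₂, hf₂⟩
  | ite t c₁ c₂ ih₁ ih₂ =>
    simp only [ok, Bool.and_eq_true] at h
    obtain ⟨s₁, τ₁, hr₁, hτ₁, hm₁, he₁, hf₁⟩ := Tm.comp_runs h.1.1 le_rfl (s := s) (Z := Z)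
      (by rw [hr 0 (by omega)]; exact h0) (by rw [hr 2 (by omega)]; exact h2)
    rw [Tm.eval_congr h.1.1 hm hr] at he₁
    by_cases hc : t.eval σ = 0
    · obtain ⟨s₂, τ₂, hr₂, hτ₂, hm₂, hf₂⟩ := ih₂ h.2 hl0 hl2 (hm₁.trans hm)
        (fun r hr' => (hf₁ r hr').trans (hr r hr')) h0 h2
      refine ⟨s₂, _, .seq hr₁ (.ite_false (by simpa [Expr.eval, he₁] using hc) hr₂), ?_, ?_, ?_⟩
      · simp [cost, Expr.cost]; omega
      · simp [denote, hc, hm₂]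
      · simpa [denote, hc] using hf₂
    · obtain ⟨s₂, τ₂, hr₂, hτ₂, hm₂, hf₂⟩ := ih₁ h.1.2 hl0 hl2 (hm₁.trans hm)
        (fun r hr' => (hf₁ r hr').trans (hr r hr')) h0 h2
      refine ⟨s₂, _, .seq hr₁ (.ite_true (by simpa [Expr.eval, he₁] using hc) hr₂), ?_, ?_, ?_⟩
      · simp [cost, Expr.cost]; omega
      · simp [denote, hc, hm₂]
      · simpa [denote, hc] using hf₂
  | iterate x b c ih =>
    simp only [ok, Bool.and_eq_true, Bool.or_eq_true, decide_eq_true_eq, Bool.not_eq_true',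
      decide_eq_false_iff_not] at h
    obtain ⟨⟨⟨hx, hb⟩, hxl⟩, hc⟩ := h
    have hbl : b ∈ l := by rcases hb with rfl | rfl <;> assumption
    have hbx : b ≠ x := fun e => hxl (e ▸ hbl)
    have hiter : ∀ r ∈ l, ∀ n, (iter x c.denote σ n).reg r = σ.reg r := by
      intro r hrl n
      have hne : r ≠ x := fun e => hxl (e ▸ hrl)
      induction n with
      | zero => rfl
      | succ n ihn =>
        rw [iter, denote_reg_of_mem hc (List.mem_cons_of_mem _ hrl), State.setReg_reg_of_ne _ _ hne,
          ihn]
    -- The machine is compared with the abstract state after `i` rounds, with `m` rounds to go.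
    have key : ∀ m i q, i + m = σ.reg b → q.mem = (iter x c.denote σ i).mem →
        (∀ r < 30, q.reg r = ((iter x c.denote σ i).setReg x i).reg r) →
        ∃ q' τ, Runs (.loop (.sub (.reg b) (.reg x))
            (.seq c.comp (.assign x (.add (.reg x) (.const 1))))) q q' τ ∧
          τ ≤ m * (c.cost.eval Z + 8) + 4 ∧ q'.mem = (iter x c.denote σ (σ.reg b)).mem ∧
          ∀ r < 30, q'.reg r = ((iter x c.denote σ (σ.reg b)).setReg x (σ.reg b)).reg r := by
      intro m
      induction m with
      | zero =>
        intro i q hi hqm hq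
        have hi' : i = σ.reg b := by omega
        refine ⟨q, _, Runs.loop_stop ?_, ?_, by rw [hqm, hi'], by rw [hi'] at hq; exact hq⟩
        · simp [Expr.eval, hq b (by omega), hq x hx, hbx, hiter b hbl]; omega
        · simp [Expr.cost]
      | succ m ihm =>
        intro i q hi hqm hq
        obtain ⟨s₁, τ₁, hr₁, hτ₁, hm₁, hf₁⟩ := ih hc (s := q) (σ := (iter x c.denote σ i).setReg x i)
          (List.mem_cons_of_mem _ hl0) (List.mem_cons_of_mem _ hl2) hqm hq
          (by
            rw [State.setReg_reg_of_ne _ _ fun e : 0 = x => hxl (e ▸ hl0), hiter 0 hl0]; exact h0)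
          (by
            rw [State.setReg_reg_of_ne _ _ fun e : 2 = x => hxl (e ▸ hl2), hiter 2 hl2]; exact h2)
        have hs₁x : s₁.reg x = i := by
          rw [hf₁ x hx, denote_reg_of_mem hc List.mem_cons_self, State.setReg_reg_self]
        obtain ⟨q', τ, hr, hτ, hrest⟩ := ihm (i + 1) (s₁.setReg x (s₁.reg x + 1)) (by omega) hm₁
          (by
            intro r hr
            rw [State.setReg_reg, State.setReg_reg, hs₁x, hf₁ r hr, iter])
        refine ⟨q', _, .loop_step (s' := s₁.setReg x (s₁.reg x + 1)) ?_
          (.seq hr₁ (.assign _ _ _)) hr, ?_, hrest⟩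
        · simp [Expr.eval, hq b (by omega), hq x hx, hbx, hiter b hbl]; omega
        · have : (m + 1) * (c.cost.eval Z + 8) = m * (c.cost.eval Z + 8) + c.cost.eval Z + 8 := by
            ring
          simp only [Expr.cost]
          omega
    obtain ⟨q', τ, hrun, hτ, hm', hf'⟩ := key (σ.reg b) 0 (s.setReg x 0) (by simp) hm (by
      intro r hr'
      rw [State.setReg_reg, State.setReg_reg, hr r hr', iter])
    refine ⟨q', _, .seq (.assign _ _ _) hrun, ?_, hm', hf'⟩
    have hle : σ.reg b * (c.cost.eval Z + 8) ≤ Z * (c.cost.eval Z + 8) :=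
      Nat.mul_le_mul_right _ (by rcases hb with rfl | rfl <;> assumption)
    simp [cost, Expr.cost]; omega

end Cmd
end RAM

/-! ### Optimal diamond-free graphs and their bags -/

section DiamondFreeCompletion

set_option linter.unusedSectionVars false

open Classical Finset

variable {V : Type*} [Fintype V] [DecidableEq V]

/-- Two triangles on a common edge span a complete graph. -/
def NoDiamond {V : Type*} (H : SimpleGraph V) : Prop :=
  ∀ ⦃a b c d⦄, H.Adj a b → H.Adj a c → H.Adj b c → H.Adj a d → H.Adj b d → c ≠ d → H.Adj c d

/-- `a, b, c, d` induce a diamond whose missing edge is `cd`. -/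
def IsDiamond {V : Type*} (G : SimpleGraph V) (a b c d : V) : Prop :=
  G.Adj a b ∧ G.Adj a c ∧ G.Adj b c ∧ G.Adj a d ∧ G.Adj b d ∧ c ≠ d ∧ ¬ G.Adj c d

/-- The ordered pairs on which `G` and `H` differ. -/
noncomputable def diffPairs (G H : SimpleGraph V) : Finset (V × V) :=
  univ.filter fun p => ¬ (H.Adj p.1 p.2 ↔ G.Adj p.1 p.2)

/-- The ordered pairs that are adjacent in `H` but not in `G`. -/
noncomputable def addPairs (G H : SimpleGraph V) : Finset (V × V) :=
  univ.filter fun p => H.Adj p.1 p.2 ∧ ¬ G.Adj p.1 p.2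

theorem mem_diffPairs {G H : SimpleGraph V} {p : V × V} :
    p ∈ diffPairs G H ↔ ¬ (H.Adj p.1 p.2 ↔ G.Adj p.1 p.2) := by simp [diffPairs]

theorem mem_addPairs {G H : SimpleGraph V} {p : V × V} :
    p ∈ addPairs G H ↔ H.Adj p.1 p.2 ∧ ¬ G.Adj p.1 p.2 := by simp [addPairs]

/-- Among the diamond-free graphs with all edges in `M`, `H` is closest to `G`, and among the
closest ones it addPairs the fewest edges. -/
structure IsOptimal (G H : SimpleGraph V) (M : Finset V) : Prop where
  noDiamond : NoDiamond H
  supp : ∀ ⦃a b⦄, H.Adj a b → a ∈ M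
  card_le : ∀ H', NoDiamond H' → (∀ ⦃a b⦄, H'.Adj a b → a ∈ M) →
    (diffPairs G H).card ≤ (diffPairs G H').card
  adds_le : ∀ H', NoDiamond H' → (∀ ⦃a b⦄, H'.Adj a b → a ∈ M) →
    (diffPairs G H').card ≤ (diffPairs G H).card → (addPairs G H).card ≤ (addPairs G H').card

theorem exists_isOptimal (G H : SimpleGraph V) (M : Finset V) (h : NoDiamond H)
    (hM : ∀ ⦃a b⦄, H.Adj a b → a ∈ M) :
    ∃ H', IsOptimal G H' M ∧ (diffPairs G H').card ≤ (diffPairs G H).card := by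
  set S : Set (SimpleGraph V) := {K | NoDiamond K ∧ ∀ ⦃a b⦄, K.Adj a b → a ∈ M}
  obtain ⟨m, hm⟩ := WellFounded.has_min (measure fun K => (diffPairs G K).card).wf S ⟨H, h, hM⟩
  have hm1 : ∀ K ∈ S, (diffPairs G m).card ≤ (diffPairs G K).card := fun K hK => not_lt.mp (hm.2 K hK)
  obtain ⟨p, hp, hpm⟩ := WellFounded.has_min (measure fun K => (addPairs G K).card).wf
    {K | K ∈ S ∧ (diffPairs G K).card ≤ (diffPairs G m).card} ⟨m, hm.1, le_rfl⟩
  refine ⟨p, ⟨hp.1.1, hp.1.2, fun K h1 h2 => hp.2.trans (hm1 K ⟨h1, h2⟩), fun K h1 h2 h3 => ?_⟩,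
    hp.2.trans (hm1 H ⟨h, hM⟩)⟩
  exact not_lt.mp (hpm K ⟨⟨h1, h2⟩, h3.trans hp.2⟩)

/-- A clique that contains every vertex with two neighbours in it. -/
structure IsBag (H : SimpleGraph V) (Q : Finset V) : Prop where
  clique : ∀ ⦃a⦄, a ∈ Q → ∀ ⦃b⦄, b ∈ Q → a ≠ b → H.Adj a b
  closed : ∀ ⦃x a b⦄, a ∈ Q → b ∈ Q → a ≠ b → H.Adj x a → H.Adj x b → x ∈ Q

/-- Take `z`, `w` and their common neighbours. Two common neighbours are adjacent because of their
triangles on `zw`; the same argument, moved along edges of the clique, shows that a vertex with two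
neighbours in it is adjacent to both `z` and `w`. -/
theorem NoDiamond.exists_isBag {H : SimpleGraph V} (h : NoDiamond H) {z w : V} (hzw : H.Adj z w) :
    ∃ Q, IsBag H Q ∧ z ∈ Q ∧ w ∈ Q := by
  refine ⟨univ.filter fun x => x = z ∨ x = w ∨ H.Adj z x ∧ H.Adj w x, ⟨?_, ?_⟩, by simp, by simp⟩
  · intro a ha b hb hab
    simp only [mem_filter, mem_univ, true_and] at ha hb
    rcases ha with rfl | rfl | ⟨ha1, ha2⟩ <;> rcases hb with rfl | rfl | ⟨hb1, hb2⟩ <;>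
      first
      | exact absurd rfl hab
      | exact hzw
      | exact hzw.symm
      | assumption
      | (apply SimpleGraph.Adj.symm; assumption)
      | exact h hzw ha1 ha2 hb1 hb2 hab
  · intro x a b ha hb hab hxa hxb
    simp only [mem_filter, mem_univ, true_and] at ha hb ⊢
    by_cases hxz : x = z
    · exact Or.inl hxz
    by_cases hxw : x = w
    · exact Or.inr (Or.inl hxw)
    have main : ∀ a, a ≠ z → a ≠ w → H.Adj z a → H.Adj w a → ∀ b, b ≠ a →
        (b = z ∨ b = w ∨ H.Adj z b ∧ H.Adj w b) → H.Adj x a → H.Adj x b →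
        H.Adj z x ∧ H.Adj w x := by
      intro a haz haw h1 h2 b hba hb hxa hxb
      rcases hb with rfl | rfl | ⟨h3, h4⟩
      · exact ⟨hxb.symm, h h1 hzw h2.symm hxb.symm hxa.symm (Ne.symm hxw)⟩
      · exact ⟨h h2 hzw.symm h1.symm hxb.symm hxa.symm (Ne.symm hxz), hxb.symm⟩
      · have hab := h hzw h1 h2 h3 h4 (Ne.symm hba)
        exact ⟨h hab h1.symm h3.symm hxa.symm hxb.symm (Ne.symm hxz),
          h hab h2.symm h4.symm hxa.symm hxb.symm (Ne.symm hxw)⟩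
    right; right
    by_cases haz : a = z
    · subst haz
      by_cases hbw : b = w
      · subst hbw; exact ⟨hxa.symm, hxb.symm⟩
      · rcases hb with hb | hb | hb
        · exact absurd hb.symm hab
        · exact absurd hb hbw
        · exact main b (Ne.symm hab) hbw hb.1 hb.2 a hab (Or.inl rfl) hxb hxa
    · by_cases haw : a = w
      · subst haw
        by_cases hbz : b = z
        · subst hbz; exact ⟨hxb.symm, hxa.symm⟩
        · rcases hb with hb | hb | hb
          · exact absurd hb hbz
          · exact absurd hb.symm hab
          · exact main b hbz (Ne.symm hab) hb.1 hb.2 a hab (Or.inr (Or.inl rfl)) hxb hxa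
      · rcases ha with ha | ha | ha
        · exact absurd ha haz
        · exact absurd ha haw
        · exact main a haz haw ha.1 ha.2 b (Ne.symm hab) hb hxa hxb

/-- The ordered pairs formed by `u` and a vertex of `A`. -/
def starPairs (u : V) (A : Finset V) : Finset (V × V) := {u} ×ˢ A ∪ A ×ˢ {u}

theorem mem_starPairs {u : V} {A : Finset V} {p : V × V} :
    p ∈ starPairs u A ↔ p.1 = u ∧ p.2 ∈ A ∨ p.1 ∈ A ∧ p.2 = u := by
  obtain ⟨a, b⟩ := p
  simp only [starPairs, mem_union, mem_product, mem_singleton]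

theorem card_starPairs {u : V} {A : Finset V} (h : u ∉ A) : (starPairs u A).card = 2 * A.card := by
  rw [starPairs, card_union_of_disjoint, card_product, card_product]
  · simp; ring
  · rw [disjoint_left]
    rintro ⟨a, b⟩ h1 h2
    simp only [mem_product, mem_singleton] at h1 h2
    exact h (h1.1 ▸ h2.1)

/-- The graph `H` without the edges from `u` to the vertices of `R`. -/
def cutStar {V : Type*} (H : SimpleGraph V) (u : V) (R : Finset V) : SimpleGraph V where
  Adj a b := H.Adj a b ∧ ¬ (a = u ∧ b ∈ R) ∧ ¬ (b = u ∧ a ∈ R)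
  symm := ⟨fun _ _ h => ⟨h.1.symm, h.2.2, h.2.1⟩⟩
  loopless := ⟨fun a h => H.loopless.irrefl a h.1⟩

/-- In a bag of an optimal solution, a vertex is adjacent to more than half of the bag. -/
theorem IsOptimal.card_lt_two_mul {G H : SimpleGraph V} {M Q : Finset V} (h : IsOptimal G H M)
    (hQ : IsBag H Q) {u z : V} (hu : u ∈ Q) (hz : z ∈ Q) (huz : u ≠ z) (hG : ¬ G.Adj u z) :
    Q.card + 1 ≤ 2 * (Q.filter fun x => G.Adj u x).card := by
  by_contra hlt
  set N := Q.filter fun x => G.Adj u x with hN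
  set A := (Q.erase u).filter fun x => ¬ G.Adj u x with hA
  have hcard : N.card + A.card + 1 = Q.card := by
    have h1 : N = (Q.erase u).filter fun x => G.Adj u x := by
      ext x
      simp only [hN, mem_filter, mem_erase]
      constructor
      · rintro ⟨h1, h2⟩; exact ⟨⟨h2.ne', h1⟩, h2⟩
      · rintro ⟨h1, h2⟩; exact ⟨h1.2, h2⟩
    rw [h1, hA, card_filter_add_card_filter_not, card_erase_add_one hu]
  have hzA : z ∈ A := by simp [hA, hz, huz.symm, hG]
  -- The plan is to cut `u` off from the bag except for at most one `G`-neighbour, the element of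
  -- `K`. If `u` has at most half of the bag as neighbours, the `|N \ K|` new deletions are paid for
  -- by the `|A|` additions that are undone.
  obtain ⟨K, hKN, hK1, hKA⟩ : ∃ K ⊆ N, K.card ≤ 1 ∧ (N \ K).card ≤ A.card := by
    rcases N.eq_empty_or_nonempty with he | ⟨x, hx⟩
    · exact ⟨∅, by simp, by simp, by simp [he]⟩
    · refine ⟨{x}, by simpa using hx, by simp, ?_⟩
      have := card_sdiff_add_card_eq_card (singleton_subset_iff.mpr hx)
      simp only [card_singleton] at this
      omega
  have huN : u ∉ N := by simp [hN]
  have huA : u ∉ A := by simp [hA]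
  set R := (Q.erase u) \ K with hR
  set H' := cutStar H u R with hH'
  have hdf : NoDiamond H' := by
    intro a b c d hab hac hbc had hbd hcd
    have hH := h.noDiamond hab.1 hac.1 hbc.1 had.1 hbd.1 hcd
    by_contra hcon
    have hcut : (c = u ∧ d ∈ R) ∨ (d = u ∧ c ∈ R) := by
      by_contra hne
      rw [not_or] at hne
      exact hcon ⟨hH, hne.1, hne.2⟩
    -- A diamond created by cutting `ud` has two adjacent vertices `a`, `b` that are joined to `u`
    -- and `d`. They lie in the bag and are not cut off, so both belong to `K`, which has at most
    -- one element.
    have main : ∀ d, d ∈ R → H.Adj a u → H.Adj b u → H.Adj a d → H.Adj b d → H.Adj a b →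
        ¬ (a ∈ R) → ¬ (b ∈ R) → False := by
      intro d hd hau hbu had hbd hab haR hbR
      have hdQ : d ∈ Q ∧ u ≠ d := by
        simp only [hR, Finset.mem_sdiff, mem_erase] at hd; exact ⟨hd.1.2, Ne.symm hd.1.1⟩
      have haQ : a ∈ Q := hQ.closed hu hdQ.1 hdQ.2 hau had
      have hbQ : b ∈ Q := hQ.closed hu hdQ.1 hdQ.2 hbu hbd
      have haK : a ∈ K := by
        by_contra hk; exact haR (by simp [hR, haQ, hau.ne, hk])
      have hbK : b ∈ K := by
        by_contra hk; exact hbR (by simp [hR, hbQ, hbu.ne, hk])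
      exact hab.ne (card_le_one.mp hK1 a haK b hbK)
    rcases hcut with ⟨rfl, hdR⟩ | ⟨rfl, hcR⟩
    · exact main d hdR hac.1 hbc.1 had.1 hbd.1 hab.1 (fun hh => hac.2.2 ⟨rfl, hh⟩)
        (fun hh => hbc.2.2 ⟨rfl, hh⟩)
    · exact main c hcR had.1 hbd.1 hac.1 hbc.1 hab.1 (fun hh => had.2.2 ⟨rfl, hh⟩)
        (fun hh => hbd.2.2 ⟨rfl, hh⟩)
  have hsupp : ∀ ⦃a b⦄, H'.Adj a b → a ∈ M := fun a b hab => h.supp hab.1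
  have hAdiff : starPairs u A ⊆ diffPairs G H := by
    rintro ⟨a, b⟩ hp
    simp only [mem_starPairs, hA, mem_filter, mem_erase] at hp
    rw [mem_diffPairs]
    rcases hp with ⟨rfl, ⟨h1, h2⟩, h3⟩ | ⟨⟨⟨h1, h2⟩, h3⟩, rfl⟩
    · simp only [h3, iff_false, not_not]; exact hQ.clique hu h2 (Ne.symm h1)
    · have h3' : ¬ G.Adj a b := fun e => h3 e.symm
      simp only [h3', iff_false, not_not]; exact hQ.clique h2 hu h1
  have hd : diffPairs G H' ⊆ (diffPairs G H \ starPairs u A) ∪ starPairs u (N \ K) := by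
    rintro ⟨a, b⟩ hp
    rw [mem_diffPairs] at hp
    simp only [mem_union, Finset.mem_sdiff, mem_diffPairs, mem_starPairs]
    by_cases hc : (a = u ∧ b ∈ R) ∨ (b = u ∧ a ∈ R)
    · have hH'n : ¬ H'.Adj a b := by
        rintro ⟨-, h1, h2⟩; exact hc.elim h1 h2
      have hGab : G.Adj a b := by
        by_contra hg; exact hp (by simp [hH'n, hg])
      right
      rcases hc with ⟨rfl, hb⟩ | ⟨rfl, ha⟩
      · left
        simp only [hR, Finset.mem_sdiff, mem_erase] at hb
        exact ⟨rfl, by simp [hN, hb.1.2, hGab], hb.2⟩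
      · right
        simp only [hR, Finset.mem_sdiff, mem_erase] at ha
        exact ⟨⟨by simp [hN, ha.1.2, hGab.symm], ha.2⟩, rfl⟩
    · left
      rw [not_or] at hc
      have hiff : H'.Adj a b ↔ H.Adj a b := ⟨fun e => e.1, fun e => ⟨e, hc.1, hc.2⟩⟩
      rw [hiff] at hp
      have hAR : ∀ x ∈ A, x ∈ R := by
        intro x hx
        simp only [hA, mem_filter, mem_erase] at hx
        simp only [hR, Finset.mem_sdiff, mem_erase]
        refine ⟨hx.1, fun hk => hx.2 ?_⟩
        have := hKN hk
        simp only [hN, mem_filter] at this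
        exact this.2
      refine ⟨hp, ?_⟩
      rintro (⟨h1, h2⟩ | ⟨h1, h2⟩)
      · exact hc.1 ⟨h1, hAR _ h2⟩
      · exact hc.2 ⟨h2, hAR _ h1⟩
  have hcd : (diffPairs G H').card ≤ (diffPairs G H).card := by
    have h1 := card_le_card hd
    have h2 := card_union_le (diffPairs G H \ starPairs u A) (starPairs u (N \ K))
    have h3 := card_sdiff_add_card_eq_card hAdiff
    rw [card_starPairs huA] at h3
    rw [card_starPairs (fun hh => huN (Finset.mem_sdiff.mp hh).1)] at h2
    omega
  -- The cost has not grown, but the addition of `uz` is saved, against the second minimality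
  -- condition.
  have hadd : addPairs G H' ⊂ addPairs G H := by
    refine ⟨fun p hp => ?_, fun hsub => ?_⟩
    · rw [mem_addPairs] at hp ⊢; exact ⟨hp.1.1, hp.2⟩
    · have hmem : (u, z) ∈ addPairs G H := mem_addPairs.mpr ⟨hQ.clique hu hz huz, hG⟩
      have := (mem_addPairs.mp (hsub hmem)).1.2.1
      refine this ⟨rfl, ?_⟩
      simp only [hR, Finset.mem_sdiff, mem_erase]
      refine ⟨⟨huz.symm, hz⟩, fun hk => hG ?_⟩
      have := hKN hk
      simp only [hN, mem_filter] at this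
      exact this.2
  exact absurd (h.adds_le H' hdf hsupp hcd) (not_le.mpr (card_lt_card hadd))

/-- A noncomplete graph in which each vertex is adjacent to more than half of the vertices has a
diamond through each vertex. -/
theorem exists_isDiamond_of_degree {G : SimpleGraph V} {Q : Finset V}
    (hdeg : ∀ u ∈ Q, Q.card + 1 ≤ 2 * (Q.filter fun x => G.Adj u x).card)
    {z w : V} (hz : z ∈ Q) (hw : w ∈ Q) (hzw : z ≠ w) (hG : ¬ G.Adj z w) {u : V} (hu : u ∈ Q) :
    ∃ a ∈ Q, ∃ b ∈ Q, ∃ c ∈ Q, ∃ d ∈ Q, IsDiamond G a b c d ∧ (u = a ∨ u = c) := by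
  by_contra hcon
  have hno : ∀ a ∈ Q, ∀ b ∈ Q, ∀ c ∈ Q, ∀ d ∈ Q, IsDiamond G a b c d → u ≠ a ∧ u ≠ c := by
    intro a ha b hb c hc d hd hD
    rw [← not_or]
    exact fun h => hcon ⟨a, ha, b, hb, c, hc, d, hd, hD, h⟩
  set N := Q.filter fun x => G.Adj u x with hN
  have hmemN : ∀ {x}, x ∈ N ↔ x ∈ Q ∧ G.Adj u x := by simp [hN]
  -- As `u` is not a vertex of degree three of a diamond, its neighbourhood is a disjoint union of
  -- cliques.
  have tr : ∀ a ∈ N, ∀ b ∈ N, ∀ c ∈ N, G.Adj a b → G.Adj b c → a ≠ c → G.Adj a c := by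
    intro a ha b hb c hc hab hbc hac
    rw [hmemN] at ha hb hc
    by_contra h
    exact (hno u hu b hb.1 a ha.1 c hc.1 ⟨hb.2, ha.2, hab.symm, hc.2, hbc, hac, h⟩).1 rfl
  -- As `u` is not a vertex of degree two of a diamond, a non-neighbour of `u` sees at most one
  -- vertex of each of these cliques.
  have one : ∀ x ∈ Q, x ≠ u → ¬ G.Adj u x → ∀ a ∈ N, ∀ b ∈ N, G.Adj a b → G.Adj x a →
      ¬ G.Adj x b := by
    intro x hx hxu hux a ha b hb hab hxa hxb
    rw [hmemN] at ha hb
    exact (hno a ha.1 b hb.1 u hu x hx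
      ⟨hab, ha.2.symm, hb.2.symm, hxa.symm, hxb.symm, hxu.symm, hux⟩).2 rfl
  have hNdeg := hdeg u hu
  rw [← hN] at hNdeg
  obtain ⟨a, ha⟩ : N.Nonempty := by
    rw [← card_pos]; omega
  -- The clique of `a` in the neighbourhood of `u`. The aim is to show that `L` and `u` exhaust `Q`,
  -- which makes `Q` complete.
  set L := N.filter fun x => x = a ∨ G.Adj a x with hL
  have hmemL : ∀ {x}, x ∈ L ↔ x ∈ N ∧ (x = a ∨ G.Adj a x) := by simp [hL]
  have haL : a ∈ L := hmemL.mpr ⟨ha, Or.inl rfl⟩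
  have hLN : L ⊆ N := filter_subset _ _
  have hLclique : ∀ x ∈ L, ∀ y ∈ L, x ≠ y → G.Adj x y := by
    intro x hx y hy hxy
    rw [hmemL] at hx hy
    rcases hx.2 with rfl | hx' <;> rcases hy.2 with rfl | hy'
    · exact absurd rfl hxy
    · exact hy'
    · exact hx'.symm
    · exact tr x hx.1 a ha y hy.1 hx'.symm hy' hxy
  have hLclosed : ∀ x ∈ L, ∀ y ∈ N, G.Adj x y → y ∈ L := by
    intro x hx y hy hxy
    rw [hmemL] at hx ⊢
    refine ⟨hy, ?_⟩
    by_cases hya : y = a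
    · exact Or.inl hya
    · rcases hx.2 with rfl | hx'
      · exact Or.inr hxy
      · exact Or.inr (tr a ha x hx.1 y hy hx' hxy (Ne.symm hya))
  have huN : u ∉ N := by simp [hN]
  set Z := (Q.erase u) \ N with hZ
  have hZcard : Z.card + N.card + 1 = Q.card := by
    have hsub : N ⊆ Q.erase u := fun x hx =>
      mem_erase.mpr ⟨fun e => huN (e ▸ hx), (hmemN.mp hx).1⟩
    rw [hZ, card_sdiff_add_card_eq_card hsub, card_erase_add_one hu]
  have hmemZ : ∀ {x}, x ∈ Z ↔ x ∈ Q ∧ x ≠ u ∧ ¬ G.Adj u x := by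
    intro x
    simp only [hZ, Finset.mem_sdiff, mem_erase, hmemN]
    tauto
  -- A vertex `x` of `L` is adjacent only to `u`, to the rest of `L`, and to non-neighbours of `u`.
  have hdegL : ∀ x ∈ L, (Q.filter fun y => G.Adj x y).card ≤
      L.card + (bipartiteAbove G.Adj Z x).card := by
    intro x hx
    have hsub : (Q.filter fun y => G.Adj x y) ⊆
        insert u (L.erase x) ∪ bipartiteAbove G.Adj Z x := by
      intro y hy
      rw [mem_filter] at hy
      rw [mem_union, mem_insert, mem_erase, mem_bipartiteAbove, hmemZ]
      by_cases hyu : y = u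
      · exact Or.inl (Or.inl hyu)
      · by_cases huy : G.Adj u y
        · exact Or.inl (Or.inr ⟨hy.2.ne', hLclosed x hx y (hmemN.mpr ⟨hy.1, huy⟩) hy.2⟩)
        · exact Or.inr ⟨⟨hy.1, hyu, huy⟩, hy.2⟩
    refine (card_le_card hsub).trans ((card_union_le _ _).trans (Nat.add_le_add_right ?_ _))
    refine (card_insert_le _ _).trans ?_
    rw [card_erase_add_one hx]
  -- Double counting the edges between `L` and the non-neighbours of `u`, each of which has at most
  -- one neighbour in `L`.
  have hsum : ∑ x ∈ L, (bipartiteAbove G.Adj Z x).card ≤ Z.card := by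
    rw [sum_card_bipartiteAbove_eq_sum_card_bipartiteBelow]
    refine (sum_le_card_nsmul _ _ 1 fun y hy => ?_).trans (by simp)
    rw [card_le_one]
    intro x hx x' hx'
    rw [mem_bipartiteBelow] at hx hx'
    rw [hmemZ] at hy
    by_contra hne
    exact one y hy.1 hy.2.1 hy.2.2 x (hLN hx.1) x' (hLN hx'.1) (hLclique x hx.1 x' hx'.1 hne)
      hx.2.symm hx'.2.symm
  have hbound : L.card * (Q.card + 1) ≤ 2 * (L.card * L.card + Z.card) := by
    have h1 : ∑ x ∈ L, (Q.card + 1) ≤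
        ∑ x ∈ L, 2 * (L.card + (bipartiteAbove G.Adj Z x).card) := by
      refine sum_le_sum fun x hx => ?_
      have h1 := hdeg x (hmemN.mp (hLN hx)).1
      have h2 := hdegL x hx
      omega
    rw [← mul_sum, sum_const, smul_eq_mul, sum_add_distrib, sum_const, smul_eq_mul] at h1
    omega
  have hLpos : 1 ≤ L.card := card_pos.mpr ⟨a, haL⟩
  -- With `q`, `l`, `z` the sizes of `Q`, `L`, `Z`: the degree sum over `L` gives `l(q + 1) ≤ 2(l² +
  -- z)`, and the degree of `u` gives `2z + 3 ≤ q`. If `q = 2l + 1 + r`, then `2l + lr ≤ 2z ≤ 2l - 2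
  -- + r`, impossible for `l ≥ 1`.
  have hLbig : Q.card ≤ 2 * L.card := by
    by_contra hlt
    obtain ⟨m, hm⟩ := Nat.exists_eq_add_of_le hLpos
    obtain ⟨r, hr⟩ : ∃ r, Q.card = 2 * L.card + 1 + r :=
      ⟨Q.card - (2 * L.card + 1), by omega⟩
    have h3 : 2 * Z.card + 3 ≤ Q.card := by omega
    have hpr : (0 : ℕ) ≤ m * r := Nat.zero_le _
    have : L.card * (Q.card + 1) = 2 * (L.card * L.card) + 2 * L.card + L.card * r := by
      rw [hr]; ring
    have h4 : L.card * r = r + m * r := by rw [hm]; ring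
    nlinarith
  -- A further vertex `y` has at most one neighbour among the `l + 1 > q/2` vertices of `L ∪ {u}`,
  -- so its degree is too small.
  have hout : ∀ y ∈ Q, y ≠ u → y ∉ L → False := by
    intro y hy hyu hyL
    have hyle : ((insert u L).filter fun x => G.Adj y x).card ≤ 1 := by
      rw [card_le_one]
      intro x hx x' hx'
      simp only [mem_filter, mem_insert] at hx hx'
      by_contra hne
      by_cases huy : G.Adj u y
      · have hyN : y ∈ N := hmemN.mpr ⟨hy, huy⟩
        have hnot : ∀ x ∈ L, ¬ G.Adj y x := fun x hx hyx => hyL (hLclosed x hx y hyN hyx.symm)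
        rcases hx with ⟨rfl | hx, hyx⟩
        · rcases hx' with ⟨rfl | hx', hyx'⟩
          · exact hne rfl
          · exact hnot _ hx' hyx'
        · exact hnot _ hx hyx
      · rcases hx with ⟨rfl | hx, hyx⟩
        · exact huy hyx.symm
        · rcases hx' with ⟨rfl | hx', hyx'⟩
          · exact huy hyx'.symm
          · exact one y hy hyu huy x (hLN hx) x' (hLN hx') (hLclique x hx x' hx' hne) hyx hyx'
    have hsub : (Q.filter fun x => G.Adj y x) ⊆
        ((insert u L).filter fun x => G.Adj y x) ∪ ((Q \ insert u L).erase y) := by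
      intro x hx
      simp only [mem_filter, mem_union, mem_erase, Finset.mem_sdiff] at hx ⊢
      by_cases hxL : x ∈ insert u L
      · exact Or.inl ⟨hxL, hx.2⟩
      · exact Or.inr ⟨hx.2.ne', hx.1, hxL⟩
    have hLQ : insert u L ⊆ Q := by
      intro x hx
      rcases mem_insert.mp hx with rfl | hx
      · exact hu
      · exact (hmemN.mp (hLN hx)).1
    have h1 := (card_le_card hsub).trans (card_union_le _ _)
    have h2 : ((Q \ insert u L).erase y).card + 1 = (Q \ insert u L).card :=
      card_erase_add_one (by simp [hy, hyu, hyL])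
    have h3 := card_sdiff_add_card_eq_card hLQ
    have h4 : (insert u L).card = L.card + 1 :=
      card_insert_of_notMem fun hh => huN (hLN hh)
    have h5 := hdeg y hy
    omega
  have hall : ∀ y ∈ Q, y ≠ u → y ∈ L := fun y hy hyu => by
    by_contra h; exact hout y hy hyu h
  by_cases hzu : z = u
  · exact hG (hzu ▸ (hmemN.mp (hLN (hall w hw (fun e => hzw (hzu.trans e.symm))))).2)
  · by_cases hwu : w = u
    · exact hG (hwu ▸ (hmemN.mp (hLN (hall z hz hzu))).2.symm)
    · exact hG (hLclique z (hall z hz hzu) w (hall w hw hwu) hzw)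

end DiamondFreeCompletion

/-! ### Extending a solution from the kept vertices to the whole graph -/

section Extension

set_option linter.unusedSectionVars false

open Classical Finset

variable {V : Type*} [Fintype V] [DecidableEq V]

/-- The graph with the edges of `G` inside `M`. -/
def within {V : Type*} (G : SimpleGraph V) (M : Finset V) : SimpleGraph V where
  Adj a b := a ∈ M ∧ b ∈ M ∧ G.Adj a b
  symm := ⟨fun _ _ h => ⟨h.2.1, h.1, h.2.2.symm⟩⟩
  loopless := ⟨fun a h => G.loopless.irrefl a h.2.2⟩

/-- The kernel vertices `M` of `G`, with the core `Y` of a maximal packing of diamonds, the pairs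
`Pr` inside the members of the packing, the vertices `B` that can be incident to added edges, and
the common neighbours `mark a b` of `a` and `b` that are kept. -/
structure IsMarking (G : SimpleGraph V) (k : ℕ) (Y B M : Finset V) (Pr : V → V → Prop)
    (mark : V → V → Finset V) : Prop where
  core : ∀ ⦃a b c d⦄, IsDiamond G a b c d → ∃ T : Finset V, T ⊆ Y ∧
    (∀ w ∈ T, ∀ w' ∈ T, Pr w w') ∧ 3 ≤ (({a, b, c, d} : Finset V) ∩ T).card
  mark_sub : ∀ ⦃a b v⦄, v ∈ mark a b → v ∉ Y ∧ G.Adj a v ∧ G.Adj b v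
  mark_full : ∀ ⦃a b v⦄, v ∉ Y → G.Adj a v → G.Adj b v → v ∉ mark a b →
    2 * k + 2 ≤ (mark a b).card
  Y_sub : Y ⊆ B
  B_sub : B ⊆ M
  mark_pair : ∀ ⦃a b⦄, Pr a b → mark a b ⊆ B
  mark_base : ∀ ⦃a b⦄, a ∈ B → b ∈ B → mark a b ⊆ M
  mark_next : ∀ ⦃x c d⦄, x ∈ B → c ∈ B → d ∈ mark x c → mark c d ⊆ M

namespace IsMarking

variable {G H : SimpleGraph V} {k : ℕ} {Y B M : Finset V} {Pr : V → V → Prop}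
  {mark : V → V → Finset V}

/-- At least three of the four vertices of the diamond lie in `T ⊆ Y`, so the vertex outside `Y` is
the only one missing from `T`. -/
theorem core_of_notMem (h : IsMarking G k Y B M Pr mark) {a b c d p : V}
    (hD : IsDiamond G a b c d) (hp : p ∈ ({a, b, c, d} : Finset V)) (hpY : p ∉ Y) :
    ∃ T : Finset V, T ⊆ Y ∧ (∀ w ∈ T, ∀ w' ∈ T, Pr w w') ∧
      ∀ q ∈ ({a, b, c, d} : Finset V), q ≠ p → q ∈ T := by
  obtain ⟨T, hTY, hTP, hT⟩ := h.core hD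
  refine ⟨T, hTY, hTP, fun q hq hqp => ?_⟩
  by_contra hqT
  have hsub : ({a, b, c, d} : Finset V) ∩ T ⊆ (({a, b, c, d} : Finset V).erase p).erase q := by
    intro x hx
    rw [mem_inter] at hx
    rw [mem_erase, mem_erase]
    exact ⟨fun e => hqT (e ▸ hx.2), fun e => hpY (hTY (e ▸ hx.2)), hx.1⟩
  have h1 := card_le_card hsub
  rw [card_erase_of_mem (mem_erase.mpr ⟨hqp, hq⟩), card_erase_of_mem hp] at h1
  have h2 : ({a, b, c, d} : Finset V).card ≤ 4 := card_le_four
  omega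

/-- Two triangles on a common edge with two vertices outside `Y` span a complete graph. -/
theorem adj (h : IsMarking G k Y B M Pr mark) {a b c d : V} (p q : V) (hab : G.Adj a b)
    (hac : G.Adj a c) (hbc : G.Adj b c) (had : G.Adj a d) (hbd : G.Adj b d) (hcd : c ≠ d)
    (hpY : p ∉ Y) (hqY : q ∉ Y) (hpq : p ≠ q)
    (hp : p ∈ ({a, b, c, d} : Finset V)) (hq : q ∈ ({a, b, c, d} : Finset V)) : G.Adj c d := by
  by_contra hn
  obtain ⟨T, hTY, -, hT⟩ := h.core_of_notMem ⟨hab, hac, hbc, had, hbd, hcd, hn⟩ hp hpY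
  exact hqY (hTY (hT q hq hpq.symm))

end IsMarking

/-- `H` agrees with `G` at `w` inside `M`. -/
def Untouched {V : Type*} (G H : SimpleGraph V) (M : Finset V) (w : V) : Prop :=
  w ∈ M ∧ ∀ z ∈ M, H.Adj w z ↔ G.Adj w z

/-- A marking together with an optimal solution on `M`. -/
structure IsSolved (G H : SimpleGraph V) (k : ℕ) (Y B M : Finset V) (Pr : V → V → Prop)
    (mark : V → V → Finset V) : Prop extends IsMarking G k Y B M Pr mark where
  opt : IsOptimal (within G M) H M
  diffPairs_le : (diffPairs (within G M) H).card ≤ 2 * k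

namespace IsSolved

variable {G H : SimpleGraph V} {k : ℕ} {Y B M : Finset V} {Pr : V → V → Prop}
  {mark : V → V → Finset V}

theorem mem_left (h : IsSolved G H k Y B M Pr mark) {a b : V} (hab : H.Adj a b) : a ∈ M :=
  h.opt.supp hab

theorem mem_right (h : IsSolved G H k Y B M Pr mark) {a b : V} (hab : H.Adj a b) : b ∈ M :=
  h.opt.supp hab.symm

/-- Two untouched vertices among the kept common neighbours, if some are not kept. -/
theorem exists_untouched (h : IsSolved G H k Y B M Pr mark) {a b v : V} (hM : mark a b ⊆ M)
    (hv : v ∉ Y) (hav : G.Adj a v) (hbv : G.Adj b v) (hm : v ∉ mark a b) :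
    ∃ w₁ w₂, w₁ ≠ w₂ ∧ w₁ ∈ mark a b ∧ w₂ ∈ mark a b ∧ Untouched G H M w₁ ∧
      Untouched G H M w₂ := by
  -- The vertices touched by `H`. There are at most `2k`, because differing pairs are counted in
  -- both orders; hence two of the `2k + 2` kept vertices remain.
  set D := (diffPairs (within G M) H).image Prod.fst
  have hD : D.card ≤ 2 * k := card_image_le.trans h.diffPairs_le
  have hcard : 1 < (mark a b \ D).card := by
    have := le_card_sdiff D (mark a b)
    have := h.mark_full hv hav hbv hm
    omega
  obtain ⟨w₁, hw₁, w₂, hw₂, hne⟩ := one_lt_card.mp hcard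
  rw [Finset.mem_sdiff] at hw₁ hw₂
  have key : ∀ w ∈ mark a b, w ∉ D → Untouched G H M w := by
    intro w hw hwD
    refine ⟨hM hw, fun z hz => ?_⟩
    by_contra hn
    refine hwD (mem_image.mpr ⟨(w, z), mem_diffPairs.mpr fun hiff => hn ?_, rfl⟩)
    rw [hiff]
    exact ⟨fun e => e.2.2, fun e => ⟨hM hw, hz, e⟩⟩
  exact ⟨w₁, w₂, hne, hw₁.1, hw₂.1, key _ hw₁.1 hw₁.2, key _ hw₂.1 hw₂.2⟩

/-- The unkept vertices are not adjacent to both ends of an added edge. -/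
theorem mem_mark_of_added (h : IsSolved G H k Y B M Pr mark) {a b v : V} (hM : mark a b ⊆ M)
    (hH : H.Adj a b) (hG : ¬ G.Adj a b) (hv : v ∉ Y) (hav : G.Adj a v) (hbv : G.Adj b v) :
    v ∈ mark a b := by
  by_contra hm
  obtain ⟨w₁, w₂, hne, h1, h2, u1, u2⟩ := h.exists_untouched hM hv hav hbv hm
  obtain ⟨hY1, ha1, hb1⟩ := h.mark_sub h1
  obtain ⟨hY2, ha2, hb2⟩ := h.mark_sub h2
  have haM := h.mem_left hH
  have hbM := h.mem_right hH
  -- The triangles on the added edge force `w₁w₂` into `H`, hence into `G`. The triangles on `w₁w₂`,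
  -- whose ends are outside `Y`, then force `ab` into `G`.
  have h12 : G.Adj w₁ w₂ := (u1.2 w₂ u2.1).mp (h.opt.noDiamond hH
    ((u1.2 a haM).mpr ha1.symm).symm ((u1.2 b hbM).mpr hb1.symm).symm
    ((u2.2 a haM).mpr ha2.symm).symm ((u2.2 b hbM).mpr hb2.symm).symm hne)
  exact hG (h.adj w₁ w₂ h12 ha1.symm ha2.symm hb1.symm hb2.symm hH.ne hY1 hY2 hne
    (by simp) (by simp))

/-- The unkept vertices are not adjacent to both ends of a deleted edge. -/
theorem mem_mark_of_deleted (h : IsSolved G H k Y B M Pr mark) {a b v : V} (hM : mark a b ⊆ M)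
    (haM : a ∈ M) (hbM : b ∈ M)
    (hH : ¬ H.Adj a b) (hG : G.Adj a b) (hv : v ∉ Y) (hav : G.Adj a v) (hbv : G.Adj b v) :
    v ∈ mark a b := by
  by_contra hm
  obtain ⟨w₁, w₂, hne, h1, h2, u1, u2⟩ := h.exists_untouched hM hv hav hbv hm
  obtain ⟨hY1, ha1, hb1⟩ := h.mark_sub h1
  obtain ⟨hY2, ha2, hb2⟩ := h.mark_sub h2
  have h12 : G.Adj w₁ w₂ := h.adj w₁ w₂ hG ha1 hb1 ha2 hb2 hne hY1 hY2 hne (by simp) (by simp)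
  exact hH (h.opt.noDiamond ((u1.2 w₂ u2.1).mpr h12) ((u1.2 a haM).mpr ha1.symm)
    ((u2.2 a haM).mpr ha2.symm) ((u1.2 b hbM).mpr hb1.symm) ((u2.2 b hbM).mpr hb2.symm) hG.ne)

/-- A bag with two untouched vertices outside `Y`. -/
def HasAnchors (G H : SimpleGraph V) (Y M Q : Finset V) : Prop :=
  ∃ w₁ ∈ Q, ∃ w₂ ∈ Q, w₁ ≠ w₂ ∧ w₁ ∉ Y ∧ w₂ ∉ Y ∧ Untouched G H M w₁ ∧ Untouched G H M w₂

/-- The untouched kept common neighbours of `a` and `b` are still adjacent to both in `H`, so the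
bag absorbs them. -/
theorem hasAnchors (h : IsSolved G H k Y B M Pr mark) {Q : Finset V} (hQ : IsBag H Q)
    {a b v : V} (ha : a ∈ Q) (hb : b ∈ Q) (hab : a ≠ b) (hM : mark a b ⊆ M)
    (hv : v ∉ Y) (hav : G.Adj a v) (hbv : G.Adj b v) (hm : v ∉ mark a b) :
    HasAnchors G H Y M Q := by
  obtain ⟨w₁, w₂, hne, h1, h2, u1, u2⟩ := h.exists_untouched hM hv hav hbv hm
  obtain ⟨hY1, ha1, hb1⟩ := h.mark_sub h1
  obtain ⟨hY2, ha2, hb2⟩ := h.mark_sub h2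
  have hHab := hQ.clique ha hb hab
  have haM := h.mem_left hHab
  have hbM := h.mem_right hHab
  exact ⟨w₁, hQ.closed ha hb hab ((u1.2 a haM).mpr ha1.symm) ((u1.2 b hbM).mpr hb1.symm),
    w₂, hQ.closed ha hb hab ((u2.2 a haM).mpr ha2.symm) ((u2.2 b hbM).mpr hb2.symm),
    hne, hY1, hY2, u1, u2⟩

/-- A vertex outside `Y` adjacent to the anchors of a bag is adjacent to the whole bag. -/
theorem adj_of_anchors (h : IsSolved G H k Y B M Pr mark) {Q : Finset V} (hQ : IsBag H Q)
    {w₁ w₂ v z : V} (h1 : w₁ ∈ Q) (h2 : w₂ ∈ Q) (hne : w₁ ≠ w₂) (hY1 : w₁ ∉ Y)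
    (u1 : Untouched G H M w₁) (u2 : Untouched G H M w₂)
    (hv : v ∉ Y) (hv1 : G.Adj v w₁) (hv2 : G.Adj v w₂) (hz : z ∈ Q) (hzv : z ≠ v) :
    G.Adj v z := by
  by_cases hz1 : z = w₁
  · rwa [hz1]
  by_cases hz2 : z = w₂
  · rwa [hz2]
  have hH1 := hQ.clique h1 hz (Ne.symm hz1)
  have hH2 := hQ.clique h2 hz (Ne.symm hz2)
  have hzM := h.mem_right hH1
  exact h.adj v w₁ ((u1.2 w₂ u2.1).mp (hQ.clique h1 h2 hne)) hv1.symm hv2.symm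
    ((u1.2 z hzM).mp hH1) ((u2.2 z hzM).mp hH2) (Ne.symm hzv) hv hY1 hv1.ne (by simp) (by simp)

/-- Optimality enters here. A diamond of `G` inside the bag passes through `u`. If `u ∉ B`, its
other three vertices lie in one member of the packing, two of them are neighbours of `u`, and `u`
was not kept for these two. -/
theorem hasAnchors_or_mem (h : IsSolved G H k Y B M Pr mark) {Q : Finset V} (hQ : IsBag H Q)
    {z w u : V} (hz : z ∈ Q) (hw : w ∈ Q) (hzw : z ≠ w) (hG : ¬ G.Adj z w) (hu : u ∈ Q) :
    u ∈ B ∨ HasAnchors G H Y M Q := by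
  by_cases huB : u ∈ B
  · exact Or.inl huB
  right
  have hW : ∀ {p q}, (within G M).Adj p q → G.Adj p q := fun e => e.2.2
  have hQM : ∀ p ∈ Q, p ∈ M := by
    intro p hp
    by_cases hpz : p = z
    · exact h.mem_left (hQ.clique hp hw (hpz ▸ hzw))
    · exact h.mem_left (hQ.clique hp hz hpz)
  have hWG : ∀ {p q}, p ∈ Q → q ∈ Q → G.Adj p q → (within G M).Adj p q :=
    fun hp hq e => ⟨hQM _ hp, hQM _ hq, e⟩
  have hGM : ¬ (within G M).Adj z w := fun e => hG (hW e)
  have hqz := h.opt.card_lt_two_mul hQ hz hw hzw hGM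
  have hdeg : ∀ u ∈ Q, Q.card + 1 ≤ 2 * (Q.filter fun x => (within G M).Adj u x).card := by
    intro u hu
    by_cases hall : ∃ y ∈ Q, u ≠ y ∧ ¬ (within G M).Adj u y
    · obtain ⟨y, hy, huy, hn⟩ := hall
      exact h.opt.card_lt_two_mul hQ hu hy huy hn
    · push Not at hall
      have h1 : (Q.filter fun x => (within G M).Adj u x) = Q.erase u := by
        ext x
        rw [mem_filter, mem_erase]
        exact ⟨fun e => ⟨e.2.ne', e.1⟩, fun e => ⟨e.2, hall x e.2 (Ne.symm e.1)⟩⟩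
      -- A vertex joined in `G` to all others of the bag has degree `|Q| - 1`. This is more than
      -- half since `|Q| + 1 ≤ 2(|Q| - 2)`, by the degree of `z`.
      have h2 : (Q.filter fun x => (within G M).Adj z x).card ≤ ((Q.erase z).erase w).card := by
        refine card_le_card fun x hx => ?_
        rw [mem_filter] at hx
        rw [mem_erase, mem_erase]
        exact ⟨fun e => hGM (e ▸ hx.2), hx.2.ne', hx.1⟩
      have h3 := card_erase_add_one hu
      have h4 := card_erase_add_one hz
      have h5 := card_erase_add_one (mem_erase.mpr ⟨hzw.symm, hw⟩)
      rw [h1]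
      omega
  obtain ⟨a, ha, b, hb, c, hc, d, hd, ⟨hab, hac, hbc, had, hbd, hcd, hncd⟩, hucases⟩ :=
    exists_isDiamond_of_degree hdeg hz hw hzw hGM hu
  have hD : IsDiamond G a b c d := ⟨hW hab, hW hac, hW hbc, hW had, hW hbd, hcd,
    fun e => hncd (hWG hc hd e)⟩
  have huY : u ∉ Y := fun e => huB (h.Y_sub e)
  -- Two neighbours of `u` in the diamond, for `u` of degree three and of degree two in it.
  obtain ⟨p, q, hp, hq, hpq, hup, huq, hPr⟩ : ∃ p q, p ∈ Q ∧ q ∈ Q ∧ p ≠ q ∧ G.Adj p u ∧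
      G.Adj q u ∧ Pr p q := by
    rcases hucases with rfl | rfl
    · obtain ⟨T, -, hTP, hT⟩ := h.core_of_notMem hD (by simp) huY
      exact ⟨b, c, hb, hc, hbc.ne, (hW hab).symm, (hW hac).symm,
        hTP b (hT b (by simp) hab.ne') c (hT c (by simp) hac.ne')⟩
    · obtain ⟨T, -, hTP, hT⟩ := h.core_of_notMem hD (by simp) huY
      exact ⟨a, b, ha, hb, hab.ne, hW hac, hW hbc,
        hTP a (hT a (by simp) hac.ne) b (hT b (by simp) hbc.ne)⟩
  exact h.hasAnchors hQ hp hq hpq ((h.mark_pair hPr).trans h.B_sub) huY hup huq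
    fun e => huB (h.mark_pair hPr e)

/-- Added edges join vertices of `B`. -/
theorem mem_of_added (h : IsSolved G H k Y B M Pr mark) {z w : V} (hH : H.Adj z w)
    (hG : ¬ G.Adj z w) : z ∈ B := by
  obtain ⟨Q, hQ, hz, hw⟩ := h.opt.noDiamond.exists_isBag hH
  rcases h.hasAnchors_or_mem hQ hz hw hH.ne hG hz with hB | ⟨w₁, h1, w₂, h2, hne, hY1, hY2, u1, u2⟩
  · exact hB
  by_contra hzB
  have hzM := h.mem_left hH
  have hwM := h.mem_right hH
  have hz1 : w₁ ≠ z := fun e => hG (e ▸ (u1.2 w hwM).mp (e ▸ hH))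
  have hz2 : w₂ ≠ z := fun e => hG (e ▸ (u2.2 w hwM).mp (e ▸ hH))
  exact hG (h.adj_of_anchors hQ h1 h2 hne hY1 u1 u2 (fun e => hzB (h.Y_sub e))
    ((u1.2 z hzM).mp (hQ.clique h1 hz hz1)).symm ((u2.2 z hzM).mp (hQ.clique h2 hz hz2)).symm hw
    hH.ne')

/-- A removed vertex has at most one neighbour in a bag with an added edge. -/
theorem false_of_two_neighbors (h : IsSolved G H k Y B M Pr mark) {Q : Finset V} (hQ : IsBag H Q)
    {z w v a b : V} (hz : z ∈ Q) (hw : w ∈ Q) (hzw : z ≠ w) (hG : ¬ G.Adj z w) (hv : v ∉ M)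
    (ha : a ∈ Q) (hb : b ∈ Q) (hab : a ≠ b) (hva : G.Adj v a) (hvb : G.Adj v b) : False := by
  have hvY : v ∉ Y := fun e => hv (h.B_sub (h.Y_sub e))
  -- If two neighbours of `v` in the bag were joined by an added edge, its ends would lie in `B`,
  -- and then `v` would have been kept for them.
  have step : ∀ a ∈ Q, ∀ b ∈ Q, a ≠ b → G.Adj v a → G.Adj v b → G.Adj a b := by
    intro a ha b hb hab hva hvb
    by_contra hn
    have hH := hQ.clique ha hb hab
    have hM := h.mark_base (h.mem_of_added hH hn)
      (h.mem_of_added hH.symm fun e => hn e.symm)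
    exact hv (hM (h.mem_mark_of_added hM hH hn hvY hva.symm hvb.symm))
  have hGab := step a ha b hb hab hva hvb
  have hanch : HasAnchors G H Y M Q := by
    rcases h.hasAnchors_or_mem hQ hz hw hzw hG ha with haB | hA
    · rcases h.hasAnchors_or_mem hQ hz hw hzw hG hb with hbB | hA
      · exact h.hasAnchors hQ ha hb hab (h.mark_base haB hbB) hvY hva.symm hvb.symm
          fun e => hv (h.mark_base haB hbB e)
      · exact hA
    · exact hA
  obtain ⟨w₁, h1, w₂, h2, hne, hY1, hY2, u1, u2⟩ := hanch
  have hH := hQ.clique ha hb hab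
  have haM := h.mem_left hH
  have hbM := h.mem_right hH
  -- The edge `ab` carries the adjacency of `v` over to the anchors, and the anchors carry it over
  -- to the whole bag, including both ends of the added edge `zw`.
  have hadj : ∀ x ∈ Q, x ∉ Y → Untouched G H M x → G.Adj v x := by
    intro x hx hxY ux
    by_cases hxa : x = a
    · rwa [hxa]
    by_cases hxb : x = b
    · rwa [hxb]
    exact h.adj v x hGab hva.symm hvb.symm ((ux.2 a haM).mp (hQ.clique hx ha hxa)).symm
      ((ux.2 b hbM).mp (hQ.clique hx hb hxb)).symm (fun e => hv (e ▸ ux.1)) hvY hxY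
      (fun e => hv (e ▸ ux.1)) (by simp) (by simp)
  have hall : ∀ x ∈ Q, G.Adj v x := by
    intro x hx
    refine h.adj_of_anchors hQ h1 h2 hne hY1 u1 u2 hvY (hadj _ h1 hY1 u1) (hadj _ h2 hY2 u2) hx ?_
    rintro rfl
    by_cases hxa : x = a
    · exact hv (hxa ▸ haM)
    · exact hv (h.mem_left (hQ.clique hx ha hxa))
  exact hG (step z hz w hw hzw (hall z hz) (hall w hw))

/-- Edges in a triangle with a removed vertex are not deleted. -/
theorem adj_of_removed (h : IsSolved G H k Y B M Pr mark) {c d v : V} (hcM : c ∈ M)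
    (hdM : d ∈ M) (hcd : G.Adj c d) (hv : v ∉ M) (hcv : G.Adj c v) (hdv : G.Adj d v) :
    H.Adj c d := by
  by_contra hH
  have hvY : v ∉ Y := fun e => hv (h.B_sub (h.Y_sub e))
  have hdel : ∀ e f, e ∈ M → f ∈ M → ¬ H.Adj e f → G.Adj e f → G.Adj e v → G.Adj f v →
      ¬ mark e f ⊆ M := fun e f he hf h1 h2 h3 h4 hm =>
    hv (hm (h.mem_mark_of_deleted hm he hf h1 h2 hvY h3 h4))
  have htouch : ∀ w, Untouched G H M w → w ≠ c ∧ w ≠ d := by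
    refine fun w hw => ⟨?_, ?_⟩
    · rintro rfl; exact hH ((hw.2 d hdM).mpr hcd)
    · rintro rfl; exact hH ((hw.2 c hcM).mpr hcd.symm).symm
  -- Suppose `c`, `p` lie in one member and `d ∉ B` is adjacent to both. Two untouched vertices kept
  -- for `c`, `p` are adjacent to each other and to `c` and `d`, so in `H` their edge forces `cd`.
  have hPr : ∀ c d p, c ∈ M → d ∈ M → ¬ H.Adj c d → G.Adj c d → G.Adj c p → G.Adj d p →
      d ∉ B → ¬ Pr c p := by
    intro c d p hcM hdM hH hcd hcp hdp hdB hP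
    have hsub := h.mark_pair hP
    have hdY : d ∉ Y := fun e => hdB (h.Y_sub e)
    obtain ⟨w₁, w₂, hne, h1, h2, u1, u2⟩ := h.exists_untouched (hsub.trans h.B_sub) hdY hcd
      hdp.symm fun e => hdB (hsub e)
    obtain ⟨hY1, hc1, hp1⟩ := h.mark_sub h1
    obtain ⟨hY2, hc2, hp2⟩ := h.mark_sub h2
    have hd1 : d ≠ w₁ := fun e => hdB (e ▸ hsub h1)
    have hd2 : d ≠ w₂ := fun e => hdB (e ▸ hsub h2)
    have a1 : G.Adj d w₁ := h.adj d w₁ hcp hcd hdp.symm hc1 hp1 hd1 hdY hY1 hd1 (by simp) (by simp)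
    have a2 : G.Adj d w₂ := h.adj d w₂ hcp hcd hdp.symm hc2 hp2 hd2 hdY hY2 hd2 (by simp) (by simp)
    have a12 : G.Adj w₁ w₂ := h.adj w₁ w₂ hcp hc1 hp1 hc2 hp2 hne hY1 hY2 hne (by simp) (by simp)
    exact hH (h.opt.noDiamond ((u1.2 w₂ u2.1).mpr a12) ((u1.2 c hcM).mpr hc1.symm)
      ((u2.2 c hcM).mpr hc2.symm) ((u1.2 d hdM).mpr a1.symm) ((u2.2 d hdM).mpr a2.symm) hcd.ne)
  -- Since `v` was not kept, `c` and `d` are not both in `B`. The one outside `B` is the only vertex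
  -- of the diamond outside its member, so `hPr` applies, with the roles of `c` and `d` chosen
  -- accordingly.
  have hnoD : ∀ a b e f p, IsDiamond G a b e f → c ∈ ({a, b, e, f} : Finset V) →
      d ∈ ({a, b, e, f} : Finset V) → p ∈ ({a, b, e, f} : Finset V) → G.Adj c p → G.Adj d p →
      False := by
    intro a b e f p hD hc hd hp hcp hdp
    by_cases hdB : d ∈ B
    · have hcB : c ∉ B := fun hcB => hdel c d hcM hdM hH hcd hcv hdv (h.mark_base hcB hdB)
      obtain ⟨T, -, hTP, hT⟩ := h.core_of_notMem hD hc fun e => hcB (h.Y_sub e)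
      exact hPr d c p hdM hcM (fun e => hH e.symm) hcd.symm hdp hcp hcB
        (hTP d (hT d hd hcd.ne') p (hT p hp hcp.ne'))
    · obtain ⟨T, -, hTP, hT⟩ := h.core_of_notMem hD hd fun e => hdB (h.Y_sub e)
      exact hPr c d p hcM hdM hH hcd hcp hdp hdB
        (hTP c (hT c hc hcd.ne) p (hT p hp hdp.ne'))
  -- The maximal clique of `G` at `cd`. The contradiction will come from restoring all of its edges
  -- inside `M`.
  obtain ⟨K, hK⟩ : ∃ K : Set V, ∀ x, x ∈ K ↔ x = c ∨ x = d ∨ G.Adj c x ∧ G.Adj d x :=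
    ⟨{x | x = c ∨ x = d ∨ G.Adj c x ∧ G.Adj d x}, fun _ => Iff.rfl⟩
  have hcK : c ∈ K := (hK c).mpr (Or.inl rfl)
  have hdK : d ∈ K := (hK d).mpr (Or.inr (Or.inl rfl))
  have hvK : v ∈ K := (hK v).mpr (Or.inr (Or.inr ⟨hcv, hdv⟩))
  have hclique : ∀ x ∈ K, ∀ y ∈ K, x ≠ y → G.Adj x y := by
    intro x hx y hy hxy
    rw [hK] at hx hy
    rcases hx with rfl | rfl | ⟨hx1, hx2⟩ <;> rcases hy with rfl | rfl | ⟨hy1, hy2⟩ <;>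
      first
      | exact absurd rfl hxy
      | assumption
      | (apply SimpleGraph.Adj.symm; assumption)
      | skip
    by_contra hn
    exact hnoD c d x y x ⟨hcd, hx1, hx2, hy1, hy2, hxy, hn⟩ (by simp) (by simp) (by simp) hx1 hx2
  -- If two vertices of `K` were in `Y`, then `v` would be a discarded common neighbour of them. The
  -- untouched kept ones are adjacent to `c` and `d` by way of `v`, so `cd` would survive in `H`.
  have hKY : ∀ y ∈ K, ∀ y' ∈ K, y ≠ y' → y ∈ Y → y' ∉ Y := by
    intro y hy y' hy' hne hyY hy'Y
    have hyv : y ≠ v := fun e => hvY (e ▸ hyY)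
    have hyv' : y' ≠ v := fun e => hvY (e ▸ hy'Y)
    have hyy := hclique y hy y' hy' hne
    have av := hclique y hy v hvK hyv
    have av' := hclique y' hy' v hvK hyv'
    have hsub := h.mark_base (h.Y_sub hyY) (h.Y_sub hy'Y)
    obtain ⟨w₁, w₂, hne', h1, h2, u1, u2⟩ := h.exists_untouched hsub hvY av av'
      fun e => hv (hsub e)
    have key : ∀ w ∈ mark y y', Untouched G H M w → ∀ s ∈ K, s ≠ v → w ≠ s → G.Adj s w := by
      intro w hw uw s hs hsv hws
      obtain ⟨hwY, hyw, hyw'⟩ := h.mark_sub hw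
      have hvw : v ≠ w := fun e => hv (e ▸ uw.1)
      by_cases hsy : s = y
      · rwa [hsy]
      have avw : G.Adj v w := h.adj v w hyy av av' hyw hyw' hvw hvY hwY hvw (by simp) (by simp)
      exact h.adj v w av.symm (hclique v hvK s hs (Ne.symm hsv)) (hclique y hy s hs (Ne.symm hsy))
        avw hyw (Ne.symm hws) hvY hwY hvw (by simp) (by simp)
    have hcv' : c ≠ v := fun e => hv (e ▸ hcM)
    have hdv' : d ≠ v := fun e => hv (e ▸ hdM)
    obtain ⟨hY1, hy1, hy1'⟩ := h.mark_sub h1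
    obtain ⟨hY2, hy2, hy2'⟩ := h.mark_sub h2
    have a12 : G.Adj w₁ w₂ :=
      h.adj w₁ w₂ hyy hy1 hy1' hy2 hy2' hne' hY1 hY2 hne' (by simp) (by simp)
    exact hH (h.opt.noDiamond ((u1.2 w₂ u2.1).mpr a12)
      ((u1.2 c hcM).mpr (key w₁ h1 u1 c hcK hcv' (htouch _ u1).1).symm)
      ((u2.2 c hcM).mpr (key w₂ h2 u2 c hcK hcv' (htouch _ u2).1).symm)
      ((u1.2 d hdM).mpr (key w₁ h1 u1 d hdK hdv' (htouch _ u1).2).symm)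
      ((u2.2 d hdM).mpr (key w₂ h2 u2 d hdK hdv' (htouch _ u2).2).symm) hcd.ne)
  -- An `x` outside `K` misses `c` or `d`; call it `s`. If `x` saw `e` and `f`, then `e, f, s, x`
  -- would be a diamond, yet at most one of `e, f, s` lies in `Y`.
  have hout : ∀ x ∉ K, ∀ e ∈ K, ∀ f ∈ K, e ≠ f → G.Adj x e → ¬ G.Adj x f := by
    intro x hx e he f hf hef hxe hxf
    have main : ∀ s ∈ K, ¬ G.Adj s x → False := by
      intro s hs hsx
      have hse : s ≠ e := by rintro rfl; exact hsx hxe.symm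
      have hsf : s ≠ f := by rintro rfl; exact hsx hxf.symm
      have hsx' : s ≠ x := by rintro rfl; exact hx hs
      have aef := hclique e he f hf hef
      have aes := hclique e he s hs hse.symm
      have afs := hclique f hf s hs hsf.symm
      by_cases heY : e ∈ Y
      · exact hsx (h.adj s f aef aes afs hxe.symm hxf.symm hsx' (hKY e he s hs hse.symm heY)
          (hKY e he f hf hef heY) hsf (by simp) (by simp))
      · by_cases hfY : f ∈ Y
        · exact hsx (h.adj s e aef aes afs hxe.symm hxf.symm hsx' (hKY f hf s hs hsf.symm hfY)
            heY hse (by simp) (by simp))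
        · exact hsx (h.adj e f aef aes afs hxe.symm hxf.symm hsx' heY hfY hef (by simp) (by simp))
    by_cases hcx : G.Adj c x
    · by_cases hdx : G.Adj d x
      · exact hx ((hK x).mpr (Or.inr (Or.inr ⟨hcx, hdx⟩)))
      · exact main d hdK hdx
    · exact main c hcK hcx
  -- If `ef` is in `H`, the bag of the added edge `xe` contains two neighbours of `v`. Otherwise
  -- `ef` is deleted, and it must be shown that the vertices kept for `e`, `f` all lie in `M`.
  have hbase : ∀ x ∉ K, ∀ e ∈ K, ∀ f ∈ K, e ≠ f → H.Adj x e → H.Adj x f → ¬ G.Adj x e →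
      False := by
    intro x hx e he f hf hef hxe hxf hGxe
    obtain ⟨Q, hQ, hxQ, heQ⟩ := h.opt.noDiamond.exists_isBag hxe
    have heM := h.mem_right hxe
    have hfM := h.mem_right hxf
    have hev : G.Adj e v := hclique e he v hvK fun e' => hv (e' ▸ heM)
    have hfv : G.Adj f v := hclique f hf v hvK fun e' => hv (e' ▸ hfM)
    by_cases hHef : H.Adj e f
    · exact h.false_of_two_neighbors hQ hxQ heQ hxe.ne hGxe hv heQ
        (hQ.closed hxQ heQ hxe.ne hxf.symm hHef.symm) hef hev.symm hfv.symm
    · have hGef := hclique e he f hf hef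
      have heB : e ∈ B := h.mem_of_added hxe.symm fun e' => hGxe e'.symm
      have hxB : x ∈ B := h.mem_of_added hxe hGxe
      refine hdel e f heM hfM hHef hGef hev hfv ?_
      by_cases hfB : f ∈ B
      · exact h.mark_base heB hfB
      · have hGxf : G.Adj x f := by
          by_contra hn; exact hfB (h.mem_of_added hxf.symm fun e' => hn e'.symm)
        -- The only use of the last marking rule, which is the one that costs `k⁸`: `f` is kept for
        -- the ends of the added edge `xe`, which lie in `B`.
        exact h.mark_next hxB heB (h.mem_mark_of_added (h.mark_base hxB heB) hxe hGxe
          (fun e' => hfB (h.Y_sub e')) hGxf hGef)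
  have hHout : ∀ x ∉ K, ∀ e ∈ K, ∀ f ∈ K, e ≠ f → H.Adj x e → ¬ H.Adj x f := by
    intro x hx e he f hf hef hxe hxf
    by_cases hGe : G.Adj x e
    · exact hbase x hx f hf e he hef.symm hxf hxe (hout x hx e he f hf hef hGe)
    · exact hbase x hx e he f hf hef hxe hxf hGe
  -- `H` with all edges of the clique `K` inside `M`. No vertex outside `K` has two neighbours in
  -- `K`, so two triangles on a common edge lie entirely in `K` or use no edge inside `K`.
  let H' : SimpleGraph V :=
    { Adj := fun a b => H.Adj a b ∨ a ≠ b ∧ a ∈ K ∧ b ∈ K ∧ a ∈ M ∧ b ∈ M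
      symm := ⟨fun a b e => e.imp (fun e => e.symm) fun e =>
        ⟨e.1.symm, e.2.2.1, e.2.1, e.2.2.2.2, e.2.2.2.1⟩⟩
      loopless := ⟨fun a e => e.elim (fun e => H.loopless.irrefl a e) fun e => e.1 rfl⟩ }
  have hH'iff : ∀ a b, H'.Adj a b ↔ H.Adj a b ∨ a ≠ b ∧ a ∈ K ∧ b ∈ K ∧ a ∈ M ∧ b ∈ M :=
    fun _ _ => Iff.rfl
  have hsupp : ∀ ⦃a b⦄, H'.Adj a b → a ∈ M := fun a b e => e.elim (fun e => h.opt.supp e)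
    fun e => e.2.2.2.1
  have hH' : ∀ a b, H'.Adj a b → ¬ (a ∈ K ∧ b ∈ K) → H.Adj a b := fun a b e hn =>
    e.elim id fun e => absurd ⟨e.2.1, e.2.2.1⟩ hn
  have htwo : ∀ x, ∀ e ∈ K, ∀ f ∈ K, e ≠ f → H'.Adj x e → H'.Adj x f → x ∈ K := by
    intro x e he f hf hef hxe hxf
    by_contra hx
    exact hHout x hx e he f hf hef (hH' x e hxe fun e' => hx e'.1) (hH' x f hxf fun e' => hx e'.1)
  have hdf : NoDiamond H' := by
    intro a b e f hab hae hbe haf hbf hef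
    by_cases hKab : a ∈ K ∧ b ∈ K
    · exact Or.inr ⟨hef, htwo e a hKab.1 b hKab.2 hab.ne hae.symm hbe.symm,
        htwo f a hKab.1 b hKab.2 hab.ne haf.symm hbf.symm, hsupp hae.symm, hsupp haf.symm⟩
    · have h1 : ¬ (a ∈ K ∧ e ∈ K) := fun e' =>
        hKab ⟨e'.1, htwo b a e'.1 e e'.2 hae.ne hab.symm hbe⟩
      have h2 : ¬ (b ∈ K ∧ e ∈ K) := fun e' =>
        hKab ⟨htwo a b e'.1 e e'.2 hbe.ne hab hae, e'.1⟩
      have h3 : ¬ (a ∈ K ∧ f ∈ K) := fun e' =>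
        hKab ⟨e'.1, htwo b a e'.1 f e'.2 haf.ne hab.symm hbf⟩
      have h4 : ¬ (b ∈ K ∧ f ∈ K) := fun e' =>
        hKab ⟨htwo a b e'.1 f e'.2 hbf.ne hab haf, e'.1⟩
      exact Or.inl (h.opt.noDiamond (hH' _ _ hab hKab) (hH' _ _ hae h1) (hH' _ _ hbe h2)
        (hH' _ _ haf h3) (hH' _ _ hbf h4) hef)
  have hlt : diffPairs (within G M) H' ⊂ diffPairs (within G M) H := by
    refine ⟨?_, fun hsub => ?_⟩
    · rintro ⟨a, b⟩ hp
      rw [mem_diffPairs, hH'iff] at hp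
      rw [mem_diffPairs]
      by_cases hab : a ≠ b ∧ a ∈ K ∧ b ∈ K ∧ a ∈ M ∧ b ∈ M
      · refine absurd ?_ hp
        exact ⟨fun _ => ⟨hab.2.2.2.1, hab.2.2.2.2, hclique a hab.2.1 b hab.2.2.1 hab.1⟩,
          fun _ => Or.inr hab⟩
      · simpa [hab] using hp
    · have : (c, d) ∈ diffPairs (within G M) H :=
        mem_diffPairs.mpr fun e => hH (e.mpr ⟨hcM, hdM, hcd⟩)
      refine mem_diffPairs.mp (hsub this) ⟨fun _ => ⟨hcM, hdM, hcd⟩, fun _ => Or.inr ?_⟩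
      exact ⟨hcd.ne, hcK, hdK, hcM, hdM⟩
  exact absurd (h.opt.card_le H' hdf hsupp) (not_le.mpr (card_lt_card hlt))

/-- Since `b`, `c`, `d` lie in `Y`, some untouched `w` is kept for `b`, `c`. It is adjacent to `v`,
and thereby to `d`, so `w` replaces `v`; the triangles on `wb` in `H` force `cd`. -/
theorem adj_of_isDiamond_of_removed (h : IsSolved G H k Y B M Pr mark) {v b c d : V} (hv : v ∉ M)
    (hD : IsDiamond G v b c d) (hbc : H.Adj b c) (hbd : H.Adj b d) : H.Adj c d := by
  have hvY : v ∉ Y := fun e => hv (h.B_sub (h.Y_sub e))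
  obtain ⟨T, hTY, -, hT⟩ := h.core_of_notMem hD (by simp) hvY
  obtain ⟨gvb, gvc, gbc, gvd, gbd, hcd, hncd⟩ := hD
  have hbY := hTY (hT b (by simp) gvb.ne')
  have hcY := hTY (hT c (by simp) gvc.ne')
  have hdY := hTY (hT d (by simp) gvd.ne')
  have hsub := h.mark_base (h.Y_sub hbY) (h.Y_sub hcY)
  obtain ⟨w, -, -, hw, -, u, -⟩ := h.exists_untouched hsub hvY gvb.symm gvc.symm
    fun e => hv (hsub e)
  obtain ⟨hwY, hbw, hcw⟩ := h.mark_sub hw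
  have hvw : v ≠ w := fun e => hv (e ▸ u.1)
  have gvw : G.Adj v w := h.adj v w gbc gvb.symm gvc.symm hbw hcw hvw hvY hwY hvw (by simp)
    (by simp)
  have gdw : G.Adj d w := h.adj v w gvb gvd gbd gvw hbw (fun e => hwY (e ▸ hdY)) hvY hwY hvw
    (by simp) (by simp)
  exact h.opt.noDiamond ((u.2 b (h.mem_left hbc)).mpr hbw.symm)
    ((u.2 c (h.mem_right hbc)).mpr hcw.symm) hbc ((u.2 d (h.mem_right hbd)).mpr gdw.symm) hbd hcd

/-- Two untouched vertices kept for `a`, `b` are adjacent to `v` in `G`, and to `d` because `H` has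
no diamond on `ab`. They are adjacent to each other, so their edge forces `vd` in `G`. -/
theorem false_of_isDiamond_of_removed (h : IsSolved G H k Y B M Pr mark) {v a b d : V}
    (hv : v ∉ M) (hD : IsDiamond G a b v d) (hab : H.Adj a b) (had : H.Adj a d)
    (hbd : H.Adj b d) : False := by
  have hvY : v ∉ Y := fun e => hv (h.B_sub (h.Y_sub e))
  obtain ⟨T, hTY, -, hT⟩ := h.core_of_notMem hD (by simp) hvY
  obtain ⟨gab, gav, gbv, gad, gbd, hvd, hnvd⟩ := hD
  have haY := hTY (hT a (by simp) gav.ne)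
  have hbY := hTY (hT b (by simp) gbv.ne)
  have hdY := hTY (hT d (by simp) hvd.symm)
  have hsub := h.mark_base (h.Y_sub haY) (h.Y_sub hbY)
  obtain ⟨w₁, w₂, hne, h1, h2, u1, u2⟩ := h.exists_untouched hsub hvY gav gbv fun e => hv (hsub e)
  have key : ∀ w ∈ mark a b, Untouched G H M w → G.Adj w v ∧ G.Adj w d := by
    intro w hw u
    obtain ⟨hwY, haw, hbw⟩ := h.mark_sub hw
    have hvw : v ≠ w := fun e => hv (e ▸ u.1)
    have hwd : w ≠ d := fun e => hwY (e ▸ hdY)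
    refine ⟨(h.adj v w gab gav gbv haw hbw hvw hvY hwY hvw (by simp) (by simp)).symm, ?_⟩
    exact (u.2 d (h.mem_right had)).mp (h.opt.noDiamond hab
      ((u.2 a (h.mem_left hab)).mpr haw.symm).symm ((u.2 b (h.mem_right hab)).mpr hbw.symm).symm
      had hbd hwd)
  obtain ⟨hY1, ha1, hb1⟩ := h.mark_sub h1
  obtain ⟨hY2, ha2, hb2⟩ := h.mark_sub h2
  have g12 : G.Adj w₁ w₂ := h.adj w₁ w₂ gab ha1 hb1 ha2 hb2 hne hY1 hY2 hne (by simp) (by simp)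
  have hv1 : v ≠ w₁ := fun e => hv (e ▸ u1.1)
  exact hnvd (h.adj v w₁ g12 (key _ h1 u1).1 (key _ h2 u2).1 (key _ h1 u1).2 (key _ h2 u2).2 hvd
    hvY hY1 hv1 (by simp) (by simp))

end IsSolved

/-- The graph that agrees with `H` inside `M` and with `G` elsewhere. -/
def patch {V : Type*} (G H : SimpleGraph V) (M : Finset V) : SimpleGraph V where
  Adj a b := a ∈ M ∧ b ∈ M ∧ H.Adj a b ∨ ¬ (a ∈ M ∧ b ∈ M) ∧ G.Adj a b
  symm := ⟨fun _ _ h => h.imp (fun h => ⟨h.2.1, h.1, h.2.2.symm⟩)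
    fun h => ⟨fun e => h.1 ⟨e.2, e.1⟩, h.2.symm⟩⟩
  loopless := ⟨fun a h => h.elim (fun h => H.loopless.irrefl a h.2.2)
    fun h => G.loopless.irrefl a h.2⟩

theorem patch_adj_of_mem {V : Type*} {G H : SimpleGraph V} {M : Finset V} {a b : V} (ha : a ∈ M)
    (hb : b ∈ M) : (patch G H M).Adj a b ↔ H.Adj a b := by
  simp [patch, ha, hb]

theorem patch_adj_of_not {V : Type*} {G H : SimpleGraph V} {M : Finset V} {a b : V}
    (h : ¬ (a ∈ M ∧ b ∈ M)) : (patch G H M).Adj a b ↔ G.Adj a b := by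
  simp only [patch, h, not_false_eq_true, true_and, ← and_assoc, false_and, false_or]

theorem card_diffPairs_patch_le (G H : SimpleGraph V) (M : Finset V) :
    (diffPairs G (patch G H M)).card ≤ (diffPairs (within G M) H).card := by
  refine card_le_card ?_
  rintro ⟨a, b⟩ hp
  rw [mem_diffPairs] at hp ⊢
  by_cases hM : a ∈ M ∧ b ∈ M
  · rw [patch_adj_of_mem hM.1 hM.2] at hp
    simpa [within, hM.1, hM.2] using hp
  · rw [patch_adj_of_not hM] at hp
    exact absurd Iff.rfl hp

/-- A diamond of the patched graph contains a removed vertex. It has no added edge, as a removed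
vertex would have two neighbours in the bag of that edge. So its five edges belong to `G`, and the
missing pair is either a deleted edge in a triangle with a removed vertex, or the missing pair of a
diamond of `G` with exactly one vertex outside `M`. -/
theorem IsSolved.noDiamond_patch {G H : SimpleGraph V} {k : ℕ} {Y B M : Finset V}
    {Pr : V → V → Prop} {mark : V → V → Finset V} (h : IsSolved G H k Y B M Pr mark) :
    NoDiamond (patch G H M) := by
  intro a b c d hab hac hbc had hbd hcd
  by_contra hn
  have hnM : ¬ (a ∈ M ∧ b ∈ M ∧ c ∈ M ∧ d ∈ M) := by
    rintro ⟨ha, hb, hc, hd⟩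
    exact hn ((patch_adj_of_mem hc hd).mpr (h.opt.noDiamond ((patch_adj_of_mem ha hb).mp hab)
      ((patch_adj_of_mem ha hc).mp hac) ((patch_adj_of_mem hb hc).mp hbc)
      ((patch_adj_of_mem ha hd).mp had) ((patch_adj_of_mem hb hd).mp hbd) hcd))
  -- Suppose that the edge `pq` of the triangle `pqr` is added. Either `r` is removed, with
  -- neighbours `p`, `q` in the bag, or the triangle lies in the bag and `s` is removed, with
  -- neighbours `x`, `y` there.
  have key : ∀ p q r s x y, (patch G H M).Adj p q → (patch G H M).Adj p r →
      (patch G H M).Adj q r → x ≠ y → (x = p ∨ x = q ∨ x = r) → (y = p ∨ y = q ∨ y = r) →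
      (patch G H M).Adj s x → (patch G H M).Adj s y → ¬ (p ∈ M ∧ q ∈ M ∧ r ∈ M ∧ s ∈ M) →
      G.Adj p q := by
    intro p q r s x y hpq hpr hqr hxy hx hy hsx hsy hM
    by_contra hG
    have hpqM : p ∈ M ∧ q ∈ M := by
      by_contra hc; exact hG ((patch_adj_of_not hc).mp hpq)
    obtain ⟨hp, hq⟩ := hpqM
    rw [patch_adj_of_mem hp hq] at hpq
    obtain ⟨Q, hQ, hpQ, hqQ⟩ := h.opt.noDiamond.exists_isBag hpq
    have hr : r ∈ M := by
      by_contra hr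
      rw [patch_adj_of_not fun e => hr e.2] at hpr hqr
      exact h.false_of_two_neighbors hQ hpQ hqQ hpq.ne hG hr hpQ hqQ hpq.ne hpr.symm hqr.symm
    rw [patch_adj_of_mem hp hr] at hpr
    rw [patch_adj_of_mem hq hr] at hqr
    have hrQ : r ∈ Q := hQ.closed hpQ hqQ hpq.ne hpr.symm hqr.symm
    have hs : s ∉ M := fun e => hM ⟨hp, hq, hr, e⟩
    rw [patch_adj_of_not fun e => hs e.1] at hsx hsy
    have hmem : ∀ x, (x = p ∨ x = q ∨ x = r) → x ∈ Q := by
      rintro x (rfl | rfl | rfl) <;> assumption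
    exact h.false_of_two_neighbors hQ hpQ hqQ hpq.ne hG hs (hmem x hx) (hmem y hy) hxy hsx hsy
  have gab : G.Adj a b := key a b c d a b hab hac hbc hab.ne (by simp) (by simp) had.symm hbd.symm
    (by tauto)
  have gac : G.Adj a c := key a c b d a b hac hab hbc.symm hab.ne (by simp) (by simp) had.symm
    hbd.symm (by tauto)
  have gbc : G.Adj b c := key b c a d a b hbc hab.symm hac.symm hab.ne (by simp) (by simp) had.symm
    hbd.symm (by tauto)
  have gad : G.Adj a d := key a d b c a b had hab hbd.symm hab.ne (by simp) (by simp) hac.symm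
    hbc.symm (by tauto)
  have gbd : G.Adj b d := key b d a c a b hbd hab.symm had.symm hab.ne (by simp) (by simp) hac.symm
    hbc.symm (by tauto)
  by_cases gcd : G.Adj c d
  · have hcdM : c ∈ M ∧ d ∈ M := by
      by_contra hc; exact hn ((patch_adj_of_not hc).mpr gcd)
    rw [patch_adj_of_mem hcdM.1 hcdM.2] at hn
    by_cases ha : a ∈ M
    · have hb : b ∉ M := fun e => hnM ⟨ha, e, hcdM⟩
      exact hn (h.adj_of_removed hcdM.1 hcdM.2 gcd hb gbc.symm gbd.symm)
    · exact hn (h.adj_of_removed hcdM.1 hcdM.2 gcd ha gac.symm gad.symm)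
  · have hD : IsDiamond G a b c d := ⟨gab, gac, gbc, gad, gbd, hcd, gcd⟩
    have hD1 : IsDiamond G b a c d := ⟨gab.symm, gbc, gac, gbd, gad, hcd, gcd⟩
    have hD2 : IsDiamond G a b d c := ⟨gab, gad, gbd, gac, gbc, hcd.symm, fun e => gcd e.symm⟩
    have hmem : ∀ v ∈ ({a, b, c, d} : Finset V), v ∉ M → ∀ q ∈ ({a, b, c, d} : Finset V), q ≠ v →
        q ∈ M := by
      intro v hv hvM q hq hqv
      obtain ⟨T, hTY, -, hT⟩ := h.core_of_notMem hD hv fun e => hvM (h.B_sub (h.Y_sub e))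
      exact h.B_sub (h.Y_sub (hTY (hT q hq hqv)))
    by_cases ha : a ∈ M
    · by_cases hb : b ∈ M
      · rw [patch_adj_of_mem ha hb] at hab
        by_cases hc : c ∈ M
        · have hd : d ∉ M := fun e => hnM ⟨ha, hb, hc, e⟩
          rw [patch_adj_of_mem ha hc] at hac
          rw [patch_adj_of_mem hb hc] at hbc
          exact h.false_of_isDiamond_of_removed hd hD2 hab hac hbc
        · have hd : d ∈ M := hmem c (by simp) hc d (by simp) hcd.symm
          rw [patch_adj_of_mem ha hd] at had
          rw [patch_adj_of_mem hb hd] at hbd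
          exact h.false_of_isDiamond_of_removed hc hD hab had hbd
      · have hc : c ∈ M := hmem b (by simp) hb c (by simp) gbc.ne'
        have hd : d ∈ M := hmem b (by simp) hb d (by simp) gbd.ne'
        rw [patch_adj_of_mem ha hc] at hac
        rw [patch_adj_of_mem ha hd] at had
        exact hn ((patch_adj_of_mem hc hd).mpr (h.adj_of_isDiamond_of_removed hb hD1 hac had))
    · have hb : b ∈ M := hmem a (by simp) ha b (by simp) gab.ne'
      have hc : c ∈ M := hmem a (by simp) ha c (by simp) gac.ne'
      have hd : d ∈ M := hmem a (by simp) ha d (by simp) gad.ne'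
      rw [patch_adj_of_mem hb hc] at hbc
      rw [patch_adj_of_mem hb hd] at hbd
      exact hn ((patch_adj_of_mem hc hd).mpr (h.adj_of_isDiamond_of_removed ha hD hbc hbd))

/-- A solution inside `M` extends to a solution. -/
theorem IsMarking.exists_extension {G H : SimpleGraph V} {k : ℕ} {Y B M : Finset V}
    {Pr : V → V → Prop} {mark : V → V → Finset V} (h : IsMarking G k Y B M Pr mark)
    (hH : NoDiamond H) (hM : ∀ ⦃a b⦄, H.Adj a b → a ∈ M)
    (hk : (diffPairs (within G M) H).card ≤ 2 * k) :
    ∃ H', NoDiamond H' ∧ (diffPairs G H').card ≤ 2 * k := by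
  obtain ⟨K, hK, hle⟩ := exists_isOptimal (within G M) H M hH hM
  have hs : IsSolved G K k Y B M Pr mark := { h with opt := hK, diffPairs_le := hle.trans hk }
  exact ⟨_, hs.noDiamond_patch, (card_diffPairs_patch_le G K M).trans hs.diffPairs_le⟩

end Extension

/-! ### Solutions as nearby diamond-free graphs, and packings of diamonds -/

section Instances

set_option linter.unusedSectionVars false

open Classical Finset

theorem diamond_adj (i j : Fin 4) : diamond.Adj i j ↔ i ≠ j ∧ ¬ (i = 0 ∧ j = 3) ∧
    ¬ (i = 3 ∧ j = 0) := by
  simp only [diamond, SimpleGraph.deleteEdges_adj, SimpleGraph.top_adj, Set.mem_singleton_iff,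
    Sym2.eq_iff, not_or]

theorem diamondFree_iff {V : Type*} {H : SimpleGraph V} : DiamondFree H ↔ NoDiamond H := by
  constructor
  · intro h a b c d hab hac hbc had hbd hcd
    by_contra hn
    -- The nonadjacent pair has to go to the positions `0` and `3`.
    refine h ⟨⟨⟨![c, a, b, d], ?_⟩, ?_⟩⟩
    · intro i j hij
      fin_cases i <;> fin_cases j <;> simp_all [hab.ne, hac.ne, hbc.ne, had.ne, hbd.ne,
        hab.ne', hac.ne', hbc.ne', had.ne', hbd.ne', hcd.symm]
    · intro i j
      rw [diamond_adj]
      have hn' : ¬ H.Adj d c := fun e => hn e.symm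
      change H.Adj (![c, a, b, d] i) (![c, a, b, d] j) ↔ _
      fin_cases i <;> fin_cases j <;> simp [hab, hac, hbc, had, hbd, hab.symm, hac.symm, hbc.symm,
        had.symm, hbd.symm, hn, hn']
  · rintro h ⟨f⟩
    have hf : ∀ i j, H.Adj (f i) (f j) ↔ i ≠ j ∧ ¬ (i = 0 ∧ j = 3) ∧ ¬ (i = 3 ∧ j = 0) :=
      fun i j => f.map_adj_iff.trans (diamond_adj i j)
    have := h ((hf 1 2).mpr (by decide)) ((hf 1 0).mpr (by decide)) ((hf 2 0).mpr (by decide))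
      ((hf 1 3).mpr (by decide)) ((hf 2 3).mpr (by decide))
      (fun e => absurd (f.injective e) (by decide))
    exact absurd ((hf 0 3).mp this) (by decide)

variable {V : Type*} [Fintype V] [DecidableEq V]

/-- `H` determines the added edges `H \ G` and the deleted edges `G \ H`; the factor two comes from
counting ordered pairs. -/
theorem exists_isSolution_iff (G : SimpleGraph V) (k : ℕ) :
    (∃ Ep Em : Finset (Sym2 V), IsSolution G k Ep Em) ↔
      ∃ H, NoDiamond H ∧ (diffPairs G H).card ≤ 2 * k := by
  constructor
  · rintro ⟨Ep, Em, h⟩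
    refine ⟨editGraph G Ep Em, diamondFree_iff.mp h.diamondFree, ?_⟩
    have hmaps : ∀ p ∈ diffPairs G (editGraph G Ep Em), s(p.1, p.2) ∈ Ep ∪ Em := by
      rintro ⟨a, b⟩ hp
      rw [mem_diffPairs] at hp
      by_contra hn
      rw [mem_union, not_or] at hn
      apply hp
      simp [editGraph, SimpleGraph.deleteEdges_adj, hn.1, hn.2]
    refine (card_le_mul_card_image_of_maps_to hmaps 2 fun e _ => ?_).trans
      (Nat.mul_le_mul_left 2 h.card_le)
    induction e with
    | h a b =>
      refine (card_le_card (t := {(a, b), (b, a)}) ?_).trans card_le_two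
      rintro ⟨x, y⟩ hp
      simpa [Sym2.eq_iff] using (mem_filter.mp hp).2
  · rintro ⟨H, hH, hk⟩
    refine ⟨(H \ G).edgeFinset, (G \ H).edgeFinset, ?_, ?_, ?_, ?_⟩
    · intro e he
      induction e with
      | h a b =>
        simp only [SimpleGraph.coe_edgeFinset, SimpleGraph.mem_edgeSet,
          SimpleGraph.sdiff_adj] at he
        simp [he.2, he.1.ne]
    · intro e he
      induction e with
      | h a b =>
        simp only [SimpleGraph.coe_edgeFinset, SimpleGraph.mem_edgeSet,
          SimpleGraph.sdiff_adj] at he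
        simpa using he.1
    · have h2 : 2 * ((H \ G).edgeFinset ∪ (G \ H).edgeFinset).card ≤ (diffPairs G H).card := by
        have himg : (H \ G).edgeFinset ∪ (G \ H).edgeFinset ⊆
            (diffPairs G H).image fun p => s(p.1, p.2) := by
          intro e he
          induction e with
          | h a b =>
            simp only [mem_union, SimpleGraph.mem_edgeFinset, SimpleGraph.mem_edgeSet,
              SimpleGraph.sdiff_adj] at he
            refine mem_image.mpr ⟨(a, b), ?_, rfl⟩
            rw [mem_diffPairs]
            tauto
        refine (Nat.mul_le_mul_left 2 (card_le_card himg)).trans ?_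
        refine mul_card_image_le_card _ 2 fun e he => ?_
        obtain ⟨⟨a, b⟩, hp, rfl⟩ := mem_image.mp he
        have hab : a ≠ b := by
          rintro rfl
          rw [mem_diffPairs] at hp
          simp at hp
        have h3 : ({(a, b), (b, a)} : Finset (V × V)).card = 2 :=
          card_pair fun e => hab (congrArg Prod.fst e)
        rw [← h3]
        refine card_le_card ?_
        intro p hp'
        have hp2 : ¬ (H.Adj b a ↔ G.Adj b a) := by
          rw [mem_diffPairs] at hp
          rwa [H.adj_comm b a, G.adj_comm b a]
        simp only [mem_insert, mem_singleton] at hp'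
        rcases hp' with rfl | rfl
        · exact mem_filter.mpr ⟨hp, rfl⟩
        · exact mem_filter.mpr ⟨mem_diffPairs.mpr hp2, Sym2.eq_swap⟩
      omega
    · rw [diamondFree_iff]
      convert hH
      ext a b
      simp only [editGraph, SimpleGraph.deleteEdges_adj, SimpleGraph.sup_adj,
        SimpleGraph.fromEdgeSet_adj, SimpleGraph.coe_edgeFinset, SimpleGraph.mem_edgeSet,
        SimpleGraph.sdiff_adj]
      have := @SimpleGraph.Adj.ne _ H a b
      tauto

theorem diamondFreeEditing_iff (I : GraphInstance) :
    DiamondFreeEditing I ↔ ∃ H, NoDiamond H ∧ (diffPairs I.graph H).card ≤ 2 * I.k :=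
  exists_isSolution_iff I.graph I.k

/-- A solution on an induced subgraph, as a solution on the vertices of the whole graph. -/
theorem exists_within_of_comap {W : Type*} [Fintype W] [DecidableEq W] {G : SimpleGraph V}
    {M : Finset V} (e : W ↪ V) (he : ∀ w, e w ∈ M) (he' : ∀ v ∈ M, ∃ w, e w = v) {k : ℕ}
    {H : SimpleGraph W} (hH : NoDiamond H) (hk : (diffPairs (G.comap e) H).card ≤ k) :
    ∃ K, NoDiamond K ∧ (∀ ⦃a b⦄, K.Adj a b → a ∈ M) ∧ (diffPairs (within G M) K).card ≤ k := by
  have hadj : ∀ x y, (H.map e).Adj (e x) (e y) ↔ H.Adj x y := fun x y => SimpleGraph.map_adj_apply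
  have hex : ∀ {a b}, (H.map e).Adj a b → ∃ x y, e x = a ∧ e y = b := by
    intro a b hab
    obtain ⟨x, y, -, hx, hy⟩ := (SimpleGraph.map_adj _ _ _ _).mp hab
    exact ⟨x, y, hx, hy⟩
  refine ⟨H.map e, ?_, ?_, ?_⟩
  · intro a b c d hab hac hbc had hbd hcd
    obtain ⟨a, b, rfl, rfl⟩ := hex hab
    obtain ⟨c, _, rfl, -⟩ := hex hac.symm
    obtain ⟨d, _, rfl, -⟩ := hex had.symm
    rw [hadj] at *
    exact hH hab hac hbc had hbd fun e' => hcd (e' ▸ rfl)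
  · intro a b hab
    obtain ⟨x, y, rfl, rfl⟩ := hex hab
    exact he x
  · refine le_trans ?_ hk
    have hsub : diffPairs (within G M) (H.map e) ⊆
        (diffPairs (G.comap e) H).image fun p => (e p.1, e p.2) := by
      rintro ⟨a, b⟩ hp
      rw [mem_diffPairs] at hp
      have hab : a ∈ M ∧ b ∈ M := by
        by_contra hc
        refine hp ⟨fun h => ?_, fun h => absurd ⟨h.1, h.2.1⟩ hc⟩
        obtain ⟨x, y, rfl, rfl⟩ := hex h
        exact absurd ⟨he x, he y⟩ hc
      obtain ⟨x, rfl⟩ := he' a hab.1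
      obtain ⟨y, rfl⟩ := he' b hab.2
      refine mem_image.mpr ⟨(x, y), mem_diffPairs.mpr fun h => hp ?_, rfl⟩
      rw [hadj, h]
      exact ⟨fun h => ⟨he x, he y, h⟩, fun h => h.2.2⟩
    exact (card_le_card hsub).trans card_image_le

theorem exists_comap {W : Type*} [Fintype W] [DecidableEq W] {G H : SimpleGraph V} (e : W ↪ V)
    {k : ℕ} (hH : NoDiamond H) (hk : (diffPairs G H).card ≤ k) :
    ∃ K, NoDiamond K ∧ (diffPairs (G.comap e) K).card ≤ k := by
  refine ⟨H.comap e, ?_, ?_⟩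
  · intro a b c d hab hac hbc had hbd hcd
    exact hH hab hac hbc had hbd (e.injective.ne hcd)
  · refine (card_le_card_of_injOn (fun p => (e p.1, e p.2)) ?_ ?_).trans hk
    · rintro ⟨a, b⟩ hp
      rw [mem_coe, mem_diffPairs] at hp ⊢
      exact hp
    · rintro ⟨a, b⟩ - ⟨c, d⟩ - h
      simp only [Prod.mk.injEq, EmbeddingLike.apply_eq_iff_eq] at h
      rw [h.1, h.2]

/-- `G` with the pair `uv` edited. -/
def flipPair {V : Type*} (G : SimpleGraph V) (u v : V) : SimpleGraph V where
  Adj a b := a ≠ b ∧ (G.Adj a b ↔ ¬ (a = u ∧ b = v ∨ a = v ∧ b = u))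
  symm := ⟨fun a b h => ⟨h.1.symm, by rw [G.adj_comm b a, h.2]; tauto⟩⟩
  loopless := ⟨fun _ h => h.1 rfl⟩

/-- `D 0, …, D (N - 1)` are diamonds of `G`, any two of which share at most two vertices. -/
structure IsPacking (G : SimpleGraph V) (N : ℕ) (D : ℕ → Finset V) : Prop where
  isDiamond : ∀ i < N, ∃ a b c d, IsDiamond G a b c d ∧ D i = {a, b, c, d}
  inter_le : ∀ i < N, ∀ j < N, i ≠ j → (D i ∩ D j).card ≤ 2

/-- The indices of the members of the packing that contain `u` and `v`. -/
def pairIndices (N : ℕ) (D : ℕ → Finset V) (u v : V) : Finset ℕ :=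
  (range N).filter fun i => u ∈ D i ∧ v ∈ D i

namespace IsPacking

variable {G H : SimpleGraph V} {N k : ℕ} {D : ℕ → Finset V}

/-- A member without an edited pair would remain a diamond. -/
theorem exists_diff (h : IsPacking G N D) (hH : NoDiamond H) {i : ℕ} (hi : i < N) :
    ∃ p ∈ diffPairs G H, p.1 ∈ D i ∧ p.2 ∈ D i := by
  obtain ⟨a, b, c, d, ⟨hab, hac, hbc, had, hbd, hcd, hn⟩, hD⟩ := h.isDiamond i hi
  rw [hD]
  by_contra hcon
  have key : ∀ x ∈ ({a, b, c, d} : Finset V), ∀ y ∈ ({a, b, c, d} : Finset V),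
      (H.Adj x y ↔ G.Adj x y) := by
    intro x hx y hy
    by_contra hne
    exact hcon ⟨(x, y), mem_diffPairs.mpr hne, hx, hy⟩
  exact hn ((key c (by simp) d (by simp)).mp (hH ((key a (by simp) b (by simp)).mpr hab)
    ((key a (by simp) c (by simp)).mpr hac) ((key b (by simp) c (by simp)).mpr hbc)
    ((key a (by simp) d (by simp)).mpr had) ((key b (by simp) d (by simp)).mpr hbd) hcd))

/-- A pair in many members of the packing is edited by each solution. -/
theorem mem_diffPairs_of_card (h : IsPacking G N D) (hH : NoDiamond H)
    (hk : (diffPairs G H).card ≤ 2 * k) {u v : V} (huv : u ≠ v)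
    (hcard : 2 * k < (pairIndices N D u v).card) : (u, v) ∈ diffPairs G H := by
  by_contra hn
  have hmem : ∀ i ∈ pairIndices N D u v, i < N ∧ u ∈ D i ∧ v ∈ D i := by
    intro i hi
    simpa [pairIndices] using hi
  have : Nonempty (V × V) := ⟨(u, v)⟩
  choose! f hf1 hf2 hf3 using fun i hi => h.exists_diff hH (hmem i hi).1
  obtain ⟨i, hi, j, hj, hij, hfij⟩ := exists_ne_map_eq_of_card_lt_of_maps_to
    (lt_of_le_of_lt hk hcard) (f := f) hf1
  obtain ⟨hiN, hui, hvi⟩ := hmem i hi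
  obtain ⟨hjN, huj, hvj⟩ := hmem j hj
  have hlt := h.inter_le i hiN j hjN hij
  have hpq : (f i).1 ≠ (f i).2 := by
    intro e
    have := mem_diffPairs.mp (hf1 i hi)
    rw [e] at this
    simp at this
  -- The edited pair common to both members is not `uv` in either order, so it supplies a third
  -- common vertex.
  have hex : ∃ x, x ∈ D i ∩ D j ∧ x ≠ u ∧ x ≠ v := by
    have m1 : (f i).1 ∈ D i ∩ D j := mem_inter.mpr ⟨hf2 i hi, hfij ▸ hf2 j hj⟩
    have m2 : (f i).2 ∈ D i ∩ D j := mem_inter.mpr ⟨hf3 i hi, hfij ▸ hf3 j hj⟩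
    by_contra hne
    push Not at hne
    have hn' : ¬ (u, v) ∈ diffPairs G H ∧ ¬ (v, u) ∈ diffPairs G H := by
      refine ⟨hn, fun e => hn ?_⟩
      rw [mem_diffPairs] at e ⊢
      rwa [H.adj_comm u v, G.adj_comm u v]
    have hfm := hf1 i hi
    by_cases h1 : (f i).1 = u
    · have h2 := hne _ m2 (fun e => hpq (h1.trans e.symm))
      exact hn'.1 (by rw [← h1, ← h2]; exact hfm)
    · have h1' := hne _ m1 h1
      by_cases h2 : (f i).2 = u
      · exact hn'.2 (by rw [← h1', ← h2]; exact hfm)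
      · exact hpq (h1'.trans (hne _ m2 h2).symm)
  obtain ⟨x, hx, hxu, hxv⟩ := hex
  have hsub : ({x, u, v} : Finset V) ⊆ D i ∩ D j := by
    intro y hy
    simp only [mem_insert, mem_singleton] at hy
    rcases hy with rfl | rfl | rfl
    · exact hx
    · exact mem_inter.mpr ⟨hui, huj⟩
    · exact mem_inter.mpr ⟨hvi, hvj⟩
  have h3 := card_le_card hsub
  rw [card_eq_three.mpr ⟨x, u, v, hxu, hxv, huv, rfl⟩] at h3
  omega

/-- There are at most `2k` edited ordered pairs, each inside at most `2k` members, and every member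
contains one. -/
theorem card_le (h : IsPacking G N D) (hH : NoDiamond H) (hk : (diffPairs G H).card ≤ 2 * k)
    (hpair : ∀ u v, u ≠ v → (pairIndices N D u v).card ≤ 2 * k) : N ≤ 2 * k * (2 * k) := by
  rcases Nat.eq_zero_or_pos N with rfl | hN
  · exact Nat.zero_le _
  obtain ⟨p₀, -⟩ := h.exists_diff hH hN
  have : Nonempty (V × V) := ⟨p₀⟩
  choose! f hf1 hf2 hf3 using fun i (hi : i ∈ range N) => h.exists_diff hH (mem_range.mp hi)
  have := card_le_mul_card_image_of_maps_to hf1 (2 * k) fun p hp => by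
    have hpq : p.1 ≠ p.2 := by
      intro e
      have := mem_diffPairs.mp hp
      rw [e] at this
      simp at this
    refine (card_le_card fun i hi => ?_).trans (hpair p.1 p.2 hpq)
    rw [mem_filter] at hi
    rw [pairIndices, mem_filter]
    exact ⟨hi.1, hi.2 ▸ hf2 i hi.1, hi.2 ▸ hf3 i hi.1⟩
  rw [card_range] at this
  exact this.trans (Nat.mul_le_mul_left _ hk)

/-- Every solution edits `uv`, so making this edit in advance saves exactly one edit, that is, two
ordered pairs. -/
theorem flipPair_iff (h : IsPacking G N D) {u v : V} (huv : u ≠ v)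
    (hcard : 2 * k < (pairIndices N D u v).card) (hk : 1 ≤ k) :
    (∃ H, NoDiamond H ∧ (diffPairs (flipPair G u v) H).card ≤ 2 * (k - 1)) ↔
      ∃ H, NoDiamond H ∧ (diffPairs G H).card ≤ 2 * k := by
  have hpc : ({(u, v), (v, u)} : Finset (V × V)).card = 2 :=
    card_pair fun e => huv (congrArg Prod.fst e)
  have hpair : ∀ p : V × V, p ∈ ({(u, v), (v, u)} : Finset (V × V)) ↔
      p.1 = u ∧ p.2 = v ∨ p.1 = v ∧ p.2 = u := by
    rintro ⟨a, b⟩; simp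
  have hne : ∀ H : SimpleGraph V, ∀ p : V × V, p ∉ ({(u, v), (v, u)} : Finset (V × V)) →
      (p ∈ diffPairs G H ↔ p ∈ diffPairs (flipPair G u v) H) := by
    rintro H ⟨a, b⟩ hp
    rw [hpair] at hp
    have : (flipPair G u v).Adj a b ↔ G.Adj a b := by
      simp only [flipPair, hp, not_false_eq_true, iff_true, and_iff_right_iff_imp]
      exact fun e => e.ne
    rw [mem_diffPairs, mem_diffPairs, this]
  constructor
  · rintro ⟨H, hH, hd⟩
    refine ⟨H, hH, ?_⟩
    have hsub : diffPairs G H ⊆ diffPairs (flipPair G u v) H ∪ {(u, v), (v, u)} := by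
      intro p hp
      rw [mem_union]
      by_cases hpm : p ∈ ({(u, v), (v, u)} : Finset (V × V))
      · exact Or.inr hpm
      · exact Or.inl ((hne H p hpm).mp hp)
    have h1 := (card_le_card hsub).trans (card_union_le _ _)
    omega
  · rintro ⟨H, hH, hd⟩
    refine ⟨H, hH, ?_⟩
    have hmem := h.mem_diffPairs_of_card hH hd huv hcard
    have hmem' : (v, u) ∈ diffPairs G H := by
      rw [mem_diffPairs] at hmem ⊢
      rwa [H.adj_comm v u, G.adj_comm v u]
    have hpsub : ({(u, v), (v, u)} : Finset (V × V)) ⊆ diffPairs G H := by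
      intro p hp
      simp only [mem_insert, mem_singleton] at hp
      rcases hp with rfl | rfl <;> assumption
    have hsub : diffPairs (flipPair G u v) H ⊆ diffPairs G H \ {(u, v), (v, u)} := by
      intro p hp
      have hpm : p ∉ ({(u, v), (v, u)} : Finset (V × V)) := by
        intro hpm
        have h1 := mem_diffPairs.mp (hpsub hpm)
        have h2 := mem_diffPairs.mp hp
        have hpe := (hpair p).mp hpm
        have hne' : p.1 ≠ p.2 := by
          rcases hpe with ⟨e1, e2⟩ | ⟨e1, e2⟩ <;> rw [e1, e2]
          exacts [huv, huv.symm]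
        have : (flipPair G u v).Adj p.1 p.2 ↔ ¬ G.Adj p.1 p.2 := by
          simp only [flipPair]
          tauto
        rw [this] at h2
        tauto
      exact Finset.mem_sdiff.mpr ⟨(hne H p hpm).mpr hp, hpm⟩
    have h1 := card_le_card hsub
    have h2 := card_sdiff_add_card_eq_card hpsub
    omega

end IsPacking

end Instances

/-! ### Choosing and counting the kept vertices -/

section Marking

set_option linter.unusedSectionVars false

open Classical Finset

/-- The `t` smallest elements of `C`. -/
noncomputable def firstElems {n : ℕ} (C : Finset (Fin n)) (t : ℕ) : Finset (Fin n) :=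
  C.filter fun v => (C.filter fun w => w < v).card < t

theorem card_firstElems_le {n : ℕ} (C : Finset (Fin n)) (t : ℕ) : (firstElems C t).card ≤ t := by
  by_contra hlt
  push Not at hlt
  have hne : (firstElems C t).Nonempty := card_pos.mp (by omega)
  obtain ⟨hm, hm'⟩ := mem_filter.mp ((firstElems C t).max'_mem hne)
  have hsub : (firstElems C t).erase ((firstElems C t).max' hne) ⊆
      C.filter fun w => w < (firstElems C t).max' hne := by
    intro x hx
    rw [mem_erase] at hx
    exact mem_filter.mpr ⟨(mem_filter.mp hx.2).1, lt_of_le_of_ne (le_max' _ _ hx.2) hx.1⟩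
  have h1 := card_le_card hsub
  rw [card_erase_of_mem (max'_mem _ _)] at h1
  omega

/-- The least omitted element has at least `t` smaller ones, all of them selected. -/
theorem le_card_firstElems {n : ℕ} {C : Finset (Fin n)} {t : ℕ} {v : Fin n} (hv : v ∈ C)
    (hv' : v ∉ firstElems C t) : t ≤ (firstElems C t).card := by
  have hne : (C \ firstElems C t).Nonempty := ⟨v, Finset.mem_sdiff.mpr ⟨hv, hv'⟩⟩
  set m := (C \ firstElems C t).min' hne
  obtain ⟨hmC, hmF⟩ := Finset.mem_sdiff.mp (min'_mem _ hne)
  have hsub : (C.filter fun w => w < m) ⊆ firstElems C t := by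
    intro x hx
    rw [mem_filter] at hx
    by_contra hxF
    exact absurd (min'_le _ x (Finset.mem_sdiff.mpr ⟨hx.1, hxF⟩)) (not_le.mpr hx.2)
  have hrank : t ≤ (C.filter fun w => w < m).card := by
    by_contra hlt
    exact hmF (mem_filter.mpr ⟨hmC, not_le.mp hlt⟩)
  exact hrank.trans (card_le_card hsub)

variable {n : ℕ} (G : SimpleGraph (Fin n)) (k N : ℕ) (D : ℕ → Finset (Fin n))

/-- The vertices of the packing. -/
noncomputable def coreVerts : Finset (Fin n) := univ.filter fun v => ∃ i < N, v ∈ D i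

/-- The common neighbours of `a` and `b` outside the packing that are kept. -/
noncomputable def keptNbrs (a b : Fin n) : Finset (Fin n) :=
  firstElems (univ.filter fun v => v ∉ coreVerts N D ∧ G.Adj a v ∧ G.Adj b v) (2 * k + 2)

noncomputable def baseVerts : Finset (Fin n) :=
  univ.filter fun v => v ∈ coreVerts N D ∨
    ∃ w w', (∃ i < N, w ∈ D i ∧ w' ∈ D i) ∧ v ∈ keptNbrs G k N D w w'

/-- The vertices of the kernel. -/
noncomputable def kernelVerts : Finset (Fin n) :=
  univ.filter fun v => v ∈ baseVerts G k N D ∨ ∃ c d, c ∈ baseVerts G k N D ∧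
    (d ∈ baseVerts G k N D ∨ ∃ x, x ∈ baseVerts G k N D ∧ d ∈ keptNbrs G k N D x c) ∧
    v ∈ keptNbrs G k N D c d

variable {G k N D}

theorem isMarking_of_maximal (hmax : ∀ ⦃a b c d⦄, IsDiamond G a b c d →
      ∃ i < N, 3 ≤ (({a, b, c, d} : Finset (Fin n)) ∩ D i).card) :
    IsMarking G k (coreVerts N D) (baseVerts G k N D) (kernelVerts G k N D)
      (fun w w' => ∃ i < N, w ∈ D i ∧ w' ∈ D i) (keptNbrs G k N D) where
  core a b c d hD := by
    obtain ⟨i, hi, h3⟩ := hmax hD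
    exact ⟨D i, fun v hv => mem_filter.mpr ⟨mem_univ v, i, hi, hv⟩,
      fun w hw w' hw' => ⟨i, hi, hw, hw'⟩, h3⟩
  mark_sub a b v hv := (mem_filter.mp (mem_filter.mp hv).1).2
  mark_full a b v h1 h2 h3 h4 :=
    le_card_firstElems (mem_filter.mpr ⟨mem_univ v, h1, h2, h3⟩) h4
  Y_sub v hv := mem_filter.mpr ⟨mem_univ v, Or.inl hv⟩
  B_sub v hv := mem_filter.mpr ⟨mem_univ v, Or.inl hv⟩
  mark_pair a b hab v hv := mem_filter.mpr ⟨mem_univ v, Or.inr ⟨a, b, hab, hv⟩⟩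
  mark_base a b ha hb v hv := mem_filter.mpr ⟨mem_univ v, Or.inr ⟨a, b, ha, Or.inl hb, hv⟩⟩
  mark_next x c d hx hc hd v hv :=
    mem_filter.mpr ⟨mem_univ v, Or.inr ⟨c, d, hc, Or.inr ⟨x, hx, hd⟩, hv⟩⟩

theorem card_keptNbrs_le (a b : Fin n) : (keptNbrs G k N D a b).card ≤ 2 * k + 2 :=
  card_firstElems_le _ _

theorem card_coreVerts_le (hD : ∀ i < N, (D i).card ≤ 4) : (coreVerts N D).card ≤ N * 4 := by
  have : coreVerts N D ⊆ (range N).biUnion D := by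
    intro v hv
    obtain ⟨i, hi, hv⟩ := (mem_filter.mp hv).2
    exact mem_biUnion.mpr ⟨i, mem_range.mpr hi, hv⟩
  refine (card_le_card this).trans ((card_biUnion_le_card_mul _ _ 4 fun i hi =>
    hD i (mem_range.mp hi)).trans (by simp))

theorem card_baseVerts_le (hD : ∀ i < N, (D i).card ≤ 4) :
    (baseVerts G k N D).card ≤ N * 4 + N * (4 * (4 * (2 * k + 2))) := by
  have : baseVerts G k N D ⊆ coreVerts N D ∪ (range N).biUnion fun i => (D i).biUnion fun w =>
      (D i).biUnion fun w' => keptNbrs G k N D w w' := by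
    intro v hv
    rw [mem_union]
    refine (mem_filter.mp hv).2.imp id ?_
    rintro ⟨w, w', ⟨i, hi, hw, hw'⟩, hv⟩
    exact mem_biUnion.mpr ⟨i, mem_range.mpr hi, mem_biUnion.mpr ⟨w, hw,
      mem_biUnion.mpr ⟨w', hw', hv⟩⟩⟩
  refine (card_le_card this).trans ((card_union_le _ _).trans
    (Nat.add_le_add (card_coreVerts_le hD) ?_))
  refine (card_biUnion_le_card_mul _ _ (4 * (4 * (2 * k + 2))) fun i hi => ?_).trans (by simp)
  have h4 := hD i (mem_range.mp hi)
  refine (card_biUnion_le_card_mul _ _ (4 * (2 * k + 2)) fun w _ => ?_).trans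
    (Nat.mul_le_mul_right _ h4)
  exact (card_biUnion_le_card_mul _ _ (2 * k + 2) fun w' _ => card_keptNbrs_le w w').trans
    (Nat.mul_le_mul_right _ h4)

/-- Over `b` choices of `c`, there are at most `b + b(2k + 2)` choices of `d`, and `2k + 2` vertices
are kept for each pair. With `b = O(k³)` this is `O(k⁸)`. -/
theorem card_kernelVerts_le {b : ℕ} (hb : (baseVerts G k N D).card ≤ b) :
    (kernelVerts G k N D).card ≤ b + b * ((b + b * (2 * k + 2)) * (2 * k + 2)) := by
  have : kernelVerts G k N D ⊆ baseVerts G k N D ∪ (baseVerts G k N D).biUnion fun c =>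
      (baseVerts G k N D ∪ (baseVerts G k N D).biUnion fun x => keptNbrs G k N D x c).biUnion
        fun d => keptNbrs G k N D c d := by
    intro v hv
    rw [mem_union]
    refine (mem_filter.mp hv).2.imp id ?_
    rintro ⟨c, d, hc, hd, hv⟩
    refine mem_biUnion.mpr ⟨c, hc, mem_biUnion.mpr ⟨d, ?_, hv⟩⟩
    rw [mem_union]
    exact hd.imp id fun ⟨x, hx, hd⟩ => mem_biUnion.mpr ⟨x, hx, hd⟩
  refine (card_le_card this).trans ((card_union_le _ _).trans (Nat.add_le_add hb ?_))
  refine (card_biUnion_le_card_mul _ _ ((b + b * (2 * k + 2)) * (2 * k + 2)) fun c _ => ?_).trans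
    (Nat.mul_le_mul_right _ hb)
  refine (card_biUnion_le_card_mul _ _ (2 * k + 2) fun d _ => card_keptNbrs_le c d).trans
    (Nat.mul_le_mul_right _ ?_)
  refine (card_union_le _ _).trans (Nat.add_le_add hb ?_)
  exact (card_biUnion_le_card_mul _ _ (2 * k + 2) fun x _ => card_keptNbrs_le x c).trans
    (Nat.mul_le_mul_right _ hb)

end Marking

/-- Bounds the number of vertices in `B`. -/
def baseBound (k : ℕ) : ℕ :=
  2 * k * (2 * k) * 4 + 2 * k * (2 * k) * (4 * (4 * (2 * k + 2)))

/-- Bounds the number of vertices of the kernel. -/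
def kernelBound (k : ℕ) : ℕ :=
  baseBound k + baseBound k * ((baseBound k + baseBound k * (2 * k + 2)) * (2 * k + 2)) + k + 4

theorem kernelBound_isBigO :
    (fun k : ℕ => (kernelBound k : ℝ)) =O[atTop] fun k : ℕ => (k : ℝ) ^ 8 := by
  refine IsBigO.of_bound ((272 + 272 * (272 * 5) * 4 + 5 : ℕ) : ℝ) ?_
  filter_upwards [eventually_ge_atTop 1] with k hk
  rw [Real.norm_of_nonneg (by positivity), Real.norm_of_nonneg (by positivity)]
  have h1 : 2 * k + 2 ≤ 4 * k := by omega
  have hpow : ∀ i j, i ≤ j → k ^ i ≤ k ^ j := fun i j h => Nat.pow_le_pow_right hk h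
  have hb : baseBound k ≤ 272 * k ^ 3 := by
    calc baseBound k ≤ 2 * k * (2 * k) * 4 + 2 * k * (2 * k) * (4 * (4 * (4 * k))) := by
          unfold baseBound; gcongr
      _ = 16 * k ^ 2 + 256 * k ^ 3 := by ring
      _ ≤ 16 * k ^ 3 + 256 * k ^ 3 := by gcongr; norm_num
      _ = 272 * k ^ 3 := by ring
  have hg : kernelBound k ≤ (272 + 272 * (272 * 5) * 4 + 5) * k ^ 8 := by
    calc kernelBound k ≤ 272 * k ^ 3 + 272 * k ^ 3 * ((272 * k ^ 3 + 272 * k ^ 3 * (4 * k)) *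
            (4 * k)) + k + 4 := by unfold kernelBound; gcongr
      _ = 272 * k ^ 3 + 272 * (272 * (k ^ 7 + 4 * k ^ 8)) * 4 + k ^ 1 + 4 * k ^ 0 := by ring
      _ ≤ 272 * k ^ 8 + 272 * (272 * (k ^ 8 + 4 * k ^ 8)) * 4 + k ^ 8 + 4 * k ^ 8 := by
          gcongr <;> first | exact hk | norm_num
      _ = _ := by ring
  exact_mod_cast hg

/-! ### Logic, counting and graph predicates as terms -/

namespace RAM

namespace Tm

/-- The condition `t` holds: its value is not zero. -/
def holds (t : Tm) (s : State) : Prop := t.eval s ≠ 0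

/-- Truth is a nonzero value. This returns `0` or `1`, so applying it twice turns a condition into
its indicator. -/
def not (a : Tm) : Tm := sub (const 1) a

def and (a b : Tm) : Tm := not (add (not a) (not b))

def lt (a b : Tm) : Tm := sub b a

def eq (a b : Tm) : Tm := not (add (sub a b) (sub b a))

/-- The number of values of `x` below the content of `b` for which `t` holds. -/
def count (x b : ℕ) (t : Tm) : Tm := sum x b (not (not t))

variable {s : State} {a b t : Tm}

@[simp] theorem holds_not : (not a).holds s ↔ ¬ a.holds s := by
  simp only [holds, not, eval]; omega

@[simp] theorem holds_and : (and a b).holds s ↔ a.holds s ∧ b.holds s := by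
  simp only [holds, and, not, eval]; omega

@[simp] theorem holds_add : (add a b).holds s ↔ a.holds s ∨ b.holds s := by
  simp only [holds, eval]; omega

@[simp] theorem holds_lt : (lt a b).holds s ↔ a.eval s < b.eval s := by
  simp only [holds, lt, eval]; omega

@[simp] theorem holds_eq : (eq a b).holds s ↔ a.eval s = b.eval s := by
  simp only [holds, eq, not, eval]; omega

theorem holds_sum {x b : ℕ} : (sum x b t).holds s ↔ ∃ i < s.reg b, t.holds (s.setReg x i) := by
  simp [holds, eval, Finset.sum_eq_zero_iff]

theorem eval_not_not [Decidable (t.holds s)] : (not (not t)).eval s = if t.holds s then 1 else 0 := by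
  simp only [not, eval]
  split_ifs with h
  · have : t.eval s ≠ 0 := h
    omega
  · have : t.eval s = 0 := not_ne_iff.mp h
    omega

open Classical in
theorem eval_count {x b : ℕ} : (count x b t).eval s =
    ((Finset.range (s.reg b)).filter fun i => t.holds (s.setReg x i)).card := by
  simp only [count, eval, eval_not_not, Finset.card_filter]

theorem holds_sum_fin {n x : ℕ} (hn : s.reg 0 = n) :
    (sum x 0 t).holds s ↔ ∃ i : Fin n, t.holds (s.setReg x i) := by
  rw [holds_sum, hn, Fin.exists_iff]
  simp

open Classical in
theorem card_filter_range {n : ℕ} (P : ℕ → Prop) : ((Finset.range n).filter P).card =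
    (Finset.univ.filter fun i : Fin n => P i).card := by
  rw [Finset.card_filter, Finset.card_filter, Finset.sum_range]

open Classical in
theorem eval_count_fin {n x : ℕ} (hn : s.reg 0 = n) : (count x 0 t).eval s =
    (Finset.univ.filter fun i : Fin n => t.holds (s.setReg x i)).card := by
  rw [eval_count, hn, card_filter_range]

/-- The least value of `x` for which `t` holds. -/
def first (x : ℕ) (t : Tm) : Tm :=
  sum 27 0 (not (sum x 0 (and (not (lt (reg 27) (reg x))) t)))

/-- The term counts the `j < n` that have no witness at or below them; these are exactly the numbers
below the least witness. -/
theorem exists_eval_first {n x : ℕ} (hn : s.reg 0 = n) (hx : x ≠ 27) {P : Fin n → Prop}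
    (ht : ∀ (j : ℕ) (i : Fin n), t.holds ((s.setReg 27 j).setReg x i) ↔ P i) (hP : ∃ i, P i) :
    ∃ i, P i ∧ (first x t).eval s = i := by
  classical
  have hex : ∃ i, ∃ h : i < n, P ⟨i, h⟩ := by
    obtain ⟨i, hi⟩ := hP
    exact ⟨i, i.2, hi⟩
  obtain ⟨hlt, hPm⟩ := Nat.find_spec hex
  refine ⟨⟨Nat.find hex, hlt⟩, hPm, ?_⟩
  have hterm : ∀ j, (not (sum x 0 (and (not (lt (reg 27) (reg x))) t))).eval (s.setReg 27 j) =
      if j < Nat.find hex then 1 else 0 := by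
    intro j
    have h1 : (sum x 0 (and (not (lt (reg 27) (reg x))) t)).holds (s.setReg 27 j) ↔
        ¬ j < Nat.find hex := by
      rw [holds_sum_fin (n := n) (by simpa using hn)]
      simp only [holds_and, holds_not, holds_lt, ht, eval, State.setReg_reg_self,
        State.setReg_reg_of_ne _ _ hx.symm]
      rw [not_lt, Nat.find_le_iff]
      constructor
      · rintro ⟨i, hij, hi⟩
        exact ⟨i, not_lt.mp hij, i.2, hi⟩
      · rintro ⟨i, hij, hin, hi⟩
        exact ⟨⟨i, hin⟩, not_lt.mpr hij, hi⟩
    simp only [holds] at h1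
    rw [not, eval, eval]
    split_ifs with h <;> simp only [h, not_true_eq_false, not_false_eq_true, iff_false,
      iff_true] at h1 <;> omega
  simp only [first, eval, hn]
  rw [Finset.sum_congr rfl fun j _ => hterm j, ← Finset.card_filter]
  have : (Finset.range n).filter (fun j => j < Nat.find hex) = Finset.range (Nat.find hex) := by
    ext j
    simp only [Finset.mem_filter, Finset.mem_range]
    omega
  rw [this, Finset.card_range]

/-- The number of values of `x` for which `t` holds, times `v`. -/
def scale (x : ℕ) (t v : Tm) : Tm := sum x 0 (sub v (sum 28 2 (not t)))

open Classical in
-- A product without multiplication: where `t` fails, the inner sum equals the content of register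
-- `2`, which is at least `V`, and truncated subtraction gives zero; where `t` holds, `V` remains.
theorem eval_scale {n x V : ℕ} {v : Tm} (hn : s.reg 0 = n) (hx : x ≠ 2) (hV : V ≤ s.reg 2)
    (hv : ∀ i, v.eval (s.setReg x i) = V) {P : Fin n → Prop}
    (ht : ∀ (j : ℕ) (i : Fin n), t.holds ((s.setReg x i).setReg 28 j) ↔ P i) :
    (scale x t v).eval s = (Finset.univ.filter P).card * V := by
  simp only [scale, eval, hn, hv, State.setReg_reg_of_ne _ _ hx.symm]
  rw [Finset.card_filter, Finset.sum_mul, Finset.sum_range]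
  refine Finset.sum_congr rfl fun i _ => ?_
  have h1 : ∀ j, 1 - t.eval ((s.setReg x i).setReg 28 j) = if P i then 0 else 1 := by
    intro j
    have := ht j i
    simp only [holds] at this
    split_ifs with h <;> simp only [h, iff_true, iff_false] at this <;> omega
  simp only [not, eval, h1]
  split_ifs <;> simp [hV]

/-- The entry of the adjacency matrix at `u`, `v`. -/
def adj (u v : ℕ) : Tm := load (add (sum 29 0 (reg u)) (reg v))

theorem eval_adj {u v : ℕ} (hu : u ≠ 29) : (adj u v).eval s = s.mem (s.reg 0 * s.reg u + s.reg v) := by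
  simp [adj, eval, hu]

/-- The address of the component `c` of the member `x` of the packing. -/
def entryAddr (x c : ℕ) : Tm :=
  add (reg 3) (add (add (add (reg x) (reg x)) (add (reg x) (reg x))) (const c))

theorem eval_entryAddr {x c : ℕ} : (entryAddr x c).eval s = s.reg 3 + 4 * s.reg x + c := by
  simp only [entryAddr, eval]; ring

/-- `v` belongs to the member `x` of the packing. -/
def inMember (v x : ℕ) : Tm :=
  add (add (eq (load (entryAddr x 0)) (reg v)) (eq (load (entryAddr x 1)) (reg v)))
    (add (eq (load (entryAddr x 2)) (reg v)) (eq (load (entryAddr x 3)) (reg v)))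

/-- `t` holds for the index `x` of some member of the packing. -/
def someIndex (x : ℕ) (t : Tm) : Tm := sum x 2 (and (lt (reg x) (reg 4)) t)

/-- Each predicate binds registers above those of its arguments: `26` here, `25` for kept vertices,
`22` to `24` for `B`, `19` to `21` for the kernel. So nesting never captures an argument. -/
def inCore (v : ℕ) : Tm := someIndex 26 (inMember v 26)

def isCand (a b v : ℕ) : Tm := and (not (inCore v)) (and (adj a v) (adj b v))

def isKept (a b v : ℕ) : Tm :=
  and (isCand a b v) (lt (count 25 0 (and (isCand a b 25) (lt (reg 25) (reg v))))
    (add (add (reg 1) (reg 1)) (const 2)))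

def inBase (v : ℕ) : Tm :=
  add (inCore v) (sum 22 0 (sum 23 0
    (and (someIndex 24 (and (inMember 22 24) (inMember 23 24))) (isKept 22 23 v))))

def inKernel (v : ℕ) : Tm :=
  add (inBase v) (sum 19 0 (sum 20 0 (and (inBase 19)
    (and (add (inBase 20) (sum 21 0 (and (inBase 21) (isKept 21 19 20)))) (isKept 19 20 v)))))

/-- The vertices in the registers `7`, …, `10` form a diamond that shares at most two vertices with
each member of the packing. -/
def isFresh : Tm :=
  and (and (and (adj 7 8) (adj 7 9)) (and (adj 8 9) (and (adj 7 10) (adj 8 10))))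
    (and (and (not (eq (reg 9) (reg 10))) (not (adj 9 10)))
      (not (someIndex 14 (lt (const 2) (count 15 0 (and (add (add (eq (reg 15) (reg 7))
        (eq (reg 15) (reg 8))) (add (eq (reg 15) (reg 9)) (eq (reg 15) (reg 10))))
        (inMember 15 14)))))))

/-- The vertices in the registers `7` and `8` are different and lie in more than `2k` members of
the packing. -/
def isHeavy : Tm :=
  and (not (eq (reg 7) (reg 8))) (lt (add (reg 1) (reg 1))
    (count 14 2 (and (lt (reg 14) (reg 4)) (and (inMember 7 14) (inMember 8 14)))))

end Tm

/-! ### Meaning of the terms in a state that stores a graph and a packing -/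

open Classical Finset

/-- The state `s` holds the graph `G`, the parameter `k` and the packing `D 0, …, D (N - 1)`. -/
structure Stores (s : State) {n : ℕ} (G : SimpleGraph (Fin n)) (k N : ℕ)
    (D : ℕ → Finset (Fin n)) : Prop where
  reg_zero : s.reg 0 = n
  reg_one : s.reg 1 = k
  reg_two : s.reg 2 = n ^ 4
  reg_three : s.reg 3 = n ^ 2
  reg_four : s.reg 4 = N
  le : N ≤ n ^ 4
  adj : ∀ i j : Fin n, s.mem (n * i + j) ≠ 0 ↔ G.Adj i j
  member : ∀ q < N, ∀ i, i ∈ D q ↔ ∃ c < 4, s.mem (n ^ 2 + 4 * q + c) = i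

namespace Stores

variable {s : State} {n k N : ℕ} {G : SimpleGraph (Fin n)} {D : ℕ → Finset (Fin n)}

theorem setReg (h : Stores s G k N D) {r : ℕ} (hr : 5 ≤ r) (v : ℕ) :
    Stores (s.setReg r v) G k N D where
  reg_zero := by rw [State.setReg_reg_of_ne _ _ (by omega), h.reg_zero]
  reg_one := by rw [State.setReg_reg_of_ne _ _ (by omega), h.reg_one]
  reg_two := by rw [State.setReg_reg_of_ne _ _ (by omega), h.reg_two]
  reg_three := by rw [State.setReg_reg_of_ne _ _ (by omega), h.reg_three]
  reg_four := by rw [State.setReg_reg_of_ne _ _ (by omega), h.reg_four]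
  le := h.le
  adj := h.adj
  member := h.member

theorem holds_adj (h : Stores s G k N D) {u v : ℕ} (hu : u ≠ 29) {i j : Fin n} (hi : s.reg u = i)
    (hj : s.reg v = j) : (Tm.adj u v).holds s ↔ G.Adj i j := by
  rw [Tm.holds, Tm.eval_adj hu, h.reg_zero, hi, hj, h.adj]

theorem holds_inMember (h : Stores s G k N D) {v x : ℕ} {i : Fin n} (hi : s.reg v = i)
    (hx : s.reg x < N) : (Tm.inMember v x).holds s ↔ i ∈ D (s.reg x) := by
  rw [h.member _ hx]
  simp only [Tm.inMember, Tm.holds_add, Tm.holds_eq, Tm.eval, Tm.eval_entryAddr, h.reg_three, hi]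
  constructor
  · rintro ((h | h) | (h | h))
    exacts [⟨0, by norm_num, h⟩, ⟨1, by norm_num, h⟩, ⟨2, by norm_num, h⟩, ⟨3, by norm_num, h⟩]
  · rintro ⟨c, hc, h⟩
    interval_cases c
    exacts [Or.inl (Or.inl h), Or.inl (Or.inr h), Or.inr (Or.inl h), Or.inr (Or.inr h)]

/-- The sum runs up to `n⁴`, which covers all indices because `N ≤ n⁴`. -/
theorem holds_someIndex (h : Stores s G k N D) {x : ℕ} (hx : 5 ≤ x) {t : Tm} :
    (Tm.someIndex x t).holds s ↔ ∃ q < N, t.holds (s.setReg x q) := by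
  have h4 : 4 ≠ x := by omega
  simp only [Tm.someIndex, Tm.holds_sum, h.reg_two, Tm.holds_and, Tm.holds_lt, Tm.eval,
    State.setReg_reg_self, State.setReg_reg_of_ne _ _ h4, h.reg_four]
  exact ⟨fun ⟨q, _, h⟩ => ⟨q, h⟩, fun ⟨q, hq, ht⟩ => ⟨q, hq.trans_le h.le, hq, ht⟩⟩

theorem holds_inCore (h : Stores s G k N D) {v : ℕ} (hv : v < 26) {i : Fin n} (hi : s.reg v = i) :
    (Tm.inCore v).holds s ↔ i ∈ coreVerts N D := by
  rw [Tm.inCore, h.holds_someIndex (by norm_num), coreVerts, mem_filter]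
  simp only [mem_univ, true_and]
  refine exists_congr fun q => and_congr_right fun hq => ?_
  rw [(h.setReg (by norm_num) q).holds_inMember (i := i) (by simpa [hv.ne] using hi) (by simpa),
    State.setReg_reg_self]

theorem holds_isCand (h : Stores s G k N D) {a b v : ℕ} (ha : a < 26) (hb : b < 26) (hv : v < 26)
    {x y i : Fin n} (hx : s.reg a = x) (hy : s.reg b = y) (hi : s.reg v = i) :
    (Tm.isCand a b v).holds s ↔ i ∉ coreVerts N D ∧ G.Adj x i ∧ G.Adj y i := by
  rw [Tm.isCand, Tm.holds_and, Tm.holds_and, Tm.holds_not, h.holds_inCore hv hi,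
    h.holds_adj (by omega) hx hi, h.holds_adj (by omega) hy hi]

theorem holds_isKept (h : Stores s G k N D) {a b v : ℕ} (ha : a < 25) (hb : b < 25) (hv : v < 25)
    {x y i : Fin n} (hx : s.reg a = x) (hy : s.reg b = y) (hi : s.reg v = i) :
    (Tm.isKept a b v).holds s ↔ i ∈ keptNbrs G k N D x y := by
  rw [Tm.isKept, Tm.holds_and, h.holds_isCand (by omega) (by omega) (by omega) hx hy hi,
    Tm.holds_lt, Tm.eval_count_fin h.reg_zero, keptNbrs, firstElems, mem_filter, mem_filter]
  simp only [mem_univ, true_and, Tm.eval, h.reg_one]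
  refine and_congr_right fun _ => ?_
  have : ∀ w : Fin n, ((Tm.isCand a b 25).and ((Tm.reg 25).lt (Tm.reg v))).holds (s.setReg 25 w) ↔
      (w ∉ coreVerts N D ∧ G.Adj x w ∧ G.Adj y w) ∧ w < i := by
    intro w
    rw [Tm.holds_and, (h.setReg (by norm_num) _).holds_isCand (x := x) (y := y) (i := w) (by omega)
      (by omega) (by omega) (by simpa [ha.ne] using hx) (by simpa [hb.ne] using hy) (by simp),
      Tm.holds_lt]
    simp [Tm.eval, hv.ne, hi]
  simp only [this, filter_filter]
  rw [two_mul]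

theorem holds_inBase (h : Stores s G k N D) {v : ℕ} (hv : v < 22) {i : Fin n} (hi : s.reg v = i) :
    (Tm.inBase v).holds s ↔ i ∈ baseVerts G k N D := by
  rw [Tm.inBase, Tm.holds_add, h.holds_inCore (by omega) hi, Tm.holds_sum_fin h.reg_zero, baseVerts,
    mem_filter]
  simp only [mem_univ, true_and]
  refine or_congr_right (exists_congr fun w => ?_)
  rw [Tm.holds_sum_fin (h.setReg (by norm_num) _).reg_zero]
  refine exists_congr fun w' => ?_
  have hs := (h.setReg (r := 22) (by norm_num) w).setReg (r := 23) (by norm_num) w'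
  have hv1 : v ≠ 22 := by omega
  have hv2 : v ≠ 23 := by omega
  rw [Tm.holds_and, hs.holds_isKept (x := w) (y := w') (i := i) (by omega) (by omega) (by omega)
    (by simp) (by simp) (by simpa [hv1, hv2] using hi), hs.holds_someIndex (by norm_num)]
  refine and_congr_left fun _ => exists_congr fun q => and_congr_right fun hq => ?_
  have hs' := hs.setReg (r := 24) (by norm_num) q
  rw [Tm.holds_and, hs'.holds_inMember (i := w) (by simp) (by simpa),
    hs'.holds_inMember (i := w') (by simp) (by simpa), State.setReg_reg_self]

theorem holds_inKernel (h : Stores s G k N D) {v : ℕ} (hv : v < 19) {i : Fin n}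
    (hi : s.reg v = i) : (Tm.inKernel v).holds s ↔ i ∈ kernelVerts G k N D := by
  rw [Tm.inKernel, Tm.holds_add, h.holds_inBase (by omega) hi, Tm.holds_sum_fin h.reg_zero,
    kernelVerts, mem_filter]
  simp only [mem_univ, true_and]
  refine or_congr_right (exists_congr fun c => ?_)
  rw [Tm.holds_sum_fin (h.setReg (by norm_num) _).reg_zero]
  refine exists_congr fun d => ?_
  have hs := (h.setReg (r := 19) (by norm_num) c).setReg (r := 20) (by norm_num) d
  have hv1 : v ≠ 19 := by omega
  have hv2 : v ≠ 20 := by omega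
  rw [Tm.holds_and, Tm.holds_and, Tm.holds_add, hs.holds_inBase (i := c) (by omega) (by simp),
    hs.holds_inBase (i := d) (by omega) (by simp),
    hs.holds_isKept (x := c) (y := d) (i := i) (by omega) (by omega) (by omega)
    (by simp) (by simp) (by simpa [hv1, hv2] using hi), Tm.holds_sum_fin hs.reg_zero]
  refine and_congr_right fun _ => and_congr_left fun _ => or_congr_right (exists_congr fun x => ?_)
  have hs' := hs.setReg (r := 21) (by norm_num) x
  rw [Tm.holds_and, hs'.holds_inBase (i := x) (by omega) (by simp),
    hs'.holds_isKept (x := x) (y := c) (i := d) (by omega) (by omega) (by omega)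
    (by simp) (by simp) (by simp)]

theorem holds_isFresh (h : Stores s G k N D) {a b c d : Fin n} (ha : s.reg 7 = a)
    (hb : s.reg 8 = b) (hc : s.reg 9 = c) (hd : s.reg 10 = d) :
    Tm.isFresh.holds s ↔ IsDiamond G a b c d ∧
      ¬ ∃ q < N, 3 ≤ (({a, b, c, d} : Finset (Fin n)) ∩ D q).card := by
  have hq : ∀ q < N, ((Tm.const 2).lt (Tm.count 15 0 (((((Tm.reg 15).eq (Tm.reg 7)).add
      ((Tm.reg 15).eq (Tm.reg 8))).add (((Tm.reg 15).eq (Tm.reg 9)).add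
      ((Tm.reg 15).eq (Tm.reg 10)))).and (Tm.inMember 15 14)))).holds (s.setReg 14 q) ↔
      3 ≤ (({a, b, c, d} : Finset (Fin n)) ∩ D q).card := by
    intro q hq
    rw [Tm.holds_lt, Tm.eval_count_fin (h.setReg (by norm_num) _).reg_zero]
    have : ∀ w : Fin n, (((((Tm.reg 15).eq (Tm.reg 7)).add
      ((Tm.reg 15).eq (Tm.reg 8))).add (((Tm.reg 15).eq (Tm.reg 9)).add
      ((Tm.reg 15).eq (Tm.reg 10)))).and (Tm.inMember 15 14)).holds
        ((s.setReg 14 q).setReg 15 w) ↔ w ∈ ({a, b, c, d} : Finset (Fin n)) ∩ D q := by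
      intro w
      rw [Tm.holds_and, ((h.setReg (r := 14) (by norm_num) q).setReg (r := 15) (by norm_num)
        w).holds_inMember (i := w) (by simp) (by simpa [State.setReg_reg])]
      simp [Tm.eval, ha, hb, hc, hd, Fin.val_inj, or_assoc]
    simp only [this, filter_mem_eq_inter, univ_inter]
    rfl
  rw [Tm.isFresh]
  simp only [Tm.holds_and, Tm.holds_not, Tm.holds_eq, Tm.eval, hc, hd, Fin.val_inj,
    h.holds_adj (by norm_num) ha hb, h.holds_adj (by norm_num) ha hc,
    h.holds_adj (by norm_num) hb hc, h.holds_adj (by norm_num) ha hd,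
    h.holds_adj (by norm_num) hb hd, h.holds_adj (by norm_num) hc hd,
    h.holds_someIndex (show 5 ≤ 14 by norm_num), IsDiamond]
  have : (∃ q < N, 3 ≤ (({a, b, c, d} : Finset (Fin n)) ∩ D q).card) ↔ _ :=
    exists_congr fun q => and_congr_right fun h => (hq q h).symm
  rw [this]
  tauto

theorem holds_isHeavy (h : Stores s G k N D) {u v : Fin n} (hu : s.reg 7 = u) (hv : s.reg 8 = v) :
    Tm.isHeavy.holds s ↔ u ≠ v ∧ 2 * k < (pairIndices N D u v).card := by
  rw [Tm.isHeavy, Tm.holds_and, Tm.holds_not, Tm.holds_eq, Tm.holds_lt, Tm.eval_count, h.reg_two]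
  simp only [Tm.eval, hu, hv, Fin.val_inj, h.reg_one]
  rw [two_mul]
  have : (range (n ^ 4)).filter (fun q => (((Tm.reg 14).lt (Tm.reg 4)).and ((Tm.inMember 7 14).and
      (Tm.inMember 8 14))).holds (s.setReg 14 q)) = pairIndices N D u v := by
    ext q
    rw [pairIndices, mem_filter, mem_filter, mem_range, mem_range, Tm.holds_and, Tm.holds_lt]
    simp only [Tm.eval, State.setReg_reg_self,
      State.setReg_reg_of_ne s q (show 4 ≠ 14 by norm_num), h.reg_four]
    have hle := h.le
    constructor
    · rintro ⟨h1, h2, h3⟩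
      have hs := h.setReg (r := 14) (by norm_num) q
      rw [Tm.holds_and, hs.holds_inMember (i := u) (by simpa) (by simpa),
        hs.holds_inMember (i := v) (by simpa) (by simpa), State.setReg_reg_self] at h3
      exact ⟨h2, h3⟩
    · rintro ⟨h2, h3⟩
      have hs := h.setReg (r := 14) (by norm_num) q
      rw [Tm.holds_and, hs.holds_inMember (i := u) (by simpa) (by simpa),
        hs.holds_inMember (i := v) (by simpa) (by simpa), State.setReg_reg_self]
      exact ⟨by omega, h2, h3⟩
  rw [this]

end Stores

end RAM

/-! ### Size of packings and equivalence of the possible outputs -/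

section Reduction

open Classical Finset

/-- `H` arises from `G` by at most `k` edits and is diamond-free, for some `H`. -/
def HasSolution {V : Type*} [Fintype V] (G : SimpleGraph V) (k : ℕ) : Prop :=
  ∃ H, NoDiamond H ∧ (diffPairs G H).card ≤ 2 * k

/-- Each diamond of `G` shares at least three vertices with some member of the packing. -/
def IsMaximalPacking {V : Type*} [DecidableEq V] (G : SimpleGraph V) (N : ℕ) (D : ℕ → Finset V) : Prop :=
  ∀ ⦃a b c d⦄, IsDiamond G a b c d → ∃ i < N, 3 ≤ (({a, b, c, d} : Finset V) ∩ D i).card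

theorem IsDiamond.card {V : Type*} {G : SimpleGraph V} {a b c d : V} (h : IsDiamond G a b c d) :
    ({a, b, c, d} : Finset V).card = 4 := by
  obtain ⟨hab, hac, hbc, had, hbd, hcd, -⟩ := h
  rw [card_insert_of_notMem, card_insert_of_notMem, card_pair hcd]
  · simp [hbc.ne, hbd.ne]
  · simp [hab.ne, hac.ne, had.ne]

namespace IsPacking

theorem card_eq {V : Type*} [Fintype V] [DecidableEq V] {G : SimpleGraph V} {N : ℕ}
    {D : ℕ → Finset V} (h : IsPacking G N D) {i : ℕ} (hi : i < N) : (D i).card = 4 := by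
  obtain ⟨a, b, c, d, hd, hD⟩ := h.isDiamond i hi
  rw [hD, ← hd.card]
  congr!

variable {n N k : ℕ} {G : SimpleGraph (Fin n)} {D : ℕ → Finset (Fin n)}

/-- Members are distinct sets of four vertices. Strictness matters: `n⁴` attempts to enlarge a
packing must include a failure. -/
theorem lt_pow (h : IsPacking G N D) (hn : 0 < n) : N < n ^ 4 := by
  have h1 : (range N).card ≤ (powersetCard 4 (univ : Finset (Fin n))).card := by
    refine card_le_card_of_injOn D (fun i hi => ?_) fun i hi j hj hij => ?_
    · rw [mem_coe, mem_range] at hi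
      rw [mem_coe, mem_powersetCard]
      exact ⟨subset_univ _, h.card_eq hi⟩
    · rw [mem_coe, mem_range] at hi hj
      by_contra hne
      have := h.inter_le i hi j hj hne
      rw [← hij, inter_self, h.card_eq hi] at this
      omega
  rw [card_range, card_powersetCard, card_univ, Fintype.card_fin] at h1
  have h2 := Nat.descFactorial_le_pow n 4
  rw [Nat.descFactorial_eq_factorial_mul_choose] at h2
  have h3 : (4).factorial = 24 := rfl
  rw [h3] at h2
  have h4 : 0 < n ^ 4 := by positivity
  omega

/-- The case `k = 0` is separate because no forced edit is made there; a single member already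
excludes a solution. -/
theorem le_of_hasSolution (h : IsPacking G N D) (hs : HasSolution G k)
    (hk : k = 0 ∨ ∀ u v, u ≠ v → (pairIndices N D u v).card ≤ 2 * k) : N ≤ 4 * k * k := by
  obtain ⟨H, hH, hd⟩ := hs
  rcases hk with rfl | hk
  · by_contra hN
    obtain ⟨p, hp, -⟩ := h.exists_diff hH (i := 0) (by omega)
    have := card_pos.mpr ⟨p, hp⟩
    omega
  · refine (h.card_le hH hd hk).trans (le_of_eq ?_)
    ring

theorem hasSolution_flipPair_iff (h : IsPacking G N D) {u v : Fin n} (huv : u ≠ v)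
    (hcard : 2 * k < (pairIndices N D u v).card) (hk : k ≠ 0) :
    HasSolution (flipPair G u v) (k - 1) ↔ HasSolution G k :=
  h.flipPair_iff huv hcard (Nat.one_le_iff_ne_zero.mpr hk)

end IsPacking

variable {n N k : ℕ} {G : SimpleGraph (Fin n)} {D : ℕ → Finset (Fin n)}

/-- The subgraph induced by `M`, with the vertices renumbered. -/
noncomputable def inducedInstance (G : SimpleGraph (Fin n)) (M : Finset (Fin n)) (k : ℕ) :
    GraphInstance :=
  ⟨M.card, G.comap (M.orderEmbOfFin rfl).toEmbedding, k⟩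

theorem exists_within_of_hasSolution {M : Finset (Fin n)}
    (h : HasSolution (inducedInstance G M k).graph k) :
    ∃ K, NoDiamond K ∧ (∀ ⦃a b⦄, K.Adj a b → a ∈ M) ∧ (diffPairs (within G M) K).card ≤ 2 * k := by
  obtain ⟨H, hH, hd⟩ := h
  refine exists_within_of_comap (M.orderEmbOfFin rfl).toEmbedding (fun w => orderEmbOfFin_mem _ _ w)
    (fun v hv => ?_) hH hd
  have : v ∈ Set.range (M.orderEmbOfFin rfl) := by rwa [range_orderEmbOfFin]
  exact this

theorem hasSolution_kernel_iff (h : IsMaximalPacking G N D) :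
    HasSolution (inducedInstance G (kernelVerts G k N D) k).graph k ↔ HasSolution G k := by
  constructor
  · intro hs
    obtain ⟨K, hK, hM, hd⟩ := exists_within_of_hasSolution hs
    exact (isMarking_of_maximal (k := k) h).exists_extension hK hM hd
  · rintro ⟨H, hH, hd⟩
    exact exists_comap _ hH hd

/-- This provides the fixed-size no-instance that is output when the packing is too large. -/
theorem not_hasSolution_member (h : IsPacking G N D) (hN : 0 < N) :
    ¬ HasSolution (inducedInstance G (D 0) 0).graph 0 := by
  intro hs
  obtain ⟨K, hK, hM, hd⟩ := exists_within_of_hasSolution hs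
  have hadj : ∀ a b, K.Adj a b ↔ (within G (D 0)).Adj a b := by
    intro a b
    by_contra hne
    have := card_pos.mpr ⟨(a, b), mem_diffPairs.mpr hne⟩
    omega
  obtain ⟨a, b, c, d, ⟨hab, hac, hbc, had, hbd, hcd, hn⟩, hD⟩ := h.isDiamond 0 hN
  have ha : a ∈ D 0 := by simp [hD]
  have hb : b ∈ D 0 := by simp [hD]
  have hc : c ∈ D 0 := by simp [hD]
  have hd : d ∈ D 0 := by simp [hD]
  exact hn ((hadj c d).mp (hK ((hadj _ _).mpr ⟨ha, hb, hab⟩) ((hadj _ _).mpr ⟨ha, hc, hac⟩)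
    ((hadj _ _).mpr ⟨hb, hc, hbc⟩) ((hadj _ _).mpr ⟨ha, hd, had⟩) ((hadj _ _).mpr ⟨hb, hd, hbd⟩)
    hcd)).2.2

theorem IsPacking.card_kernelVerts_le (h : IsPacking G N D) (hN : N ≤ 4 * k * k) :
    (kernelVerts G k N D).card ≤ kernelBound k := by
  have hN' : N ≤ 2 * k * (2 * k) := hN.trans (le_of_eq (by ring))
  have h1 : (baseVerts G k N D).card ≤ baseBound k := by
    refine (card_baseVerts_le fun i hi => (h.card_eq hi).le).trans ?_
    unfold baseBound
    gcongr
  have h2 := _root_.card_kernelVerts_le h1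
  unfold kernelBound
  omega

end Reduction

/-! ### The program: growing the packing and forced edits -/

namespace RAM

open Classical Finset

theorem Cmd.iterate_induction {x b : ℕ} {c : Cmd} {s : State} {P : ℕ → State → Prop} (h0 : P 0 s)
    (hs : ∀ i < s.reg b, ∀ t, P i t → P (i + 1) (c.denote (t.setReg x i))) :
    ∃ t, P (s.reg b) t ∧ (Cmd.iterate x b c).denote s = t.setReg x (s.reg b) := by
  refine ⟨_, ?_, rfl⟩
  have : ∀ m ≤ s.reg b, P m (iter x c.denote s m) := by
    intro m
    induction m with
    | zero => exact fun _ => h0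
    | succ m ih => exact fun hm => hs m (by omega) _ (ih (by omega))
  exact this _ le_rfl

namespace Cmd

/-- Sets `x` to a value for which `t` holds. -/
def find (x : ℕ) (t : Tm) : Cmd := assign x (t.first x)

/-- Adds a diamond to the packing if it is not maximal. -/
def grow : Cmd :=
  ite (.sum 7 0 (.sum 8 0 (.sum 9 0 (.sum 10 0 .isFresh))))
    (seq (seq (seq (find 7 (.sum 8 0 (.sum 9 0 (.sum 10 0 .isFresh))))
      (find 8 (.sum 9 0 (.sum 10 0 .isFresh)))) (seq (find 9 (.sum 10 0 .isFresh))
      (find 10 .isFresh)))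
      (seq (seq (seq (store (.entryAddr 4 0) (.reg 7)) (store (.entryAddr 4 1) (.reg 8)))
        (seq (store (.entryAddr 4 2) (.reg 9)) (store (.entryAddr 4 3) (.reg 10))))
        (assign 4 (.add (.reg 4) (.const 1)))))
    skip

/-- Edits the pair in the registers `7`, `8` and decreases the parameter. -/
def toggle : Cmd :=
  seq (assign 9 (.not (.adj 7 8)))
    (seq (seq (store (.add (.sum 29 0 (.reg 7)) (.reg 8)) (.reg 9))
      (store (.add (.sum 29 0 (.reg 8)) (.reg 7)) (.reg 9)))
      (assign 1 (.sub (.reg 1) (.const 1))))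

/-- Edits a heavy pair, or sets register `5` if there is none or the parameter is zero. -/
def step : Cmd :=
  ite (.and (.sum 7 0 (.sum 8 0 .isHeavy)) (.reg 1))
    (seq (seq (find 7 (.sum 8 0 .isHeavy)) (find 8 .isHeavy)) toggle)
    (assign 5 (.const 1))

def round : Cmd :=
  ite (.reg 5) skip (seq (assign 4 (.const 0)) (seq (.iterate 13 2 grow) step))

end Cmd

namespace Stores

variable {s : State} {n k N : ℕ} {G : SimpleGraph (Fin n)} {D : ℕ → Finset (Fin n)}

/-- The condition is tested in states where the search counter in register `27` has changed, so its
meaning may depend only on the stored data and on registers below `27`. -/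
theorem exists_find (h : Stores s G k N D) {x : ℕ} (hx5 : 5 ≤ x) (hx : x < 27) {t : Tm}
    {P : Fin n → Prop} (ht : ∀ s', Stores s' G k N D → (∀ r < 27, r ≠ x → s'.reg r = s.reg r) →
      ∀ i : Fin n, s'.reg x = i → (t.holds s' ↔ P i)) (hP : ∃ i, P i) :
    ∃ i, P i ∧ (Cmd.find x t).denote s = s.setReg x i := by
  obtain ⟨i, hi, he⟩ := Tm.exists_eval_first (t := t) h.reg_zero hx.ne (P := P) (fun j i =>
    ht _ ((h.setReg (by norm_num) j).setReg hx5 i) (fun r hr hrx => by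
      rw [State.setReg_reg_of_ne _ _ hrx, State.setReg_reg_of_ne _ _ hr.ne]) i (by simp)) hP
  exact ⟨i, hi, by rw [Cmd.find, Cmd.denote, he]⟩

/-- The diamond `a`, `b`, `c`, `d` can be added to the packing. -/
def Fresh (G : SimpleGraph (Fin n)) (N : ℕ) (D : ℕ → Finset (Fin n)) (a b c d : Fin n) : Prop :=
  IsDiamond G a b c d ∧ ¬ ∃ q < N, 3 ≤ (({a, b, c, d} : Finset (Fin n)) ∩ D q).card

/-- The vertices of a new diamond are found one at a time, so each partial choice needs the
statement that it can be completed. -/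
theorem holds_fresh₃ (h : Stores s G k N D) {a b c : Fin n} (ha : s.reg 7 = a) (hb : s.reg 8 = b)
    (hc : s.reg 9 = c) : (Tm.sum 10 0 .isFresh).holds s ↔ ∃ d, Fresh G N D a b c d := by
  rw [Tm.holds_sum_fin h.reg_zero]
  exact exists_congr fun d => (h.setReg (by norm_num) d).holds_isFresh (by simpa) (by simpa)
    (by simpa) (by simp)

theorem holds_fresh₂ (h : Stores s G k N D) {a b : Fin n} (ha : s.reg 7 = a) (hb : s.reg 8 = b) :
    (Tm.sum 9 0 (.sum 10 0 .isFresh)).holds s ↔ ∃ c d, Fresh G N D a b c d := by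
  rw [Tm.holds_sum_fin h.reg_zero]
  exact exists_congr fun c => (h.setReg (by norm_num) c).holds_fresh₃ (by simpa) (by simpa)
    (by simp)

theorem holds_fresh₁ (h : Stores s G k N D) {a : Fin n} (ha : s.reg 7 = a) :
    (Tm.sum 8 0 (.sum 9 0 (.sum 10 0 .isFresh))).holds s ↔ ∃ b c d, Fresh G N D a b c d := by
  rw [Tm.holds_sum_fin h.reg_zero]
  exact exists_congr fun b => (h.setReg (by norm_num) b).holds_fresh₂ (by simpa) (by simp)

theorem holds_fresh (h : Stores s G k N D) :
    (Tm.sum 7 0 (.sum 8 0 (.sum 9 0 (.sum 10 0 .isFresh)))).holds s ↔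
      ∃ a b c d, Fresh G N D a b c d := by
  rw [Tm.holds_sum_fin h.reg_zero]
  exact exists_congr fun a => (h.setReg (by norm_num) a).holds_fresh₁ (by simp)

theorem addr_lt (i j : Fin n) : n * i + j < n ^ 2 := by
  have h1 : n * i + j < n * (i + 1) := by rw [Nat.mul_succ]; omega
  exact h1.trans_le (by rw [sq]; exact Nat.mul_le_mul_left _ i.2)

theorem addr_inj {i j i' j' : Fin n} (h : n * (i : ℕ) + j = n * i' + j') : i = i' ∧ j = j' := by
  have hn : 0 < n := i.pos
  have h1 := congrArg (· / n) h
  have h2 := congrArg (· % n) h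
  simp only [Nat.mul_add_div hn, Nat.div_eq_of_lt j.2, Nat.div_eq_of_lt j'.2, Nat.mul_add_mod,
    Nat.mod_eq_of_lt j.2, Nat.mod_eq_of_lt j'.2] at h1 h2
  exact ⟨Fin.ext h1, Fin.ext h2⟩

theorem grow (h : Stores s G k N D) (hp : IsPacking G N D) (hN : N < n ^ 4) :
    (¬ IsMaximalPacking G N D ∧ ∃ D', Stores (Cmd.grow.denote s) G k (N + 1) D' ∧
      IsPacking G (N + 1) D') ∨ (IsMaximalPacking G N D ∧ Cmd.grow.denote s = s) := by
  by_cases hex : ∃ a b c d, Fresh G N D a b c d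
  · left
    obtain ⟨a, ha, e₁⟩ := h.exists_find (x := 7) (by norm_num) (by norm_num)
      (fun s' h' _ i hi => h'.holds_fresh₁ hi) hex
    have h₁ := h.setReg (r := 7) (by norm_num) a
    obtain ⟨b, hb, e₂⟩ := h₁.exists_find (x := 8) (by norm_num) (by norm_num)
      (fun s' h' hr i hi => h'.holds_fresh₂ (a := a) (by rw [hr 7] <;> simp) hi) ha
    have h₂ := h₁.setReg (r := 8) (by norm_num) b
    obtain ⟨c, hc, e₃⟩ := h₂.exists_find (x := 9) (by norm_num) (by norm_num)
      (fun s' h' hr i hi => h'.holds_fresh₃ (a := a) (b := b) (by rw [hr 7] <;> simp)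
        (by rw [hr 8] <;> simp) hi) hb
    have h₃ := h₂.setReg (r := 9) (by norm_num) c
    obtain ⟨d, ⟨hd, hnd⟩, e₄⟩ := h₃.exists_find (x := 10) (by norm_num) (by norm_num)
      (fun s' h' hr i hi => h'.holds_isFresh (a := a) (b := b) (c := c) (by rw [hr 7] <;> simp)
        (by rw [hr 8] <;> simp) (by rw [hr 9] <;> simp) hi) hc
    have h₄ := h₃.setReg (r := 10) (by norm_num) d
    have heq : Cmd.grow.denote s = ((((((((s.setReg 7 a).setReg 8 b).setReg 9 c).setReg 10 d).setMem
        (n ^ 2 + 4 * N) a).setMem (n ^ 2 + 4 * N + 1) b).setMem (n ^ 2 + 4 * N + 2) c).setMem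
        (n ^ 2 + 4 * N + 3) d).setReg 4 (N + 1) := by
      have := h.holds_fresh.mpr hex
      rw [Tm.holds] at this
      rw [Cmd.grow, Cmd.denote, if_pos this]
      simp only [Cmd.denote, e₁, e₂, e₃, e₄, Tm.eval_entryAddr, State.setMem_reg, Tm.eval,
        h₄.reg_three, h₄.reg_four, add_zero]
      simp
    refine ⟨fun hmax => hnd (hmax hd), Function.update D N {a, b, c, d}, ?_, ?_, ?_⟩
    · rw [heq]
      constructor
      · simp [h.reg_zero]
      · simp [h.reg_one]
      · simp [h.reg_two]
      · simp [h.reg_three]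
      · simp
      · exact hN
      · intro i j
        have := addr_lt i j
        simp only [State.setReg_mem, State.setMem_mem]
        rw [if_neg (by omega), if_neg (by omega), if_neg (by omega), if_neg (by omega)]
        exact h.adj i j
      · intro q hq i
        simp only [State.setReg_mem, State.setMem_mem]
        rcases Nat.lt_succ_iff_lt_or_eq.mp hq with hq | rfl
        · rw [Function.update_of_ne hq.ne, h.member q hq]
          refine exists_congr fun c' => and_congr_right fun hc' => ?_
          rw [if_neg (by omega), if_neg (by omega), if_neg (by omega), if_neg (by omega)]
        · rw [Function.update_self]
          simp only [mem_insert, mem_singleton]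
          constructor
          · rintro (rfl | rfl | rfl | rfl)
            exacts [⟨0, by norm_num, by simp⟩, ⟨1, by norm_num, by simp⟩,
              ⟨2, by norm_num, by simp⟩, ⟨3, by norm_num, by simp⟩]
          · rintro ⟨c', hc', he⟩
            interval_cases c' <;> simp [Fin.val_inj] at he <;> simp [he]
    · intro i hi
      rcases Nat.lt_succ_iff_lt_or_eq.mp hi with hi | rfl
      · rw [Function.update_of_ne hi.ne]
        exact hp.isDiamond i hi
      · exact ⟨a, b, c, d, hd, by rw [Function.update_self]⟩
    · have key : ∀ q < N, (({a, b, c, d} : Finset (Fin n)) ∩ D q).card ≤ 2 := by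
        intro q hq
        by_contra hlt
        exact hnd ⟨q, hq, by omega⟩
      intro i hi j hj hij
      rcases Nat.lt_succ_iff_lt_or_eq.mp hi with hi | rfl <;>
        rcases Nat.lt_succ_iff_lt_or_eq.mp hj with hj | rfl
      · rw [Function.update_of_ne hi.ne, Function.update_of_ne hj.ne]
        exact hp.inter_le i hi j hj hij
      · rw [Function.update_of_ne hi.ne, Function.update_self, inter_comm]
        convert key i hi
      · rw [Function.update_of_ne hj.ne, Function.update_self]
        convert key j hj
      · exact absurd rfl hij
  · right
    refine ⟨fun a b c d hd => ?_, ?_⟩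
    · by_contra hn
      exact hex ⟨a, b, c, d, hd, hn⟩
    · have := mt h.holds_fresh.mp hex
      rw [Tm.holds] at this
      rw [Cmd.grow, Cmd.denote, if_neg this, Cmd.denote]

/-- Invariant: after `q` attempts there are `q` members or the packing is maximal. The first
alternative fails at `q = n⁴`. -/
theorem exists_maximal (h : Stores s G k 0 D) (hn : 0 < n) :
    ∃ N D, Stores ((Cmd.iterate 13 2 Cmd.grow).denote s) G k N D ∧ IsPacking G N D ∧
      IsMaximalPacking G N D := by
  obtain ⟨t, ⟨N, D, ht, hp, hN, hmax⟩, heq⟩ := Cmd.iterate_induction (x := 13) (b := 2) (c := Cmd.grow)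
    (s := s) (P := fun q t => ∃ N D, Stores t G k N D ∧ IsPacking G N D ∧ N ≤ q ∧
      (N = q ∨ IsMaximalPacking G N D))
    ⟨0, D, h, ⟨fun i hi => absurd hi (by omega), fun i hi => absurd hi (by omega)⟩, le_rfl,
      Or.inl rfl⟩ (by
      rintro q hq t ⟨N, D, ht, hp, hN, hmax⟩
      rw [h.reg_two] at hq
      rcases (ht.setReg (r := 13) (by norm_num) q).grow hp (hN.trans_lt hq) with
        ⟨hnm, D', ht', hp'⟩ | ⟨hm, he⟩
      · exact ⟨N + 1, D', ht', hp', by omega, Or.inl (by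
          rcases hmax with rfl | hmax
          · rfl
          · exact absurd hmax hnm)⟩
      · rw [he]
        exact ⟨N, D, ht.setReg (by norm_num) q, hp, by omega, Or.inr hm⟩)
  refine ⟨N, D, ?_, hp, hmax.resolve_left ?_⟩
  · rw [heq]
    exact ht.setReg (by norm_num) _
  · rw [h.reg_two]
    exact (hp.lt_pow hn).ne

/-- The new entry is computed before either symmetric entry is overwritten. The stored family
survives as data only; it need not be a packing of the new graph, and a later round discards it. -/
theorem toggle (h : Stores s G k N D) {u v : Fin n} (huv : u ≠ v) (hu : s.reg 7 = u)
    (hv : s.reg 8 = v) : Stores (Cmd.toggle.denote s) (flipPair G u v) (k - 1) N D := by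
  have heq : Cmd.toggle.denote s = (((s.setReg 9 (1 - s.mem (n * u + v))).setMem (n * u + v)
      (1 - s.mem (n * u + v))).setMem (n * v + u) (1 - s.mem (n * u + v))).setReg 1 (k - 1) := by
    simp [Cmd.toggle, Cmd.denote, Tm.eval, Tm.not, Tm.eval_adj, h.reg_zero, hu, hv, h.reg_one]
  rw [heq]
  constructor
  · simp [h.reg_zero]
  · simp
  · simp [h.reg_two]
  · simp [h.reg_three]
  · simp [h.reg_four]
  · exact h.le
  · intro i j
    simp only [State.setReg_mem, State.setMem_mem]
    have hval : 1 - s.mem (n * u + v) ≠ 0 ↔ ¬ G.Adj u v := by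
      rw [← h.adj]; omega
    simp only [flipPair]
    split_ifs with h1 h2
    · obtain ⟨rfl, rfl⟩ := addr_inj h1
      rw [hval, G.adj_comm]
      simp [huv.symm]
    · obtain ⟨rfl, rfl⟩ := addr_inj h2
      rw [hval]
      simp [huv]
    · rw [h.adj]
      have : ¬ (i = u ∧ j = v ∨ i = v ∧ j = u) := by
        rintro (⟨rfl, rfl⟩ | ⟨rfl, rfl⟩)
        exacts [h2 rfl, h1 rfl]
      simp only [this, not_false_eq_true, iff_true]
      exact ⟨fun e => ⟨e.ne, e⟩, fun e => e.2⟩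
  · intro q hq i
    rw [h.member q hq]
    have h1 := addr_lt u v
    have h2 := addr_lt v u
    simp only [State.setReg_mem, State.setMem_mem]
    refine exists_congr fun c => and_congr_right fun hc => ?_
    rw [if_neg (by omega), if_neg (by omega)]

theorem holds_heavy₁ (h : Stores s G k N D) {u : Fin n} (hu : s.reg 7 = u) :
    (Tm.sum 8 0 .isHeavy).holds s ↔ ∃ v, u ≠ v ∧ 2 * k < (pairIndices N D u v).card := by
  rw [Tm.holds_sum_fin h.reg_zero]
  exact exists_congr fun v => (h.setReg (by norm_num) v).holds_isHeavy (by simpa) (by simp)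

theorem holds_heavy (h : Stores s G k N D) :
    (Tm.sum 7 0 (.sum 8 0 .isHeavy)).holds s ↔
      ∃ u v, u ≠ v ∧ 2 * k < (pairIndices N D u v).card := by
  rw [Tm.holds_sum_fin h.reg_zero]
  exact exists_congr fun u => (h.setReg (by norm_num) u).holds_heavy₁ (by simp)

theorem step (h : Stores s G k N D) (hp : IsPacking G N D) (h5 : s.reg 5 = 0) :
    (∃ G', Stores (Cmd.step.denote s) G' (k - 1) N D ∧ k ≠ 0 ∧ (Cmd.step.denote s).reg 5 = 0 ∧
      (HasSolution G' (k - 1) ↔ HasSolution G k)) ∨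
    (Stores (Cmd.step.denote s) G k N D ∧ (Cmd.step.denote s).reg 5 ≠ 0 ∧
      (k = 0 ∨ ∀ u v, u ≠ v → (pairIndices N D u v).card ≤ 2 * k)) := by
  have hiff : (Tm.and (.sum 7 0 (.sum 8 0 .isHeavy)) (.reg 1)).holds s ↔
      (∃ u v, u ≠ v ∧ 2 * k < (pairIndices N D u v).card) ∧ k ≠ 0 := by
    rw [Tm.holds_and, h.holds_heavy, Tm.holds, Tm.eval, h.reg_one]
  by_cases hc : (∃ u v, u ≠ v ∧ 2 * k < (pairIndices N D u v).card) ∧ k ≠ 0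
  · left
    have hpos := hiff.mpr hc
    obtain ⟨u, hu, e₁⟩ := h.exists_find (x := 7) (by norm_num) (by norm_num)
      (fun s' h' _ i hi => h'.holds_heavy₁ hi) hc.1
    have h₁ := h.setReg (r := 7) (by norm_num) u
    obtain ⟨v, ⟨huv, hcard⟩, e₂⟩ := h₁.exists_find (x := 8) (by norm_num) (by norm_num)
      (fun s' h' hr i hi => h'.holds_isHeavy (u := u) (by rw [hr 7] <;> simp) hi) hu
    have h₂ := h₁.setReg (r := 8) (by norm_num) v
    have heq : Cmd.step.denote s = Cmd.toggle.denote ((s.setReg 7 u).setReg 8 v) := by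
      rw [Tm.holds] at hpos
      rw [Cmd.step, Cmd.denote, if_pos hpos]
      simp only [Cmd.denote, e₁, e₂]
    refine ⟨flipPair G u v, ?_, hc.2, ?_, hp.hasSolution_flipPair_iff huv hcard hc.2⟩
    · rw [heq]
      exact h₂.toggle huv (by simp) (by simp)
    · rw [heq, Cmd.denote_reg_of_mem (l := [5]) (by decide) (by simp)]
      simpa
  · right
    have heq : Cmd.step.denote s = s.setReg 5 1 := by
      have hneg := mt hiff.mp hc
      rw [Tm.holds] at hneg
      rw [Cmd.step, Cmd.denote, if_neg hneg]
      rfl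
    rw [heq]
    refine ⟨h.setReg le_rfl 1, by simp, ?_⟩
    by_cases hk : k = 0
    · exact Or.inl hk
    · right
      intro u v huv
      by_contra hlt
      exact hc ⟨⟨u, v, huv, by omega⟩, hk⟩

/-- The outcome of the packing phase: no edit is forced. -/
structure IsReduced (G : SimpleGraph (Fin n)) (k N : ℕ) (D : ℕ → Finset (Fin n)) : Prop where
  isPacking : IsPacking G N D
  isMaximal : IsMaximalPacking G N D
  light : k = 0 ∨ ∀ u v, u ≠ v → (pairIndices N D u v).card ≤ 2 * k

theorem round (h : Stores s G k N D) (hn : 0 < n) (h5 : s.reg 5 = 0) :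
    (∃ (G' : SimpleGraph (Fin n)) (N' : ℕ) (D' : ℕ → Finset (Fin n)),
      Stores (Cmd.round.denote s) G' (k - 1) N' D' ∧ k ≠ 0 ∧
      (Cmd.round.denote s).reg 5 = 0 ∧ (HasSolution G' (k - 1) ↔ HasSolution G k)) ∨
    (∃ N' D', Stores (Cmd.round.denote s) G k N' D' ∧ (Cmd.round.denote s).reg 5 ≠ 0 ∧
      IsReduced G k N' D') := by
  have heq : Cmd.round.denote s =
      Cmd.step.denote ((Cmd.iterate 13 2 Cmd.grow).denote (s.setReg 4 0)) := by
    rw [Cmd.round, Cmd.denote, if_neg (by simpa [Tm.eval] using h5)]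
    simp only [Cmd.denote, Tm.eval]
  have h₀ : Stores (s.setReg 4 0) G k 0 D :=
    ⟨by simp [h.reg_zero], by simp [h.reg_one], by simp [h.reg_two], by simp [h.reg_three],
      by simp, Nat.zero_le _, h.adj, fun q hq => absurd hq (by omega)⟩
  obtain ⟨N', D', h', hp, hm⟩ := h₀.exists_maximal hn
  have h5' : ((Cmd.iterate 13 2 Cmd.grow).denote (s.setReg 4 0)).reg 5 = 0 := by
    rw [Cmd.denote_reg_of_mem (l := [0, 2, 5]) (by decide) (by simp)]
    simpa
  rw [heq]
  rcases h'.step hp h5' with ⟨G', h1, h2, h3, h4⟩ | ⟨h1, h2, h3⟩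
  · exact Or.inl ⟨G', N', D', h1, h2, h3, h4⟩
  · exact Or.inr ⟨N', D', h1, h2, hp, hm, h3⟩

/-- Each round either lowers the parameter or raises the flag in register `5`, after which rounds do
nothing. Since `k < n`, `n` rounds suffice. -/
theorem exists_reduced (h : Stores s G k N D) (hk : k < n) (h5 : s.reg 5 = 0) :
    ∃ (G' : SimpleGraph (Fin n)) (k' N' : ℕ) (D' : ℕ → Finset (Fin n)),
      Stores ((Cmd.iterate 6 0 Cmd.round).denote s) G' k' N' D' ∧
      IsReduced G' k' N' D' ∧ k' ≤ k ∧ (HasSolution G' k' ↔ HasSolution G k) := by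
  obtain ⟨t, ⟨G', k', N', D', ht, hle, hiff, hd⟩, heq⟩ := Cmd.iterate_induction (x := 6) (b := 0)
    (c := Cmd.round) (s := s) (P := fun q t => ∃ (G' : SimpleGraph (Fin n)) (k' N' : ℕ)
      (D' : ℕ → Finset (Fin n)), Stores t G' k' N' D' ∧ k' ≤ k ∧
      (HasSolution G' k' ↔ HasSolution G k) ∧
      (t.reg 5 = 0 ∧ k' + q ≤ k ∨ t.reg 5 ≠ 0 ∧ IsReduced G' k' N' D'))
    ⟨G, k, N, D, h, le_rfl, Iff.rfl, Or.inl ⟨h5, le_rfl⟩⟩ (by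
      rintro q hq t ⟨G', k', N', D', ht, hle, hiff, hd⟩
      have ht' := ht.setReg (r := 6) (by norm_num) q
      rcases hd with ⟨h5, hkq⟩ | ⟨h5, hred⟩
      · rcases ht'.round (by omega) (by simpa) with ⟨G₁, N₁, D₁, h1, h2, h3, h4⟩ | ⟨N₁, D₁, h1, h2, h3⟩
        · exact ⟨G₁, k' - 1, N₁, D₁, h1, by omega, h4.trans hiff, Or.inl ⟨h3, by omega⟩⟩
        · exact ⟨G', k', N₁, D₁, h1, hle, hiff, Or.inr ⟨h2, h3⟩⟩
      · have : Cmd.round.denote (t.setReg 6 q) = t.setReg 6 q := by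
          rw [Cmd.round, Cmd.denote, if_pos (by simpa [Tm.eval] using h5), Cmd.denote]
        rw [this]
        exact ⟨G', k', N', D', ht', hle, hiff, Or.inr ⟨by simpa, hred⟩⟩)
  rw [h.reg_zero] at hd
  refine ⟨G', k', N', D', ?_, ?_, hle, hiff⟩
  · rw [heq]
    exact ht.setReg (by norm_num) _
  · rcases hd with ⟨-, hkn⟩ | ⟨-, hred⟩
    · omega
    · exact hred

end Stores

end RAM

/-! ### Writing the output, and the running time -/

namespace RAM

open Classical Finset

namespace Tm

theorem eval_lt {s : State} {a b : Tm} : (lt a b).eval s = b.eval s - a.eval s := rfl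

/-- `v` is a vertex of the output: if register `5` is zero, a vertex of the kernel, and otherwise a
vertex of the first member of the packing. -/
def inOutput (v : ℕ) : Tm :=
  add (and (reg 5) (inMember v 14)) (and (not (reg 5)) (inKernel v))

/-- Register `13` is the address of an edge in the adjacency matrix of the output, whose number of
vertices is in register `11`. -/
def isEdge : Tm :=
  sum 15 0 (sum 16 0 (and (and (inOutput 15) (inOutput 16)) (and (adj 15 16) (eq (reg 13)
    (add (scale 17 (and (inOutput 17) (lt (reg 17) (reg 15))) (reg 11))
      (count 18 0 (and (inOutput 18) (lt (reg 18) (reg 16)))))))))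

/-- The address of a copy of the adjacency matrix of the output. -/
def outputAddr : Tm :=
  add (add (reg 3) (add (add (reg 2) (reg 2)) (add (reg 2) (reg 2)))) (reg 13)

end Tm

namespace Cmd

/-- Replaces the instance by a no-instance if the packing has more than `4k²` members. -/
def conclude : Cmd :=
  seq (assign 14 (.const 0))
    (seq (assign 5 (.lt (.scale 7 (.lt (.reg 7) (.reg 1))
      (.add (.add (.reg 1) (.reg 1)) (.add (.reg 1) (.reg 1)))) (.reg 4)))
      (ite (.reg 5) (assign 1 (.const 0)) skip))

def output : Cmd :=
  seq (assign 11 (.count 17 0 (.inOutput 17)))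
    (seq (.iterate 13 2 (store .outputAddr (.not (.not .isEdge))))
      (.iterate 13 2 (store (.reg 13) (.load .outputAddr))))

def kernelize : Cmd :=
  ite (.sub (.reg 0) (.reg 1))
    (seq (assign 3 (.sum 7 0 (.reg 0))) (seq (.iterate 6 0 round) (seq conclude output)))
    (assign 11 (.reg 0))

end Cmd

variable {s : State} {n k N : ℕ} {G : SimpleGraph (Fin n)} {D : ℕ → Finset (Fin n)}
  {M : Finset (Fin n)}

/-- `M` is the set of the output vertices. -/
structure Selects (s : State) {n : ℕ} (G : SimpleGraph (Fin n)) (k N : ℕ)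
    (D : ℕ → Finset (Fin n)) (M : Finset (Fin n)) : Prop extends Stores s G k N D where
  cases : s.reg 5 ≠ 0 ∧ s.reg 14 = 0 ∧ 0 < N ∧ M = D 0 ∨ s.reg 5 = 0 ∧ M = kernelVerts G k N D

namespace Selects

theorem setReg (h : Selects s G k N D M) {r : ℕ} (hr : 6 ≤ r) (hr' : r ≠ 14) (v : ℕ) :
    Selects (s.setReg r v) G k N D M where
  toStores := h.toStores.setReg (by omega) v
  cases := by
    rw [State.setReg_reg_of_ne _ _ (by omega), State.setReg_reg_of_ne _ _ hr'.symm]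
    exact h.cases

/-- These addresses lie beyond the adjacency matrix and the space reserved for the packing. -/
theorem setMem (h : Selects s G k N D M) {a : ℕ} (ha : n ^ 2 + 4 * n ^ 4 ≤ a) (v : ℕ) :
    Selects (s.setMem a v) G k N D M where
  reg_zero := h.reg_zero
  reg_one := h.reg_one
  reg_two := h.reg_two
  reg_three := h.reg_three
  reg_four := h.reg_four
  le := h.le
  adj i j := by
    have := Stores.addr_lt i j
    rw [State.setMem_mem, if_neg (by omega), h.adj]
  member q hq i := by
    have := h.le
    rw [h.member q hq]
    refine exists_congr fun c => and_congr_right fun hc => ?_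
    rw [State.setMem_mem, if_neg (by omega)]
  cases := h.cases

theorem holds_inOutput (h : Selects s G k N D M) {v : ℕ} (hv : v < 19) {i : Fin n}
    (hi : s.reg v = i) : (Tm.inOutput v).holds s ↔ i ∈ M := by
  rw [Tm.inOutput, Tm.holds_add, Tm.holds_and, Tm.holds_and, Tm.holds_not,
    h.holds_inKernel hv hi]
  have h5 : (Tm.reg 5).holds s ↔ s.reg 5 ≠ 0 := Iff.rfl
  rw [h5]
  rcases h.cases with ⟨hne, h14, hN, rfl⟩ | ⟨heq, rfl⟩
  · rw [h.holds_inMember hi (by rwa [h14]), h14]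
    tauto
  · tauto

theorem card_le (_ : Selects s G k N D M) : M.card ≤ n := by
  simpa using M.card_le_univ

end Selects

/-- The position of the vertex `i` in `M`. -/
noncomputable def rank (M : Finset (Fin n)) (i : Fin n) : ℕ := (M.filter fun j => j < i).card

theorem rank_orderEmbOfFin (M : Finset (Fin n)) (a : Fin M.card) :
    rank M (M.orderEmbOfFin rfl a) = a := by
  have : (M.filter fun j => j < M.orderEmbOfFin rfl a) =
      (Iio a).map (M.orderEmbOfFin rfl).toEmbedding := by
    ext j
    simp only [mem_filter, Finset.mem_map, mem_Iio, RelEmbedding.coe_toEmbedding]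
    constructor
    · rintro ⟨hj, hlt⟩
      have : j ∈ Set.range (M.orderEmbOfFin rfl) := by rwa [range_orderEmbOfFin]
      obtain ⟨b, rfl⟩ := this
      exact ⟨b, (OrderEmbedding.lt_iff_lt _).mp hlt, rfl⟩
    · rintro ⟨b, hb, rfl⟩
      exact ⟨orderEmbOfFin_mem _ _ _, (OrderEmbedding.lt_iff_lt _).mpr hb⟩
  rw [rank, this, card_map, Fin.card_Iio]

/-- The position `q` of the adjacency matrix of the graph induced by `M` belongs to an edge. -/
def EdgeAt (G : SimpleGraph (Fin n)) (M : Finset (Fin n)) (q : ℕ) : Prop :=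
  ∃ i j, (i ∈ M ∧ j ∈ M) ∧ G.Adj i j ∧ q = rank M i * M.card + rank M j

/-- `rank` inverts the increasing enumeration of `M`, and a position in the matrix determines its
row and column. -/
theorem edgeAt_iff (a b : Fin M.card) : EdgeAt G M (a * M.card + b) ↔
    (G.comap (M.orderEmbOfFin rfl).toEmbedding).Adj a b := by
  have hex : ∀ i ∈ M, ∃ a, M.orderEmbOfFin rfl a = i := by
    intro i hi
    have : i ∈ Set.range (M.orderEmbOfFin rfl) := by rwa [range_orderEmbOfFin]
    exact this
  constructor
  · rintro ⟨i, j, ⟨hi, hj⟩, hG, hq⟩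
    obtain ⟨a', rfl⟩ := hex i hi
    obtain ⟨b', rfl⟩ := hex j hj
    rw [rank_orderEmbOfFin, rank_orderEmbOfFin, mul_comm, mul_comm (a' : ℕ)] at hq
    obtain ⟨rfl, rfl⟩ := Stores.addr_inj hq
    exact hG
  · intro hG
    exact ⟨_, _, ⟨orderEmbOfFin_mem _ _ a, orderEmbOfFin_mem _ _ b⟩, hG, by
      rw [rank_orderEmbOfFin, rank_orderEmbOfFin]⟩

namespace Selects

theorem eval_card (h : Selects s G k N D M) : (Tm.count 17 0 (.inOutput 17)).eval s = M.card := by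
  rw [Tm.eval_count_fin h.reg_zero]
  have : ∀ i : Fin n, (Tm.inOutput 17).holds (s.setReg 17 i) ↔ i ∈ M := fun i =>
    (h.setReg (by norm_num) (by norm_num) i).holds_inOutput (by norm_num) (by simp)
  simp only [this, filter_univ_mem]

theorem holds_isEdge (h : Selects s G k N D M) (hm : s.reg 11 = M.card) :
    Tm.isEdge.holds s ↔ EdgeAt G M (s.reg 13) := by
  rw [Tm.isEdge, Tm.holds_sum_fin h.reg_zero]
  refine exists_congr fun i => ?_
  rw [Tm.holds_sum_fin (h.setReg (by norm_num) (by norm_num) _).reg_zero]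
  refine exists_congr fun j => ?_
  have hs := (h.setReg (r := 15) (by norm_num) (by norm_num) i).setReg (r := 16) (by norm_num)
    (by norm_num) j
  rw [Tm.holds_and, Tm.holds_and, Tm.holds_and, hs.holds_inOutput (i := i) (by norm_num) (by simp),
    hs.holds_inOutput (i := j) (by norm_num) (by simp),
    hs.holds_adj (i := i) (j := j) (by norm_num) (by simp) (by simp), Tm.holds_eq]
  refine and_congr_right fun _ => and_congr_right fun _ => ?_
  have h1 : ∀ (q : ℕ) (w : Fin n), ((Tm.inOutput 17).and ((Tm.reg 17).lt (Tm.reg 15))).holds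
      ((((s.setReg 15 i).setReg 16 j).setReg 17 w).setReg 28 q) ↔ w ∈ M ∧ w < i := by
    intro q w
    rw [Tm.holds_and, ((hs.setReg (by norm_num) (by norm_num) _).setReg (by norm_num) (by norm_num)
      q).holds_inOutput (i := w) (by norm_num) (by simp), Tm.holds_lt]
    simp [Tm.eval]
  have h2 : ∀ w : Fin n, ((Tm.inOutput 18).and ((Tm.reg 18).lt (Tm.reg 16))).holds
      (((s.setReg 15 i).setReg 16 j).setReg 18 w) ↔ w ∈ M ∧ w < j := by
    intro w
    rw [Tm.holds_and, (hs.setReg (by norm_num) (by norm_num) _).holds_inOutput (i := w)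
      (by norm_num) (by simp), Tm.holds_lt]
    simp [Tm.eval]
  have hle : M.card ≤ n ^ 4 := h.card_le.trans (Nat.le_self_pow (by norm_num) n)
  have h3 : (Tm.scale 17 ((Tm.inOutput 17).and ((Tm.reg 17).lt (Tm.reg 15))) (.reg 11)).eval
      ((s.setReg 15 i).setReg 16 j) = rank M i * M.card := by
    rw [Tm.eval_scale (V := M.card) hs.reg_zero (by norm_num) (by rw [hs.reg_two]; exact hle)
      (fun q => by simp [Tm.eval, hm]) h1, rank]
    refine congrArg (fun A : Finset (Fin n) => A.card * M.card) ?_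
    ext
    simp
  have h4 : (Tm.count 18 0 ((Tm.inOutput 18).and ((Tm.reg 18).lt (Tm.reg 16)))).eval
      ((s.setReg 15 i).setReg 16 j) = rank M j := by
    rw [Tm.eval_count_fin hs.reg_zero, rank]
    simp only [h2]
    refine congrArg Finset.card ?_
    ext
    simp
  rw [Tm.eval, Tm.eval, h3, h4]
  simp

theorem eval_outputAddr (h : Selects s G k N D M) :
    Tm.outputAddr.eval s = n ^ 2 + 4 * n ^ 4 + s.reg 13 := by
  simp only [Tm.outputAddr, Tm.eval, h.reg_two, h.reg_three]
  ring

/-- The input matrix must stay readable while the edges are computed, so the new matrix is built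
beyond the packing and then copied to the front. -/
theorem output (h : Selects s G k N D M) : (Cmd.output.denote s).reg 1 = k ∧
    (Cmd.output.denote s).reg 11 = M.card ∧
    ∀ q < n ^ 4, (Cmd.output.denote s).mem q = if EdgeAt G M q then 1 else 0 := by
  obtain ⟨t₁, ⟨h₁, hm₁, hq₁⟩, e₁⟩ := Cmd.iterate_induction (x := 13) (b := 2)
    (c := .store .outputAddr (.not (.not .isEdge))) (s := s.setReg 11 M.card)
    (P := fun q t => Selects t G k N D M ∧ t.reg 11 = M.card ∧
      ∀ p < q, t.mem (n ^ 2 + 4 * n ^ 4 + p) = if EdgeAt G M p then 1 else 0)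
    ⟨h.setReg (by norm_num) (by norm_num) _, by simp, fun p hp => absurd hp (by omega)⟩ (by
      rintro q - t ⟨ht, htm, htq⟩
      have ht' := ht.setReg (r := 13) (by norm_num) (by norm_num) q
      have hv := ht'.holds_isEdge (by simpa using htm)
      rw [State.setReg_reg_self] at hv
      simp only [Cmd.denote, Tm.eval_not_not, hv]
      rw [ht'.eval_outputAddr, State.setReg_reg_self]
      refine ⟨ht'.setMem (by omega) _, by simpa using htm, fun p hp => ?_⟩
      rw [State.setMem_mem]
      rcases Nat.lt_succ_iff_lt_or_eq.mp hp with hp | rfl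
      · rw [if_neg (by omega)]
        exact htq p hp
      · rw [if_pos rfl])
  -- During the copying the input graph is overwritten, so the invariant retains only four registers
  -- and the finished copy.
  obtain ⟨t₂, ⟨h0, h1, h2, h3, -, hq₂⟩, e₂⟩ := Cmd.iterate_induction (x := 13) (b := 2)
    (c := .store (.reg 13) (.load .outputAddr)) (s := t₁.setReg 13 (n ^ 4))
    (P := fun q t => t.reg 1 = k ∧ t.reg 11 = M.card ∧ t.reg 2 = n ^ 4 ∧ t.reg 3 = n ^ 2 ∧
      (∀ p < n ^ 4, t.mem (n ^ 2 + 4 * n ^ 4 + p) = if EdgeAt G M p then 1 else 0) ∧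
      ∀ p < q, t.mem p = if EdgeAt G M p then 1 else 0)
    ⟨by simp [h₁.reg_one], by simpa using hm₁, by simp [h₁.reg_two], by simp [h₁.reg_three],
      by simpa [h.reg_two] using hq₁, fun p hp => absurd hp (by omega)⟩ (by
      rintro q hq t ⟨h0, h1, h2, h3, hb, hp⟩
      rw [State.setReg_reg_of_ne _ _ (by norm_num), h₁.reg_two] at hq
      have haddr : Tm.outputAddr.eval (t.setReg 13 q) = n ^ 2 + 4 * n ^ 4 + q := by
        simp [Tm.outputAddr, Tm.eval, h2, h3]
        ring
      simp only [Cmd.denote, Tm.eval, haddr, State.setReg_reg_self, State.setReg_mem, hb q hq]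
      refine ⟨by simpa, by simpa, by simpa, by simpa, fun p hp => ?_, fun p hpq => ?_⟩
      · rw [State.setMem_mem, if_neg (by omega)]
        exact hb p hp
      · rw [State.setMem_mem]
        rcases Nat.lt_succ_iff_lt_or_eq.mp hpq with hpq | rfl
        · rw [if_neg (by omega)]
          exact hp p hpq
        · rw [if_pos rfl])
  have heq : Cmd.output.denote s = t₂.setReg 13 (n ^ 4) := by
    have hr : (s.setReg 11 M.card).reg 2 = n ^ 4 := by simp [h.reg_two]
    have hr' : (t₁.setReg 13 (n ^ 4)).reg 2 = n ^ 4 := by simp [h₁.reg_two]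
    rw [hr] at e₁
    rw [hr'] at e₂
    rw [Cmd.output, Cmd.denote, Cmd.denote, Cmd.denote, h.eval_card, e₁, e₂]
  rw [heq]
  refine ⟨by simpa, by simpa, fun q hq => hq₂ q ?_⟩
  simpa [h₁.reg_two] using hq

end Selects

/-- The threshold `4k²` is computed as a sum of `k` terms `4k`. Here `k < n` is needed, both for the
range of the sum and for `4k ≤ n⁴`. -/
theorem Stores.conclude (h : Stores s G k N D) (hr : IsReduced G k N D) (hk : k < n) :
    ∃ k' M, Selects (Cmd.conclude.denote s) G k' N D M ∧ k' ≤ k ∧ M.card ≤ kernelBound k ∧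
      (HasSolution (inducedInstance G M k').graph k' ↔ HasSolution G k) := by
  have h' := h.setReg (r := 14) (by norm_num) 0
  have hscale : (Tm.scale 7 (.lt (.reg 7) (.reg 1))
      (.add (.add (.reg 1) (.reg 1)) (.add (.reg 1) (.reg 1)))).eval (s.setReg 14 0) =
      4 * k * k := by
    rw [Tm.eval_scale (V := 4 * k) (P := fun i : Fin n => (i : ℕ) < k) h'.reg_zero (by norm_num) ?_
      (fun i => by simp [Tm.eval, h.reg_one]; ring) fun j i => by
        simp [Tm.eval, h.reg_one], ← Tm.card_filter_range fun i => i < k]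
    · have hrange : ∀ A : Finset ℕ, A = range k → A.card * (4 * k) = 4 * k * k := by
        rintro _ rfl
        rw [card_range]
        ring
      refine hrange _ ?_
      ext i
      simp only [mem_filter, mem_range]
      omega
    · rw [h'.reg_two]
      obtain ⟨m, rfl⟩ : ∃ m, n = m + 1 := ⟨n - 1, by omega⟩
      have h1 : 4 * m ≤ (m + 1) ^ 2 := by
        zify
        nlinarith [sq_nonneg ((m : ℤ) - 1)]
      have h2 : (m + 1) ^ 2 ≤ (m + 1) ^ 4 := Nat.pow_le_pow_right (by omega) (by norm_num)
      omega
  have h14 : (s.setReg 14 0).reg 4 = N := by simp [h.reg_four]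
  by_cases hN : 4 * k * k < N
  · have heq : Cmd.conclude.denote s = ((s.setReg 14 0).setReg 5 (N - 4 * k * k)).setReg 1 0 := by
      simp only [Cmd.conclude, Cmd.denote, Tm.eval_lt, Tm.eval, hscale, h14]
      rw [if_pos (by rw [State.setReg_reg_self]; omega)]
    rw [heq]
    -- The packing is too large: one member with parameter zero is an equivalent no-instance. Its
    -- four vertices account for the summand `4` of `kernelBound`.
    refine ⟨0, D 0, ⟨⟨by simp [h.reg_zero], by simp, by simp [h.reg_two], by simp [h.reg_three],
      by simp [h.reg_four], h.le, h.adj, h.member⟩, Or.inl ⟨?_, by simp, by omega, rfl⟩⟩,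
      Nat.zero_le _, ?_, ?_⟩
    · rw [State.setReg_reg_of_ne _ _ (by norm_num), State.setReg_reg_self]
      omega
    · rw [hr.isPacking.card_eq (by omega)]
      unfold kernelBound
      omega
    · refine iff_of_false (not_hasSolution_member hr.isPacking (by omega)) fun hs => ?_
      exact absurd (hr.isPacking.le_of_hasSolution hs hr.light) (not_le.mpr hN)
  · have heq : Cmd.conclude.denote s = (s.setReg 14 0).setReg 5 0 := by
      simp only [Cmd.conclude, Cmd.denote, Tm.eval_lt, Tm.eval, hscale, h14]
      rw [if_neg (by rw [State.setReg_reg_self]; omega)]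
      congr 1
      omega
    rw [heq]
    exact ⟨k, kernelVerts G k N D, ⟨h'.setReg le_rfl 0, Or.inr ⟨by simp, rfl⟩⟩, le_rfl,
      hr.isPacking.card_kernelVerts_le (not_lt.mp hN), hasSolution_kernel_iff hr.isMaximal⟩

/-- The kernel is bounded in terms of the parameter left after the forced edits, which is at most
the original one. -/
theorem kernelBound_mono : Monotone kernelBound := by
  intro a b hab
  unfold kernelBound baseBound
  gcongr

/-- `J` is a kernel of `I`. -/
def IsKernel (I J : GraphInstance) : Prop :=
  (DiamondFreeEditing J ↔ DiamondFreeEditing I) ∧ J.k ≤ I.k ∧ J.n ≤ kernelBound I.k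

/-- The adjacency matrix of `I` is in memory. -/
def HoldsMatrix (s : State) (I : GraphInstance) : Prop :=
  ∀ i j : Fin I.n, (I.graph.Adj i j → s.mem (i * I.n + j) = 1) ∧
    (¬ I.graph.Adj i j → s.mem (i * I.n + j) = 0)

theorem exists_isKernel (I : GraphInstance) (h0 : s.reg 0 = I.n) (h1 : s.reg 1 = I.k)
    (h2 : s.reg 2 = I.n ^ 4) (h4 : s.reg 4 = 0) (h5 : s.reg 5 = 0) (hm : HoldsMatrix s I) :
    ∃ J, IsKernel I J ∧ (Cmd.kernelize.denote s).reg 11 = J.n ∧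
      (Cmd.kernelize.denote s).reg 1 = J.k ∧ HoldsMatrix (Cmd.kernelize.denote s) J := by
  by_cases hk : I.k < I.n
  · have hst : Stores (s.setReg 3 (I.n ^ 2)) I.graph I.k 0 fun _ => ∅ := by
      refine ⟨by simp [h0], by simp [h1], by simp [h2], by simp, by simp [h4], Nat.zero_le _,
        fun i j => ?_, fun q hq => absurd hq (by omega)⟩
      rw [State.setReg_mem, mul_comm]
      by_cases hadj : I.graph.Adj i j
      · simp [(hm i j).1 hadj, hadj]
      · simp [(hm i j).2 hadj, hadj]
    obtain ⟨G, k', N, D, hst', hred, hk', hiff⟩ := hst.exists_reduced hk (by simpa)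
    obtain ⟨k'', M, hsel, hk'', hcard, hiff'⟩ := hst'.conclude hred (by omega)
    obtain ⟨ho1, ho11, hoq⟩ := hsel.output
    have heq : Cmd.kernelize.denote s = Cmd.output.denote (Cmd.conclude.denote
        ((Cmd.iterate 6 0 Cmd.round).denote (s.setReg 3 (I.n ^ 2)))) := by
      have hsq : (Tm.sum 7 0 (.reg 0)).eval s = I.n ^ 2 := by simp [Tm.eval, h0, sq]
      rw [Cmd.kernelize, Cmd.denote, if_pos (by simp only [Tm.eval, h0, h1]; omega)]
      simp only [Cmd.denote, hsq]
    refine ⟨inducedInstance G M k'', ⟨?_, hk''.trans hk', hcard.trans (kernelBound_mono hk')⟩,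
      ?_, ?_, fun a b => ?_⟩
    · rw [diamondFreeEditing_iff, diamondFreeEditing_iff]
      exact hiff'.trans hiff
    · rw [heq, ho11, inducedInstance]
    · rw [heq, ho1, inducedInstance]
    · have hlt : (a * M.card + b : ℕ) < I.n ^ 4 := by
        have h1 := Stores.addr_lt a b
        have h2 : M.card ^ 2 ≤ I.n ^ 2 := Nat.pow_le_pow_left hsel.card_le 2
        have h3 : I.n ^ 2 ≤ I.n ^ 4 := Nat.pow_le_pow_right (by omega) (by norm_num)
        rw [mul_comm]
        exact h1.trans_le (h2.trans h3)
      have := hoq _ hlt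
      rw [← heq] at this
      constructor
      · intro hadj
        exact this.trans (if_pos ((edgeAt_iff a b).mpr hadj))
      · intro hadj
        exact this.trans (if_neg (mt (edgeAt_iff a b).mp hadj))
  · have heq : Cmd.kernelize.denote s = s.setReg 11 I.n := by
      rw [Cmd.kernelize, Cmd.denote, if_neg (by simp only [Tm.eval, h0, h1]; omega)]
      simp [Cmd.denote, Tm.eval, h0]
    rw [heq]
    -- Here `n ≤ k`, which is what the summand `k` of `kernelBound` is for.
    refine ⟨I, ⟨Iff.rfl, le_rfl, ?_⟩, by simp, by simpa, hm⟩
    unfold kernelBound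
    omega

theorem Cmd.kernelize_ok : Cmd.kernelize.ok [0, 2] = true := by decide

/-- The program: register `2` becomes the fourth power of the number of vertices. -/
def kernelProgram : Program :=
  .seq ((Tm.sum 7 0 (.sum 8 0 (.sum 9 0 (.reg 0)))).comp 30)
    (.seq (.assign 2 (.reg 30)) (.seq Cmd.kernelize.comp (.assign 0 (.reg 11))))

noncomputable def kernelTime : Polynomial ℕ :=
  (Tm.sum 7 0 (.sum 8 0 (.sum 9 0 (.reg 0)))).cost +
    (Cmd.kernelize.cost.comp (Polynomial.X ^ 4) + 4)

theorem eval_mono (p : Polynomial ℕ) : Monotone fun x => p.eval x := by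
  intro a b hab
  simp only [Polynomial.eval_eq_sum_range]
  gcongr

/-- The prologue computes `n⁴`, which bounds both loop limits of the main command. The time is
polynomial in `n` alone, and monotonicity inserts the binary length of `k`. -/
theorem exists_runs (I : GraphInstance) (hs : IsInitial s I) :
    ∃ J s' t, IsKernel I J ∧ Runs kernelProgram s s' t ∧ Holds s' J ∧
      t ≤ kernelTime.eval (I.n + Nat.size I.k) := by
  obtain ⟨⟨h0, h1, hm⟩, hreg, -⟩ := hs
  obtain ⟨s₁, τ₁, hr₁, hτ₁, hm₁, he₁, hf₁⟩ := Tm.comp_runs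
    (t := .sum 7 0 (.sum 8 0 (.sum 9 0 (.reg 0)))) (by decide) le_rfl (s := s) (Z := I.n) h0.le
    (by rw [hreg 2 le_rfl]; exact Nat.zero_le _)
  have hpow : (Tm.sum 7 0 (.sum 8 0 (.sum 9 0 (.reg 0)))).eval s = I.n ^ 4 := by
    simp [Tm.eval, h0]
    ring
  rw [hpow] at he₁
  obtain ⟨s₂, τ₂, hr₂, hτ₂, hm₂, hf₂⟩ := Cmd.comp_runs Cmd.kernelize_ok (by simp) (by simp)
    (s := s₁.setReg 2 (s₁.reg 30)) (σ := s.setReg 2 (I.n ^ 4)) (Z := I.n ^ 4) hm₁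
    (fun r hr => by rw [State.setReg_reg, State.setReg_reg, he₁, hf₁ r hr])
    (by simpa [h0] using Nat.le_self_pow (by norm_num) I.n) (by simp)
  obtain ⟨J, hJ, hn, hk, hmat⟩ := exists_isKernel (s := s.setReg 2 (I.n ^ 4)) I (by simpa) (by simpa)
    (by simp) (by simp [hreg]) (by simp [hreg]) hm
  refine ⟨J, _, _, hJ, .seq hr₁ (.seq (.assign _ _ _) (.seq hr₂ (.assign _ _ _))), ⟨?_, ?_, ?_⟩, ?_⟩
  · simp [Expr.eval, hf₂, hn]
  · simp [hf₂, hk]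
  · intro i j
    simpa only [hm₂] using hmat i j
  · refine le_trans ?_ (eval_mono kernelTime (Nat.le_add_right _ _))
    simp [kernelTime, Expr.cost]
    omega

theorem exists_isInitial (I : GraphInstance) : ∃ s, IsInitial s I := by
  refine ⟨⟨fun r => if r = 0 then I.n else if r = 1 then I.k else 0, fun a =>
    if ∃ i j : Fin I.n, a = I.n * i + j ∧ I.graph.Adj i j then 1 else 0⟩, ⟨rfl, rfl, fun i j => ?_⟩,
    fun r hr => ?_, fun a ha => ?_⟩
  · rw [mul_comm]
    refine ⟨fun h => if_pos ⟨i, j, rfl, h⟩, fun h => if_neg ?_⟩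
    rintro ⟨i', j', he, h'⟩
    obtain ⟨rfl, rfl⟩ := Stores.addr_inj he
    exact h h'
  · simp only
    rw [if_neg (by omega), if_neg (by omega)]
  · refine if_neg ?_
    rintro ⟨i, j, rfl, -⟩
    have := Stores.addr_lt i j
    rw [sq] at this
    omega

/-- This allows the output instance to be chosen from a single run for each input. -/
theorem IsInitial.unique {I : GraphInstance} {s s' : State} (h : IsInitial s I)
    (h' : IsInitial s' I) : s = s' := by
  obtain ⟨⟨h0, h1, hm⟩, hr, hz⟩ := h
  obtain ⟨⟨h0', h1', hm'⟩, hr', hz'⟩ := h'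
  have hreg : s.reg = s'.reg := by
    funext r
    match r with
    | 0 => rw [h0, h0']
    | 1 => rw [h1, h1']
    | r + 2 => rw [hr _ (by omega), hr' _ (by omega)]
  have hmem : s.mem = s'.mem := by
    funext a
    by_cases ha : a < I.n * I.n
    · have hn : 0 < I.n := Nat.pos_of_ne_zero fun e => by simp [e] at ha
      have hd : a = a / I.n * I.n + a % I.n := by rw [mul_comm]; exact (Nat.div_add_mod a I.n).symm
      have h1 := hm ⟨a / I.n, Nat.div_lt_of_lt_mul ha⟩ ⟨a % I.n, Nat.mod_lt _ hn⟩
      have h2 := hm' ⟨a / I.n, Nat.div_lt_of_lt_mul ha⟩ ⟨a % I.n, Nat.mod_lt _ hn⟩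
      simp only [← hd] at h1 h2
      by_cases hadj : I.graph.Adj ⟨a / I.n, Nat.div_lt_of_lt_mul ha⟩ ⟨a % I.n, Nat.mod_lt _ hn⟩
      · rw [h1.1 hadj, h2.1 hadj]
      · rw [h1.2 hadj, h2.2 hadj]
    · rw [hz a (not_lt.mp ha), hz' a (not_lt.mp ha)]
  cases s
  cases s'
  simp_all

end RAM

theorem theorem1 :
    ∃ g : ℕ → ℕ,
      ((fun k : ℕ => (g k : ℝ)) =O[atTop] fun k : ℕ => (k : ℝ) ^ 8) ∧
      HasVertexKernel DiamondFreeEditing g := by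
  choose s hs using RAM.exists_isInitial
  choose f s' t hf hrun hhold ht using fun I => RAM.exists_runs I (hs I)
  refine ⟨kernelBound, kernelBound_isBigO, f, ⟨RAM.kernelProgram, RAM.kernelTime, fun I s₀ h₀ => ?_⟩, hf⟩
  rw [h₀.unique (hs I)]
  exact ⟨s' I, t I, hrun I, hhold I, ht I⟩
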